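/- **Setting.** Fix $p$ and $\beta\in\mathbb R^p$. For each $n$ let $Y=X\beta+\epsilon$, where $X=(x_{ij})$ is a non-random $n\times p$ matrix, $\epsilon=(\epsilon_1,\dots,\epsilon_n)^T$ is a random vector with $\mathbb E\epsilon=0$ and $\Sigma=\mathbb E\epsilon\epsilon^T$, and let $d$ be a distance on $\{1,\dots,n\}$ (symmetric, zero on the diagonal, satisfying the triangle inequality, with values in $[0,\infty]$), for example the shortest path distance of a network on these nodes. The dependence of $X,Y,\epsilon,\Sigma,d$ on $n$ is suppressed. For index sets $U,V$ put $d(U,V)=\min_{i\in U,j\in V}d(i,j)$, and let $N_m(i)=\#\{j:d(i,j)\le m\}$; $\rho^{\infty}=0$. Let $\rho\in(0,1)$ and $c_1>0$. Assume that there is a constant $c>0$, independent of $n$, such that the following hold. 1. *(Boundedness.)* $|x_{ij}|\le c$ and $(\mathbb E\epsilon_i^4)^{1/4}\le c$ for all $n,i,j$, and $c^{-1}I\preceq X^T\Sigma X/n\preceq cI$ for all sufficiently large $n$. 2. *(Correlation decay.)* For all $n$ and all indices, $|\mathbb E(\epsilon_i\epsilon_j^{\ell})|\le c\rho^{d(i,j)}$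 for $\ell\in\{1,2\}$, and $|\mathrm{Cov}(\epsilon_i\epsilon_j,\epsilon_k\epsilon_l)|\le c\rho^{d(\{i,j\},\{k,l\})}$. Moreover, for every bounded differentiable $h:\mathbb R\to\mathbb R$ with bounded derivative there is a constant $c_h$ with $|\mathrm{Cov}(\epsilon_i,h(tS_U))|\le c_h(1+|t||U|)\rho^{d(i,U)}$ for all $n$, all $t\in\mathbb R$, all $i$ and all index sets $U$, where $S_U=\sum_{j\in U}\epsilon_j$. 3. *(Network growth.)* $\max\{(\frac1n\sum_iN_m(i)^3)^{1/2},\ \frac1n\sum_iN_m(i)^2\}\le c\,e^{c_1m}$ for all $n\ge1$ and all integers $m\ge0$. Let $\hat\beta=(X^TX)^{-1}X^TY$ be the least squares estimate, $\hat\epsilon=Y-X\hat\beta$ the residual vector, and for $m\ge0$ let $\widehat{X^T\Sigma X}$ be the $p\times p$ matrix with entries $$\widehat{X^T\Sigma X}_{rs}=\sum_{i=1}^n\sum_{j:d(i,j)\le m}x_{ir}x_{js}\hat\epsilon_i\hat\epsilon_j .$$ **Theorem.** Suppose $2c_1<\log(\rho^{-1})$. Then, as $n\to\infty$: (a) $(X^T\Sigma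 X)^{-1/2}(X^TX)(\hat\beta-\beta)$ converges in distribution to $N(0,I)$. (b) There is a constant $C>0$, depending only on $\rho$ and $c_1$, such that for $m=C\log n$ the matrix $\widehat{X^T\Sigma X}$ is positive definite with probability tending to one, and $\widehat{X^T\Sigma X}^{-1/2}(X^TX)(\hat\beta-\beta)$ converges in distribution to $N(0,I)$. (For positive definite $M$, $M^{-1/2}$ denotes the symmetric inverse square root. Quantities involving an inverse need to be defined only where the matrix is invertible respectively positive definite, i.e. for large $n$, and in (b) with probability tending to one; elsewhere any fixed convention is used.) -/

import Mathlib

open MeasureTheory ProbabilityTheory Filter Topology Matrix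
open scoped ENNReal

noncomputable section

namespace NetReg

/-- A distance on an index set: it vanishes on the diagonal, is symmetric and satisfies the
triangle inequality. The value `⊤` is allowed (nodes in different components of a network). -/
structure IsDistance {V : Type*} (d : V → V → ℝ≥0∞) : Prop where
  self : ∀ i, d i i = 0
  symm : ∀ i j, d i j = d j i
  triangle : ∀ i j k, d i k ≤ d i j + d j k

/-- The shortest path distance of a graph (`⊤` between nodes that are not connected by a path). -/
def graphDistance {V : Type*} (A : SimpleGraph V) (i j : V) : ℝ≥0∞ := (A.edist i j : ℝ≥0∞)

/-- The shortest path distance is a distance. -/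
theorem isDistance_graphDistance {V : Type*} (A : SimpleGraph V) :
    IsDistance (graphDistance A) where
  self i := by simp [graphDistance]
  symm i j := by simp [graphDistance, A.edist_comm]
  triangle i j k := by
    unfold graphDistance
    exact_mod_cast A.edist_triangle

/-- `ρ ^ d`, with `ρ ^ ∞ = 0`. -/
def decay (ρ : ℝ) (d : ℝ≥0∞) : ℝ := if d = ⊤ then 0 else ρ ^ d.toReal

/-- The distance between two index sets: the minimum of `d i j` over `i ∈ U`, `j ∈ W`
(and `⊤` if one of them is empty). -/
def setDistance {V : Type*} (d : V → V → ℝ≥0∞) (U W : Set V) : ℝ≥0∞ :=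
  ⨅ i ∈ U, ⨅ j ∈ W, d i j

/-- `N_m(i)`, the number of nodes at distance at most `m` from `i`. -/
def nbhdSize {V : Type*} [Fintype V] (d : V → V → ℝ≥0∞) (m : ℕ) (i : V) : ℕ :=
  (Finset.univ.filter fun j => d i j ≤ (m : ℝ≥0∞)).card

/-- The covariance matrix `Σ = E ε εᵀ` of a centered error vector. -/
def errCov {V Ω : Type*} [MeasurableSpace Ω] (μ : Measure Ω) (ε : V → Ω → ℝ) : Matrix V V ℝ :=
  Matrix.of fun i j => ∫ ω, ε i ω * ε j ω ∂μ

/-- Bounded design, bounded fourth moments of the errors, and `XᵀΣX / n` with eigenvalues bounded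
above and away from zero. As `XᵀΣX` has rank at most `n`, the last condition is a condition for
large `n`. -/
def BoundedModel {p : ℕ} {Ω : ℕ → Type*} [∀ n, MeasurableSpace (Ω n)]
    (μ : ∀ n, Measure (Ω n)) (X : ∀ n, Matrix (Fin n) (Fin p) ℝ)
    (ε : ∀ n, Fin n → Ω n → ℝ) : Prop :=
  ∃ c : ℝ, 0 < c ∧
    (∀ n i j, |X n i j| ≤ c) ∧
    (∀ n i, eLpNorm (ε n i) 4 (μ n) ≤ ENNReal.ofReal c) ∧
    (∀ᶠ n : ℕ in atTop,
      ((n : ℝ)⁻¹ • ((X n)ᵀ * errCov (μ n) (ε n) * X n)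
        - c⁻¹ • (1 : Matrix (Fin p) (Fin p) ℝ)).PosSemidef ∧
      (c • (1 : Matrix (Fin p) (Fin p) ℝ)
        - (n : ℝ)⁻¹ • ((X n)ᵀ * errCov (μ n) (ε n) * X n)).PosSemidef)

/-- Exponential correlation decay at rate `ρ`. In the third condition the constant may depend on
the test function `h` (but not on `n`, `i`, `U`, `t`): a constant that served all `h` at once would
force the covariances to vanish, since `h` may be rescaled. -/
def CorrelationDecay {Ω : ℕ → Type*} [∀ n, MeasurableSpace (Ω n)]
    (μ : ∀ n, Measure (Ω n)) (ε : ∀ n, Fin n → Ω n → ℝ)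
    (d : ∀ n, Fin n → Fin n → ℝ≥0∞) (ρ : ℝ) : Prop :=
  (∃ c : ℝ, 0 < c ∧
    (∀ n i j, ∀ l ∈ ({1, 2} : Finset ℕ),
      |∫ ω, ε n i ω * ε n j ω ^ l ∂(μ n)| ≤ c * decay ρ (d n i j)) ∧
    (∀ n i j k l,
      |cov[fun ω => ε n i ω * ε n j ω, fun ω => ε n k ω * ε n l ω; μ n]|
        ≤ c * decay ρ (setDistance (d n) {i, j} {k, l}))) ∧
  (∀ h : ℝ → ℝ, Differentiable ℝ h → (∃ B, ∀ x, |h x| ≤ B) → (∃ B, ∀ x, |deriv h x| ≤ B) →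
    ∃ c : ℝ, 0 < c ∧ ∀ (n : ℕ) (t : ℝ) (i : Fin n) (U : Finset (Fin n)),
      |cov[ε n i, fun ω => h (t * ∑ j ∈ U, ε n j ω); μ n]|
        ≤ c * (1 + |t| * (U.card : ℝ)) * decay ρ (setDistance (d n) {i} U))

/-- Neighborhood growth of order `exp (c₁ m)`, uniformly in `n` and `m`. -/
def NeighborhoodGrowth (d : ∀ n : ℕ, Fin n → Fin n → ℝ≥0∞) (c₁ : ℝ) : Prop :=
  ∃ c : ℝ, 0 < c ∧ ∀ n m : ℕ,
    max (√((1 / (n : ℝ)) * ∑ i, (nbhdSize (d n) m i : ℝ) ^ 3))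
        ((1 / (n : ℝ)) * ∑ i, (nbhdSize (d n) m i : ℝ) ^ 2)
      ≤ c * Real.exp (c₁ * m)

/-- The symmetric inverse square root `M^(-1/2)` of a positive definite matrix, through the
spectral calculus. (The value at matrices that are not positive definite is irrelevant.) -/
def invSqrt {p : ℕ} (M : Matrix (Fin p) (Fin p) ℝ) : Matrix (Fin p) (Fin p) ℝ :=
  cfc (fun x : ℝ => (√x)⁻¹) M

/-- The least squares estimate `(XᵀX)⁻¹ Xᵀ Y`. -/
def olsEstimate {V : Type*} [Fintype V] {p : ℕ} (X : Matrix V (Fin p) ℝ) (Y : V → ℝ) :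
    Fin p → ℝ :=
  (Xᵀ * X)⁻¹ *ᵥ (Xᵀ *ᵥ Y)

/-- The fitted residuals `Y - X β̂`. -/
def residual {V : Type*} [Fintype V] {p : ℕ} (X : Matrix V (Fin p) ℝ) (Y : V → ℝ) : V → ℝ :=
  Y - X *ᵥ olsEstimate X Y

/-- The truncated plug-in estimator of `XᵀΣX` with truncation radius `m`. -/
def plugIn {V : Type*} [Fintype V] {p : ℕ} (d : V → V → ℝ≥0∞) (m : ℝ)
    (X : Matrix V (Fin p) ℝ) (Y : V → ℝ) : Matrix (Fin p) (Fin p) ℝ :=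
  Matrix.of fun r s =>
    ∑ i, ∑ j ∈ Finset.univ.filter (fun j => d i j ≤ ENNReal.ofReal m),
      X i r * X j s * residual X Y i * residual X Y j

/-- The response `Y = X β + ε`. -/
def response {V : Type*} {p : ℕ} (X : Matrix V (Fin p) ℝ) (β : Fin p → ℝ) (e : V → ℝ) : V → ℝ :=
  X *ᵥ β + e

/-- The normalized estimation error `M^(-1/2) (XᵀX) (β̂ - β)`, as a vector of Euclidean space. -/
def studentized {V : Type*} [Fintype V] {p : ℕ} (M : Matrix (Fin p) (Fin p) ℝ)
    (X : Matrix V (Fin p) ℝ) (β : Fin p → ℝ) (Y : V → ℝ) : EuclideanSpace ℝ (Fin p) :=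
  WithLp.toLp 2 (invSqrt M *ᵥ ((Xᵀ * X) *ᵥ (olsEstimate X Y - β)))

end NetReg

end

open NetReg

/-!
The statement is a central limit theorem for `Xᵀε`, together with the consistency of the plug-in
estimator of its covariance. Write `L = log ρ⁻¹`; all truncations are at radius `C log n` with
`C = 2 / (L + 2 c₁)`. As `2 c₁ < L`, at this radius the correlations have decayed to `o(1 / n)`,
while the mean squared neighborhood size is still `o(√n)` (`NetReg.Regime`).

*Central limit theorem.* By the Cramér–Wold device, one has to treat sums `∑ w i ε i` with
bounded weights. The dependence hypothesis only concerns unweighted sums over index sets, and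
Tikhomirov's method (the characteristic function `F` satisfies `F' ≈ - s Q F`, by separating `ε i`
from the errors far from `i`) needs a product structure over nodes. Both are reconciled by thinning:
for weights in `[0, 1]`, keep `ε i` with probability `w i`, independently. Given `ε`, the
characteristic function of the thinned sum is a product `∏ thin (w j) s (ε j)`, and it is an average
of exponentials of unweighted sums, so that Tikhomirov's argument applies
(`norm_integral_mul_prod_thin_le`, `norm_deriv_add_le`). The variance of the remainder in it is the
variance of a quadratic form in nearby errors, which the covariance bounds on products control
(`integral_quadForm_sq_le`). Thinning adds to the weighted sum a noise that is, given `ε`, nearly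
Gaussian with a nearly constant variance; dividing its characteristic function out gives the theorem
for weights in `[0, 1]` (`norm_integral_exp_sub_gaussian_le`).

*Signed weights.* Nonnegative weights cover the sums `S + u W` with `S = ∑ ε i`, `W = ∑ v i ε i`,
`|v i| ≤ 1` and `|u| ≤ 1`. Any limit point of the laws of `(S, W) / √n` is therefore a law on the
plane whose projections on a cone of directions are Gaussian. Such a law has all exponential moments,
and analytic continuation of its moment generating function gives the law of the second coordinate
(`integral_exp_snd_of_cone`, `tendsto_of_weights_bounded`).

*Plug-in estimator.* The growth condition bounds the matrix of decays from `ℓ⁴` to its dual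
(`GrowthAt.sum_mul_decay_le`), so that the lower bound on `XᵀΣX / n` forces one on `XᵀX / n`
(`exists_gram_lower_bound`); in particular least squares is well defined and the residuals are
within `O(n ^ (-1 / 2))` of the errors in mean square. The error of the estimator is then dominated
by a function of vanishing integral (`exists_plugIn_error`). Since the inverse square root is
uniformly continuous on positive definite matrices with spectrum in a compact interval of positive
numbers, replacing the covariance by its estimate changes characteristic functions by
`o(1)`, and Lévy's continuity theorem concludes. The probability space varies with `n`, so that all
comparisons are made for characteristic functions.
-/

set_option linter.unusedSectionVars false

namespace NetReg

/-! ### Characteristic functions of thinned sums -/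

/-- The conditional characteristic function at `s` of `ξ x`, where `ξ` is a Bernoulli variable with
success probability `w`. -/
noncomputable def thin (w s x : ℝ) : ℂ := 1 + w * (Complex.exp (Complex.I * ((s * x : ℝ) : ℂ)) - 1)

lemma norm_cexp_I_mul (θ : ℝ) : ‖Complex.exp (Complex.I * (θ : ℂ))‖ = 1 := by
  rw [mul_comm, Complex.norm_exp_ofReal_mul_I]

lemma norm_cexp_sub_one_le (θ : ℝ) : ‖Complex.exp (Complex.I * (θ : ℂ)) - 1‖ ≤ |θ| := by
  simpa using Real.norm_exp_I_mul_ofReal_sub_one_le (x := θ)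

lemma exp_le_three_of_le_one {x : ℝ} (hx : x ≤ 1) : Real.exp x ≤ 3 :=
  (Real.exp_le_exp.2 hx).trans (by have := Real.exp_one_lt_d9; linarith)

lemma norm_cexp_sub_linear_le (θ : ℝ) :
    ‖Complex.exp (Complex.I * (θ : ℂ)) - 1 - Complex.I * θ‖ ≤ 3 * θ ^ 2 := by
  have hn : ‖Complex.I * (θ : ℂ)‖ = |θ| := by simp
  rcases le_total |θ| 1 with h | h
  · have := Complex.norm_exp_sub_sum_le_norm_mul_exp (Complex.I * (θ : ℂ)) 2
    rw [hn, sq_abs] at this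
    simp only [Finset.sum_range_succ, Finset.sum_range_zero, pow_zero, pow_one, Nat.factorial_zero,
      Nat.factorial_one, Nat.cast_one, div_one, zero_add] at this
    rw [sub_sub]
    nlinarith [exp_le_three_of_le_one h, sq_nonneg θ]
  · have h1 := norm_cexp_sub_one_le θ
    have := norm_sub_le (Complex.exp (Complex.I * (θ : ℂ)) - 1) (Complex.I * θ)
    rw [hn] at this
    nlinarith [sq_abs θ]

lemma thin_eq (w s x : ℝ) :
    thin w s x = ((1 - w : ℝ) : ℂ) + w * Complex.exp (Complex.I * ((s * x : ℝ) : ℂ)) := by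
  simp only [thin]; push_cast; ring

lemma thin_one (s x : ℝ) : thin 1 s x = Complex.exp (Complex.I * ((s * x : ℝ) : ℂ)) := by
  simp [thin]

lemma norm_thin_le {w : ℝ} (hw : w ∈ Set.Icc (0 : ℝ) 1) (s x : ℝ) : ‖thin w s x‖ ≤ 1 := by
  rw [thin_eq]
  refine (norm_add_le _ _).trans ?_
  rw [norm_mul, norm_cexp_I_mul, Complex.norm_real, Complex.norm_real, Real.norm_eq_abs,
    Real.norm_eq_abs, abs_of_nonneg hw.1, abs_of_nonneg (sub_nonneg.2 hw.2)]
  linarith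

lemma norm_thin_sub_one_le {w : ℝ} (hw : w ∈ Set.Icc (0 : ℝ) 1) (s x : ℝ) :
    ‖thin w s x - 1‖ ≤ |s| * |x| := by
  have := norm_cexp_sub_one_le (s * x)
  rw [thin, add_sub_cancel_left, norm_mul, Complex.norm_real, Real.norm_eq_abs,
    abs_of_nonneg hw.1, ← abs_mul]
  nlinarith [hw.1, hw.2, norm_nonneg (Complex.exp (Complex.I * ((s * x : ℝ) : ℂ)) - 1)]

lemma norm_thin_sub_linear_le {w : ℝ} (hw : w ∈ Set.Icc (0 : ℝ) 1) (s x : ℝ) :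
    ‖thin w s x - 1 - Complex.I * s * (w * x : ℝ)‖ ≤ 3 * (|s| * |x|) ^ 2 := by
  have := norm_cexp_sub_linear_le (s * x)
  have e : thin w s x - 1 - Complex.I * s * (w * x : ℝ) =
      w * (Complex.exp (Complex.I * ((s * x : ℝ) : ℂ)) - 1 - Complex.I * ((s * x : ℝ) : ℂ)) := by
    rw [thin]; push_cast; ring
  rw [e, norm_mul, Complex.norm_real, Real.norm_eq_abs, abs_of_nonneg hw.1, ← abs_mul, sq_abs]
  nlinarith [hw.1, hw.2, norm_nonneg
    (Complex.exp (Complex.I * ((s * x : ℝ) : ℂ)) - 1 - Complex.I * ((s * x : ℝ) : ℂ))]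

/-- A thinned variable has, up to third order, the characteristic function of `w x` plus an
independent centered Gaussian of variance `w (1 - w) x²`. -/
lemma norm_thin_sub_gaussian_le {w : ℝ} (hw : w ∈ Set.Icc (0 : ℝ) 1) (s x : ℝ) :
    ‖thin w s x - Complex.exp (Complex.I * ((s * (w * x) : ℝ) : ℂ) -
      ((s ^ 2 / 2 * (w * (1 - w) * x ^ 2) : ℝ) : ℂ))‖ ≤ 7 * (|s| * |x|) ^ 3 := by
  obtain ⟨h0, h1⟩ := hw
  have hw2 : 0 ≤ w * (1 - w) := mul_nonneg h0 (by linarith)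
  set θ := s * x with hθ
  rw [← abs_mul, ← hθ]
  have hz : Complex.I * ((s * (w * x) : ℝ) : ℂ) - ((s ^ 2 / 2 * (w * (1 - w) * x ^ 2) : ℝ) : ℂ)
      = Complex.I * ((w * θ : ℝ) : ℂ) - ((w * (1 - w) * θ ^ 2 / 2 : ℝ) : ℂ) := by
    rw [hθ]; push_cast; ring
  rw [hz]
  set z : ℂ := Complex.I * ((w * θ : ℝ) : ℂ) - ((w * (1 - w) * θ ^ 2 / 2 : ℝ) : ℂ) with hzd
  rcases le_total |θ| 1 with h | h
  · have hzn : ‖z‖ ≤ |θ| := by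
      refine (norm_sub_le _ _).trans ?_
      rw [norm_mul, Complex.norm_I, one_mul, Complex.norm_real, Complex.norm_real,
        Real.norm_eq_abs, Real.norm_eq_abs, abs_mul, abs_of_nonneg h0,
        abs_of_nonneg (show 0 ≤ w * (1 - w) * θ ^ 2 / 2 by positivity), ← sq_abs θ]
      have a1 : |θ| ^ 2 ≤ |θ| := by nlinarith [abs_nonneg θ]
      have a2 : w * (1 - w) * |θ| ^ 2 ≤ w * (1 - w) * |θ| := by gcongr
      have a3 : w * (1 - w) ≤ 1 - w := by nlinarith
      have a4 := mul_le_mul_of_nonneg_right a3 (abs_nonneg θ)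
      nlinarith [mul_nonneg (sub_nonneg.2 h1) (abs_nonneg θ)]
    have e1 := Complex.norm_exp_sub_sum_le_norm_mul_exp (Complex.I * (θ : ℂ)) 3
    have e2 := Complex.norm_exp_sub_sum_le_norm_mul_exp z 3
    have hn : ‖Complex.I * (θ : ℂ)‖ = |θ| := by simp
    have e1' : ‖Complex.I * (θ : ℂ)‖ ^ 3 * Real.exp ‖Complex.I * (θ : ℂ)‖ ≤ 3 * |θ| ^ 3 := by
      rw [hn, mul_comm]
      gcongr
      exact exp_le_three_of_le_one h
    have e2' : ‖z‖ ^ 3 * Real.exp ‖z‖ ≤ 3 * |θ| ^ 3 := by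
      rw [mul_comm]
      gcongr
      exact exp_le_three_of_le_one (hzn.trans h)
    set R1 := Complex.exp (Complex.I * (θ : ℂ)) -
      ∑ m ∈ Finset.range 3, (Complex.I * (θ : ℂ)) ^ m / m.factorial with hR1
    set R2 := Complex.exp z - ∑ m ∈ Finset.range 3, z ^ m / m.factorial with hR2
    have key : thin w s x - Complex.exp z = w * R1 - R2 +
        (Complex.I * ((w ^ 2 * (1 - w) / 2 * θ ^ 3 : ℝ) : ℂ)
          - ((w ^ 2 * (1 - w) ^ 2 / 8 * θ ^ 4 : ℝ) : ℂ)) := by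
      have a1 : Complex.exp (Complex.I * (θ : ℂ)) =
          R1 + (1 + Complex.I * θ + (Complex.I * θ) ^ 2 / 2) := by
        rw [hR1]; simp [Finset.sum_range_succ]
      have a2 : Complex.exp z = R2 + (1 + z + z ^ 2 / 2) := by
        rw [hR2]; simp [Finset.sum_range_succ]
      rw [thin, ← hθ, a1, a2, hzd]
      push_cast
      ring_nf
      simp only [Complex.I_sq]
      ring
    rw [key]
    have b1 : ‖(w : ℂ) * R1‖ ≤ 3 * |θ| ^ 3 := by
      rw [norm_mul, Complex.norm_real, Real.norm_eq_abs, abs_of_nonneg h0]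
      nlinarith [norm_nonneg R1]
    have b2 : ‖Complex.I * ((w ^ 2 * (1 - w) / 2 * θ ^ 3 : ℝ) : ℂ)
          - ((w ^ 2 * (1 - w) ^ 2 / 8 * θ ^ 4 : ℝ) : ℂ)‖ ≤ |θ| ^ 3 := by
      have p1 : 0 ≤ w ^ 2 * (1 - w) / 2 := by
        have : 0 ≤ 1 - w := by linarith
        positivity
      refine (norm_sub_le _ _).trans ?_
      rw [norm_mul, Complex.norm_I, one_mul, Complex.norm_real, Complex.norm_real,
        Real.norm_eq_abs, Real.norm_eq_abs, abs_mul, abs_mul (w ^ 2 * (1 - w) ^ 2 / 8),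
        abs_pow, abs_pow, abs_of_nonneg p1,
        abs_of_nonneg (show 0 ≤ w ^ 2 * (1 - w) ^ 2 / 8 by positivity)]
      have c1 : w ^ 2 * (1 - w) / 2 ≤ 1 / 2 := by nlinarith
      have c2 : w ^ 2 * (1 - w) ^ 2 / 8 ≤ 1 / 8 := by nlinarith
      have c3 : |θ| ^ 4 ≤ |θ| ^ 3 := pow_le_pow_of_le_one (abs_nonneg _) h (by norm_num)
      have c4 : 0 ≤ |θ| ^ 3 := by positivity
      have c5 : 0 ≤ w ^ 2 * (1 - w) ^ 2 / 8 := by positivity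
      nlinarith
    have := norm_add_le (w * R1 - R2) (Complex.I * ((w ^ 2 * (1 - w) / 2 * θ ^ 3 : ℝ) : ℂ)
          - ((w ^ 2 * (1 - w) ^ 2 / 8 * θ ^ 4 : ℝ) : ℂ))
    have := norm_sub_le ((w : ℂ) * R1) R2
    linarith
  · have hexp : ‖Complex.exp z‖ ≤ 1 := by
      rw [Complex.norm_exp, Real.exp_le_one_iff, hzd, Complex.sub_re, Complex.ofReal_re,
        Complex.re_mul_ofReal, Complex.I_re]
      have : 0 ≤ w * (1 - w) * θ ^ 2 / 2 := by positivity
      linarith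
    have := norm_sub_le (thin w s x) (Complex.exp z)
    have h3 : 1 ≤ |θ| ^ 3 := one_le_pow₀ h
    linarith [norm_thin_le ⟨h0, h1⟩ s x]

section Products

variable {V : Type*} {w : V → ℝ} (s : ℝ) (x : V → ℝ)

lemma norm_prod_thin_le (hw : ∀ j, w j ∈ Set.Icc (0 : ℝ) 1) (B : Finset V) :
    ‖∏ j ∈ B, thin (w j) s (x j)‖ ≤ 1 := by
  rw [norm_prod]
  exact Finset.prod_le_one (fun _ _ => norm_nonneg _) fun j _ => norm_thin_le (hw j) _ _

lemma norm_prod_thin_sub_one_le [DecidableEq V] (hw : ∀ j, w j ∈ Set.Icc (0 : ℝ) 1) (B : Finset V) :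
    ‖∏ j ∈ B, thin (w j) s (x j) - 1‖ ≤ |s| * ∑ j ∈ B, |x j| := by
  induction B using Finset.induction_on with
  | empty => simp
  | insert a B ha ih =>
    rw [Finset.prod_insert ha, Finset.sum_insert ha]
    have e : thin (w a) s (x a) * ∏ j ∈ B, thin (w j) s (x j) - 1 =
        thin (w a) s (x a) * (∏ j ∈ B, thin (w j) s (x j) - 1) + (thin (w a) s (x a) - 1) := by ring
    rw [e]
    refine (norm_add_le _ _).trans ?_
    rw [norm_mul]
    nlinarith [norm_thin_le (hw a) s (x a), norm_thin_sub_one_le (hw a) s (x a),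
      norm_nonneg (∏ j ∈ B, thin (w j) s (x j) - 1), norm_nonneg (thin (w a) s (x a))]

lemma norm_prod_thin_sub_linear_le [DecidableEq V] (hw : ∀ j, w j ∈ Set.Icc (0 : ℝ) 1)
    (B : Finset V) :
    ‖∏ j ∈ B, thin (w j) s (x j) - 1 - Complex.I * s * ((∑ j ∈ B, w j * x j : ℝ) : ℂ)‖ ≤
      3 * (|s| * ∑ j ∈ B, |x j|) ^ 2 := by
  induction B using Finset.induction_on with
  | empty => simp
  | insert a B ha ih =>
    rw [Finset.prod_insert ha, Finset.sum_insert ha, Finset.sum_insert ha]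
    have e : thin (w a) s (x a) * ∏ j ∈ B, thin (w j) s (x j) - 1 -
        Complex.I * s * ((w a * x a + ∑ j ∈ B, w j * x j : ℝ) : ℂ) =
        (∏ j ∈ B, thin (w j) s (x j) - 1 - Complex.I * s * ((∑ j ∈ B, w j * x j : ℝ) : ℂ)) +
        (thin (w a) s (x a) - 1 - Complex.I * s * (w a * x a : ℝ)) +
        (thin (w a) s (x a) - 1) * (∏ j ∈ B, thin (w j) s (x j) - 1) := by
      push_cast; ring
    rw [e]
    refine (norm_add₃_le).trans ?_
    rw [norm_mul]
    have h1 := norm_thin_sub_linear_le (hw a) s (x a)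
    have h2 := mul_le_mul (norm_thin_sub_one_le (hw a) s (x a))
      (norm_prod_thin_sub_one_le s x hw B) (norm_nonneg _) (by positivity)
    have h3 : 0 ≤ |s| * |x a| * (|s| * ∑ j ∈ B, |x j|) := by positivity
    nlinarith

/-- The product of the thinned factors is the average of `exp (i s ∑ j ∈ A, x j)` over a random
subset `A` of `U` that contains each `j` independently with probability `w j`. -/
lemma prod_thin_eq_sum [DecidableEq V] (w : V → ℝ) (U : Finset V) :
    ∏ j ∈ U, thin (w j) s (x j) = ∑ A ∈ U.powerset,
      (((∏ j ∈ A, w j) * ∏ j ∈ U \ A, (1 - w j) : ℝ) : ℂ) *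
        Complex.exp (Complex.I * ((s * ∑ j ∈ A, x j : ℝ) : ℂ)) := by
  simp_rw [thin_eq, add_comm (((1 - w _ : ℝ)) : ℂ)]
  rw [Finset.prod_add]
  refine Finset.sum_congr rfl fun A _ => ?_
  rw [Finset.prod_mul_distrib, ← Complex.exp_sum]
  push_cast
  rw [Finset.mul_sum, Finset.mul_sum]
  ring

lemma norm_prod_sub_prod_le [DecidableEq V] {f g : V → ℂ} (hf : ∀ j, ‖f j‖ ≤ 1)
    (hg : ∀ j, ‖g j‖ ≤ 1) (B : Finset V) :
    ‖∏ j ∈ B, f j - ∏ j ∈ B, g j‖ ≤ ∑ j ∈ B, ‖f j - g j‖ := by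
  induction B using Finset.induction_on with
  | empty => simp
  | insert a B ha ih =>
    rw [Finset.prod_insert ha, Finset.prod_insert ha, Finset.sum_insert ha]
    have e : f a * ∏ j ∈ B, f j - g a * ∏ j ∈ B, g j =
        (f a - g a) * ∏ j ∈ B, f j + g a * (∏ j ∈ B, f j - ∏ j ∈ B, g j) := by ring
    rw [e]
    refine (norm_add_le _ _).trans ?_
    rw [norm_mul, norm_mul]
    have : ‖∏ j ∈ B, f j‖ ≤ 1 := by
      rw [norm_prod]; exact Finset.prod_le_one (fun _ _ => norm_nonneg _) fun j _ => hf j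
    nlinarith [hg a, norm_nonneg (f a - g a), norm_nonneg (∏ j ∈ B, f j - ∏ j ∈ B, g j),
      norm_nonneg (g a)]

/-- Removing a neighborhood `B` of `i` from the thinned product, expanded to first order. -/
lemma norm_thin_local_expansion_le [Fintype V] [DecidableEq V] (hw : ∀ j, w j ∈ Set.Icc (0 : ℝ) 1)
    {i : V} {B : Finset V} (hi : i ∈ B) :
    ‖Complex.exp (Complex.I * ((s * x i : ℝ) : ℂ)) * ∏ j ∈ Finset.univ.erase i, thin (w j) s (x j)
      - ∏ j ∈ Bᶜ, thin (w j) s (x j)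
      - Complex.I * s * ((∑ j ∈ B, Function.update w i 1 j * x j : ℝ) : ℂ) *
        ∏ j, thin (w j) s (x j)‖ ≤ 4 * (|s| * ∑ j ∈ B, |x j|) ^ 2 := by
  set w' := Function.update w i 1 with hw'
  have hw'1 : ∀ j, w' j ∈ Set.Icc (0 : ℝ) 1 := fun j => by
    rcases eq_or_ne j i with rfl | h
    · simp [hw']
    · simpa [hw', h] using hw j
  set P := ∏ j ∈ Bᶜ, thin (w j) s (x j) with hP
  set L : ℝ := ∑ j ∈ B, w' j * x j with hL
  have hsplit : ∏ j, thin (w j) s (x j) = (∏ j ∈ B, thin (w j) s (x j)) * P :=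
    (Finset.prod_mul_prod_compl B _).symm
  have hB : Complex.exp (Complex.I * ((s * x i : ℝ) : ℂ)) *
      ∏ j ∈ Finset.univ.erase i, thin (w j) s (x j) = (∏ j ∈ B, thin (w' j) s (x j)) * P := by
    have h1 : P = ∏ j ∈ Bᶜ, thin (w' j) s (x j) := by
      refine Finset.prod_congr rfl fun j hj => ?_
      have : j ≠ i := fun h => (Finset.mem_compl.1 hj) (h ▸ hi)
      simp [hw', this]
    rw [h1, Finset.prod_mul_prod_compl, ← Finset.mul_prod_erase _ _ (Finset.mem_univ i)]
    congr 1
    · simp [hw', thin_one]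
    · refine Finset.prod_congr rfl fun j hj => ?_
      simp [hw', Finset.ne_of_mem_erase hj]
  have e : (∏ j ∈ B, thin (w' j) s (x j)) * P - P
      - Complex.I * s * (L : ℂ) * ((∏ j ∈ B, thin (w j) s (x j)) * P) =
      (∏ j ∈ B, thin (w' j) s (x j) - 1 - Complex.I * s * (L : ℂ)) * P
      - Complex.I * s * (L : ℂ) * ((∏ j ∈ B, thin (w j) s (x j) - 1) * P) := by ring
  rw [hB, hsplit, e]
  have hPn : ‖P‖ ≤ 1 := norm_prod_thin_le s x hw _
  have hLn : |L| ≤ ∑ j ∈ B, |x j| := by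
    refine (Finset.abs_sum_le_sum_abs _ _).trans (Finset.sum_le_sum fun j _ => ?_)
    rw [abs_mul, abs_of_nonneg (hw'1 j).1]
    nlinarith [(hw'1 j).2, abs_nonneg (x j)]
  have h1 := norm_prod_thin_sub_linear_le s x hw'1 B
  have h2 := norm_prod_thin_sub_one_le s x hw B
  refine (norm_sub_le _ _).trans ?_
  rw [norm_mul, norm_mul, norm_mul, norm_mul, norm_mul, Complex.norm_I, one_mul, Complex.norm_real,
    Complex.norm_real, Real.norm_eq_abs, Real.norm_eq_abs]
  set X := ∑ j ∈ B, |x j|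
  have hX : 0 ≤ |s| * X := (norm_nonneg _).trans h2
  have a1 : ‖∏ j ∈ B, thin (w' j) s (x j) - 1 - Complex.I * s * (L : ℂ)‖ * ‖P‖ ≤
      3 * (|s| * X) ^ 2 := (mul_le_of_le_one_right (norm_nonneg _) hPn).trans h1
  have a2 : |s| * |L| * (‖∏ j ∈ B, thin (w j) s (x j) - 1‖ * ‖P‖) ≤ (|s| * X) * (|s| * X) :=
    mul_le_mul (by gcongr) ((mul_le_of_le_one_right (norm_nonneg _) hPn).trans h2)
      (by positivity) hX
  nlinarith

end Products

/-! ### Decay and neighborhoods -/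

lemma decay_nonneg {ρ : ℝ} (hρ : 0 < ρ) (x : ℝ≥0∞) : 0 ≤ decay ρ x := by
  unfold decay; split_ifs <;> positivity

lemma decay_anti {ρ : ℝ} (hρ : ρ ∈ Set.Ioo (0 : ℝ) 1) {x y : ℝ≥0∞} (h : x ≤ y) :
    decay ρ y ≤ decay ρ x := by
  by_cases hy : y = ⊤
  · simpa [decay, hy] using decay_nonneg hρ.1 x
  · have hx : x ≠ ⊤ := ne_top_of_le_ne_top hy h
    simp only [decay, hx, hy, if_false]
    exact Real.rpow_le_rpow_of_exponent_ge hρ.1 hρ.2.le (ENNReal.toReal_mono hy h)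

lemma decay_le_one {ρ : ℝ} (hρ : ρ ∈ Set.Ioo (0 : ℝ) 1) (x : ℝ≥0∞) : decay ρ x ≤ 1 :=
  (decay_anti hρ (zero_le : (0 : ℝ≥0∞) ≤ x)).trans (by simp [decay])

lemma decay_le_of_ofReal_le {ρ r : ℝ} (hρ : ρ ∈ Set.Ioo (0 : ℝ) 1) (hr : 0 ≤ r) {x : ℝ≥0∞}
    (h : ENNReal.ofReal r ≤ x) : decay ρ x ≤ ρ ^ r :=
  (decay_anti hρ h).trans (by simp [decay, ENNReal.toReal_ofReal hr])

section Ball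

variable {V : Type*} [Fintype V] {d : V → V → ℝ≥0∞}

/-- The ball of radius `r` about `i`. -/
noncomputable def ball (d : V → V → ℝ≥0∞) (r : ℝ) (i : V) : Finset V :=
  Finset.univ.filter fun j => d i j ≤ ENNReal.ofReal r

lemma mem_ball_iff {r : ℝ} {i j : V} : j ∈ ball d r i ↔ d i j ≤ ENNReal.ofReal r := by
  simp [ball]

lemma self_mem_ball (hd : IsDistance d) (r : ℝ) (i : V) : i ∈ ball d r i := by
  simp [mem_ball_iff, hd.self]

/-- The indicator of the pairs at distance at most `r`. -/
noncomputable def near (d : V → V → ℝ≥0∞) (r : ℝ) (i j : V) : ℝ :=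
  if d i j ≤ ENNReal.ofReal r then 1 else 0

lemma near_nonneg (r : ℝ) (i j : V) : 0 ≤ near d r i j := by unfold near; split_ifs <;> norm_num

lemma near_comm (hd : IsDistance d) (r : ℝ) (i j : V) : near d r i j = near d r j i := by
  rw [near, near, hd.symm]

lemma sum_near_mul (r : ℝ) (i : V) (f : V → ℝ) :
    ∑ j, near d r i j * f j = ∑ j ∈ ball d r i, f j := by
  simp [near, ball, Finset.sum_filter]

lemma sum_near (r : ℝ) (i : V) : ∑ j, near d r i j = ((ball d r i).card : ℝ) := by
  simpa using sum_near_mul (d := d) r i 1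

lemma sum_near' (hd : IsDistance d) (r : ℝ) (j : V) :
    ∑ i, near d r i j = ((ball d r j).card : ℝ) := by
  simp_rw [near_comm hd r _ j, sum_near]

/-- Chains of three nearby pairs are controlled by the third moment of the neighborhood sizes. -/
lemma sum_near_chain_le (hd : IsDistance d) (r : ℝ) :
    ∑ i, ∑ k, near d r i k * (((ball d r i).card : ℝ) * ((ball d r k).card : ℝ)) ≤
      ∑ i, ((ball d r i).card : ℝ) ^ 3 := by
  have h : ∑ i, ∑ k, near d r i k * ((ball d r k).card : ℝ) ^ 2 =
      ∑ i, ∑ k, near d r i k * ((ball d r i).card : ℝ) ^ 2 := by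
    rw [Finset.sum_comm]
    exact Finset.sum_congr rfl fun i _ => Finset.sum_congr rfl fun k _ => by rw [near_comm hd]
  have h' : ∑ i, ∑ k, near d r i k * ((ball d r i).card : ℝ) ^ 2 =
      ∑ i, ((ball d r i).card : ℝ) ^ 3 := by
    refine Finset.sum_congr rfl fun i _ => ?_
    rw [← Finset.sum_mul, sum_near]; ring
  calc _ ≤ ∑ i, ∑ k, (near d r i k * ((ball d r i).card : ℝ) ^ 2 / 2 +
        near d r i k * ((ball d r k).card : ℝ) ^ 2 / 2) := by
        refine Finset.sum_le_sum fun i _ => Finset.sum_le_sum fun k _ => ?_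
        nlinarith [mul_nonneg (near_nonneg (d := d) r i k)
          (sq_nonneg (((ball d r i).card : ℝ) - ((ball d r k).card : ℝ)))]
    _ = _ := by
        simp_rw [Finset.sum_add_distrib, ← Finset.sum_div]
        rw [h, h']; ring

/-- The number of nearby pairs `(i, j)`, `(k, l)`, weighted by the decay in the distance between
the pairs. -/
lemma sum_near_decay_le (hd : IsDistance d) {ρ r : ℝ} (hρ : ρ ∈ Set.Ioo (0 : ℝ) 1) (hr : 0 ≤ r) :
    ∑ a : V × V, ∑ b : V × V, near d r a.1 a.2 * near d r b.1 b.2 *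
      decay ρ (setDistance d {a.1, a.2} {b.1, b.2}) ≤
      4 * ∑ i, ((ball d r i).card : ℝ) ^ 3 + (∑ i, ((ball d r i).card : ℝ)) ^ 2 * ρ ^ r := by
  have hpt : ∀ a b : V × V, near d r a.1 a.2 * near d r b.1 b.2 *
      decay ρ (setDistance d {a.1, a.2} {b.1, b.2}) ≤
      near d r a.1 a.2 * near d r b.1 b.2 * ρ ^ r +
      (near d r a.1 a.2 * near d r b.1 b.2 * near d r a.1 b.1 +
      near d r a.1 a.2 * near d r b.1 b.2 * near d r a.1 b.2 +
      near d r a.1 a.2 * near d r b.1 b.2 * near d r a.2 b.1 +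
      near d r a.1 a.2 * near d r b.1 b.2 * near d r a.2 b.2) := by
    rintro ⟨i, j⟩ ⟨k, l⟩
    have hdec : decay ρ (setDistance d {i, j} {k, l}) ≤
        ρ ^ r + (near d r i k + near d r i l + near d r j k + near d r j l) := by
      have h0 : (0 : ℝ) ≤ ρ ^ r := Real.rpow_nonneg hρ.1.le _
      have n1 := near_nonneg (d := d) r i k
      have n2 := near_nonneg (d := d) r i l
      have n3 := near_nonneg (d := d) r j k
      have n4 := near_nonneg (d := d) r j l
      have h1 := decay_le_one hρ (setDistance d {i, j} {k, l})
      by_cases c1 : d i k ≤ ENNReal.ofReal r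
      · have : near d r i k = 1 := if_pos c1
        linarith
      by_cases c2 : d i l ≤ ENNReal.ofReal r
      · have : near d r i l = 1 := if_pos c2
        linarith
      by_cases c3 : d j k ≤ ENNReal.ofReal r
      · have : near d r j k = 1 := if_pos c3
        linarith
      by_cases c4 : d j l ≤ ENNReal.ofReal r
      · have : near d r j l = 1 := if_pos c4
        linarith
      have : decay ρ (setDistance d {i, j} {k, l}) ≤ ρ ^ r := by
        refine decay_le_of_ofReal_le hρ hr ?_
        simp only [setDistance, Set.mem_insert_iff, Set.mem_singleton_iff, le_iInf_iff]
        push Not at c1 c2 c3 c4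
        rintro _ (rfl | rfl) _ (rfl | rfl)
        exacts [c1.le, c2.le, c3.le, c4.le]
      linarith
    have := mul_le_mul_of_nonneg_left hdec
      (mul_nonneg (near_nonneg (d := d) r i j) (near_nonneg (d := d) r k l))
    simp only at this ⊢
    linarith
  have hchain := sum_near_chain_le hd r
  have e0 : ∑ a : V × V, ∑ b : V × V, near d r a.1 a.2 * near d r b.1 b.2 * ρ ^ r =
      (∑ i, ((ball d r i).card : ℝ)) ^ 2 * ρ ^ r := by
    simp_rw [← Finset.sum_mul]
    rw [← Finset.sum_mul_sum, Fintype.sum_prod_type]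
    simp_rw [sum_near]
    ring
  -- each of the four sums reduces to the same chain sum by summing out the two free indices
  have key : ∀ f : V × V → V, (f = Prod.fst ∨ f = Prod.snd) → ∀ φ : V → ℝ,
      ∑ a : V × V, near d r a.1 a.2 * φ (f a) = ∑ i, ((ball d r i).card : ℝ) * φ i := by
    rintro f (rfl | rfl) φ
    · rw [Fintype.sum_prod_type]
      simp_rw [← Finset.sum_mul, sum_near]
    · rw [Fintype.sum_prod_type_right]
      simp_rw [← Finset.sum_mul, sum_near' hd]
  have e1 : ∀ f g : V × V → V, (f = Prod.fst ∨ f = Prod.snd) → (g = Prod.fst ∨ g = Prod.snd) →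
      ∑ a : V × V, ∑ b : V × V, near d r a.1 a.2 * near d r b.1 b.2 * near d r (f a) (g b) =
      ∑ i, ∑ k, near d r i k * (((ball d r i).card : ℝ) * ((ball d r k).card : ℝ)) := by
    intro f g hf hg
    have : ∀ a : V × V, ∑ b : V × V, near d r a.1 a.2 * near d r b.1 b.2 * near d r (f a) (g b) =
        near d r a.1 a.2 * ∑ k, ((ball d r k).card : ℝ) * near d r (f a) k := fun a => by
      rw [← key g hg, Finset.mul_sum]
      exact Finset.sum_congr rfl fun b _ => by ring
    simp_rw [this]
    rw [key f hf fun i => ∑ k, ((ball d r k).card : ℝ) * near d r i k]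
    refine Finset.sum_congr rfl fun i _ => ?_
    rw [Finset.mul_sum]
    exact Finset.sum_congr rfl fun b _ => by ring
  refine (Finset.sum_le_sum fun a _ => Finset.sum_le_sum fun b _ => hpt a b).trans ?_
  simp_rw [Finset.sum_add_distrib]
  rw [e0, e1 Prod.fst Prod.fst (.inl rfl) (.inl rfl), e1 Prod.fst Prod.snd (.inl rfl) (.inr rfl),
    e1 Prod.snd Prod.fst (.inr rfl) (.inl rfl), e1 Prod.snd Prod.snd (.inr rfl) (.inr rfl)]
  linarith

end Ball

/-! ### Fields with decaying correlations -/

/-- A centered random field on a finite metric space with fourth moments at most `c` and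
correlations that decay at rate `ρ`. The last condition is the weak dependence of `ε i` on the
unweighted sums, tested with complex exponentials; for empty `U` it says that `ε i` is centered. -/
structure DecayingField {V Ω : Type*} [MeasurableSpace Ω] (μ : Measure Ω)
    (ε : V → Ω → ℝ) (d : V → V → ℝ≥0∞) (ρ c : ℝ) : Prop where
  isDistance : IsDistance d
  const_nonneg : 0 ≤ c
  aemeasurable : ∀ i, AEMeasurable (ε i) μ
  integrable_pow : ∀ i, Integrable (fun ω => ε i ω ^ 4) μ
  integral_pow_le : ∀ i, ∫ ω, ε i ω ^ 4 ∂μ ≤ c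
  abs_errCov_le : ∀ i j, |errCov μ ε i j| ≤ c * decay ρ (d i j)
  abs_cov_le : ∀ i j k l, |cov[fun ω => ε i ω * ε j ω, fun ω => ε k ω * ε l ω; μ]| ≤
    c * decay ρ (setDistance d {i, j} {k, l})
  norm_integral_exp_le : ∀ (s : ℝ) (i : V) (U : Finset V),
    ‖∫ ω, (ε i ω : ℂ) * Complex.exp (Complex.I * ((s * ∑ j ∈ U, ε j ω : ℝ) : ℂ)) ∂μ‖ ≤
      c * (1 + |s| * (U.card : ℝ)) * decay ρ (setDistance d {i} U)

namespace DecayingField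

variable {V Ω : Type*} [MeasurableSpace Ω] {μ : Measure Ω}
  [IsProbabilityMeasure μ] {ε : V → Ω → ℝ} {d : V → V → ℝ≥0∞} {ρ c : ℝ}

lemma integrable_of_abs_le (h : DecayingField μ ε d ρ c) (i j k l : V) {E : Type*}
    [NormedAddCommGroup E] {f : Ω → E} (hf : AEStronglyMeasurable f μ)
    (hb : ∀ ω, ‖f ω‖ ≤ 1 + ε i ω ^ 4 + ε j ω ^ 4 + ε k ω ^ 4 + ε l ω ^ 4) : Integrable f μ :=
  Integrable.mono' (((((integrable_const 1).add (h.integrable_pow i)).add (h.integrable_pow j)).add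
    (h.integrable_pow k)).add (h.integrable_pow l)) hf (.of_forall hb)

lemma abs_mul₄_le (a b c d : ℝ) : |a * b * c * d| ≤ 1 + a ^ 4 + b ^ 4 + c ^ 4 + d ^ 4 := by
  rw [abs_le]
  constructor <;> nlinarith [sq_nonneg (a ^ 2 - b ^ 2), sq_nonneg (c ^ 2 - d ^ 2),
    sq_nonneg (a * b - c * d), sq_nonneg (a * b + c * d), sq_nonneg (a ^ 2), sq_nonneg (b ^ 2),
    sq_nonneg (c ^ 2), sq_nonneg (d ^ 2)]

lemma abs_mul₃_le (a b c : ℝ) : |a| * |b| * |c| ≤ 1 + a ^ 4 + b ^ 4 + c ^ 4 := by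
  rw [← abs_mul, ← abs_mul, abs_le]
  constructor <;> nlinarith [sq_nonneg (a ^ 2 - b ^ 2), sq_nonneg (c ^ 2 - 1),
    sq_nonneg (a * b - c), sq_nonneg (a * b + c), sq_nonneg (a ^ 2), sq_nonneg (b ^ 2),
    sq_nonneg (c ^ 2)]

lemma aesm (h : DecayingField μ ε d ρ c) (i : V) : AEStronglyMeasurable (ε i) μ :=
  (h.aemeasurable i).aestronglyMeasurable

lemma integrable_mul₄ (h : DecayingField μ ε d ρ c) (i j k l : V) :
    Integrable (fun ω => ε i ω * ε j ω * ε k ω * ε l ω) μ :=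
  h.integrable_of_abs_le i j k l (((((h.aesm i).mul (h.aesm j))).mul (h.aesm k)).mul (h.aesm l))
    fun _ => abs_mul₄_le _ _ _ _

lemma integrable_abs_mul₃ (h : DecayingField μ ε d ρ c) (i j k : V) :
    Integrable (fun ω => |ε i ω| * |ε j ω| * |ε k ω|) μ := by
  refine h.integrable_of_abs_le i j k i
    (((h.aesm i).norm.mul (h.aesm j).norm).mul (h.aesm k).norm) fun ω => ?_
  rw [Real.norm_eq_abs, abs_of_nonneg (by positivity)]
  have : 0 ≤ ε i ω ^ 4 := by positivity
  linarith [abs_mul₃_le (ε i ω) (ε j ω) (ε k ω)]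

lemma integrable_mul (h : DecayingField μ ε d ρ c) (i j : V) :
    Integrable (fun ω => ε i ω * ε j ω) μ := by
  refine h.integrable_of_abs_le i j i i ((h.aesm i).mul (h.aesm j)) fun ω => ?_
  have h2 : 0 ≤ ε i ω ^ 4 := by positivity
  have h3 : 0 ≤ ε j ω ^ 4 := by positivity
  rw [Real.norm_eq_abs, abs_mul]
  have : |ε i ω| * |ε j ω| ≤ 1 + ε i ω ^ 4 + ε j ω ^ 4 := by
    rw [← abs_mul, abs_le]
    constructor <;> nlinarith [sq_nonneg (ε i ω ^ 2 - 1), sq_nonneg (ε j ω ^ 2 - 1),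
      sq_nonneg (ε i ω - ε j ω), sq_nonneg (ε i ω + ε j ω)]
  linarith

lemma integrable (h : DecayingField μ ε d ρ c) (i : V) : Integrable (ε i) μ := by
  refine h.integrable_of_abs_le i i i i (h.aesm i) fun ω => ?_
  rw [Real.norm_eq_abs, abs_le]
  have h2 : 0 ≤ ε i ω ^ 4 := by positivity
  constructor <;> nlinarith [sq_nonneg (ε i ω ^ 2 - 1), sq_nonneg (ε i ω - 1),
    sq_nonneg (ε i ω + 1)]

lemma integral_abs_mul₃_le (h : DecayingField μ ε d ρ c) (i j k : V) :
    ∫ ω, |ε i ω| * |ε j ω| * |ε k ω| ∂μ ≤ 1 + 3 * c := by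
  have i1 : Integrable (fun ω => 1 + ε i ω ^ 4) μ := (integrable_const 1).add (h.integrable_pow i)
  have i2 : Integrable (fun ω => 1 + ε i ω ^ 4 + ε j ω ^ 4) μ := i1.add (h.integrable_pow j)
  calc _ ≤ ∫ ω, (1 + ε i ω ^ 4 + ε j ω ^ 4 + ε k ω ^ 4) ∂μ :=
        integral_mono (h.integrable_abs_mul₃ i j k) (i2.add (h.integrable_pow k))
          fun ω => abs_mul₃_le _ _ _
    _ = 1 + ∫ ω, ε i ω ^ 4 ∂μ + ∫ ω, ε j ω ^ 4 ∂μ + ∫ ω, ε k ω ^ 4 ∂μ := by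
        rw [integral_add i2 (h.integrable_pow k), integral_add i1 (h.integrable_pow j),
          integral_add (integrable_const 1) (h.integrable_pow i)]
        simp
    _ ≤ _ := by linarith [h.integral_pow_le i, h.integral_pow_le j, h.integral_pow_le k]

lemma errCov_comm (i j : V) : errCov μ ε i j = errCov μ ε j i := by
  simp [errCov, mul_comm]

variable [Fintype V]

/-- The centered quadratic form with coefficients `a`. -/
noncomputable def quadForm (μ : Measure Ω) (ε : V → Ω → ℝ) (a : V → V → ℝ) (ω : Ω) : ℝ :=
  ∑ q : V × V, a q.1 q.2 * (ε q.1 ω * ε q.2 ω - errCov μ ε q.1 q.2)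

lemma quadForm_sq_eq (a : V → V → ℝ) (ω : Ω) : quadForm μ ε a ω ^ 2 =
    ∑ q : V × V, ∑ q' : V × V, a q.1 q.2 * a q'.1 q'.2 *
      ((ε q.1 ω * ε q.2 ω - errCov μ ε q.1 q.2) *
        (ε q'.1 ω * ε q'.2 ω - errCov μ ε q'.1 q'.2)) := by
  rw [quadForm, sq, Finset.sum_mul_sum]
  exact Finset.sum_congr rfl fun _ _ => Finset.sum_congr rfl fun _ _ => by ring

lemma integrable_centered_mul (h : DecayingField μ ε d ρ c) (i j k l : V) :
    Integrable (fun ω => (ε i ω * ε j ω - errCov μ ε i j) * (ε k ω * ε l ω - errCov μ ε k l)) μ := by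
  have : (fun ω => (ε i ω * ε j ω - errCov μ ε i j) * (ε k ω * ε l ω - errCov μ ε k l)) =
      fun ω => ε i ω * ε j ω * ε k ω * ε l ω - errCov μ ε k l * (ε i ω * ε j ω)
        - errCov μ ε i j * (ε k ω * ε l ω) + errCov μ ε i j * errCov μ ε k l := by
    ext ω; ring
  rw [this]
  exact (((h.integrable_mul₄ i j k l).sub ((h.integrable_mul i j).const_mul _)).sub
    ((h.integrable_mul k l).const_mul _)).add (integrable_const _)

lemma integrable_quadForm_sq (h : DecayingField μ ε d ρ c) (a : V → V → ℝ) :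
    Integrable (fun ω => quadForm μ ε a ω ^ 2) μ := by
  simp_rw [quadForm_sq_eq]
  exact integrable_finsetSum _ fun _ _ => integrable_finsetSum _ fun _ _ =>
    (h.integrable_centered_mul _ _ _ _).const_mul _

lemma integrable_quadForm (h : DecayingField μ ε d ρ c) (a : V → V → ℝ) :
    Integrable (quadForm μ ε a) μ :=
  integrable_finsetSum _ fun q _ =>
    ((h.integrable_mul q.1 q.2).sub (integrable_const _)).const_mul _

/-- The variance of a quadratic form supported on nearby pairs. -/
lemma integral_quadForm_sq_le (h : DecayingField μ ε d ρ c) {r A : ℝ} (hρ : ρ ∈ Set.Ioo (0 : ℝ) 1)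
    (hr : 0 ≤ r) {a : V → V → ℝ} (ha : ∀ i j, |a i j| ≤ A * near d r i j) :
    ∫ ω, quadForm μ ε a ω ^ 2 ∂μ ≤ A ^ 2 * c * (4 * ∑ i, ((ball d r i).card : ℝ) ^ 3 +
      (∑ i, ((ball d r i).card : ℝ)) ^ 2 * ρ ^ r) := by
  simp_rw [quadForm_sq_eq]
  rw [integral_finsetSum _ fun _ _ => integrable_finsetSum _ fun _ _ =>
    (h.integrable_centered_mul _ _ _ _).const_mul _]
  simp_rw [integral_finsetSum _ fun (_ : V × V) _ =>
    (h.integrable_centered_mul _ _ _ _).const_mul _, integral_const_mul]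
  refine le_trans ?_ (mul_le_mul_of_nonneg_left
    (sum_near_decay_le h.isDistance hρ hr) (?_ : 0 ≤ A ^ 2 * c))
  · rw [Finset.mul_sum]
    refine Finset.sum_le_sum fun q _ => ?_
    rw [Finset.mul_sum]
    refine Finset.sum_le_sum fun q' _ => ?_
    have h1 := h.abs_cov_le q.1 q.2 q'.1 q'.2
    have h2 := mul_le_mul (ha q.1 q.2) (ha q'.1 q'.2) (abs_nonneg _)
      ((abs_nonneg _).trans (ha q.1 q.2))
    have h3 := mul_le_mul h2 h1 (abs_nonneg _) ((by positivity : (0 : ℝ) ≤ _).trans h2)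
    rw [← abs_mul, ← abs_mul] at h3
    refine ((le_abs_self _).trans h3).trans (le_of_eq ?_)
    ring
  · exact mul_nonneg (sq_nonneg A) h.const_nonneg

lemma integral_abs_quadForm_le (h : DecayingField μ ε d ρ c) {r A : ℝ}
    (hρ : ρ ∈ Set.Ioo (0 : ℝ) 1)
    (hr : 0 ≤ r) {a : V → V → ℝ} (ha : ∀ i j, |a i j| ≤ A * near d r i j) :
    ∫ ω, |quadForm μ ε a ω| ∂μ ≤ √(A ^ 2 * c * (4 * ∑ i, ((ball d r i).card : ℝ) ^ 3 +
      (∑ i, ((ball d r i).card : ℝ)) ^ 2 * ρ ^ r)) := by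
  refine Real.le_sqrt_of_sq_le (le_trans ?_ (h.integral_quadForm_sq_le hρ hr ha))
  have hi := h.integrable_quadForm a
  have := variance_nonneg (fun ω => |quadForm μ ε a ω|) μ
  rw [variance_eq_sub] at this
  · simpa using this
  · rw [memLp_two_iff_integrable_sq hi.abs.aestronglyMeasurable]
    simpa using h.integrable_quadForm_sq a

end DecayingField

/-! ### The differential equation for the characteristic function of a thinned sum -/

lemma continuous_thin (w s : ℝ) : Continuous (thin w s) := by
  unfold thin; fun_prop

lemma hasDerivAt_thin (w s x : ℝ) : HasDerivAt (fun s => thin w s x)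
    (Complex.I * ((w * x : ℝ) : ℂ) * Complex.exp (Complex.I * ((s * x : ℝ) : ℂ))) s := by
  have h1 : HasDerivAt (fun s : ℝ => Complex.I * ((s * x : ℝ) : ℂ)) (Complex.I * (x : ℂ)) s := by
    have := ((hasDerivAt_id s).mul_const x).ofReal_comp.const_mul Complex.I
    simpa using this
  have := ((h1.cexp.sub_const 1).const_mul (w : ℂ)).const_add 1
  refine this.congr_deriv ?_
  push_cast; ring

namespace DecayingField

variable {V Ω : Type*} [MeasurableSpace Ω] {μ : Measure Ω}
  [IsProbabilityMeasure μ] {ε : V → Ω → ℝ} {d : V → V → ℝ≥0∞} {ρ c : ℝ}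

lemma aesm_prod_thin (h : DecayingField μ ε d ρ c) (w : V → ℝ) (s : ℝ) (U : Finset V) :
    AEStronglyMeasurable (fun ω => ∏ j ∈ U, thin (w j) s (ε j ω)) μ :=
  Finset.aestronglyMeasurable_fun_prod _ fun j _ =>
    (continuous_thin (w j) s).comp_aestronglyMeasurable (h.aesm j)

lemma integrable_prod_thin (h : DecayingField μ ε d ρ c) {w : V → ℝ}
    (hw : ∀ j, w j ∈ Set.Icc (0 : ℝ) 1) (s : ℝ) (U : Finset V) :
    Integrable (fun ω => ∏ j ∈ U, thin (w j) s (ε j ω)) μ :=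
  Integrable.of_bound (h.aesm_prod_thin w s U) 1 (.of_forall fun _ => norm_prod_thin_le s _ hw U)

lemma integrable_mul_prod_thin (h : DecayingField μ ε d ρ c) {w : V → ℝ}
    (hw : ∀ j, w j ∈ Set.Icc (0 : ℝ) 1) (s : ℝ) (U : Finset V) {f : Ω → ℝ} (hf : Integrable f μ) :
    Integrable (fun ω => (f ω : ℂ) * ∏ j ∈ U, thin (w j) s (ε j ω)) μ :=
  hf.ofReal.mul_bdd (h.aesm_prod_thin w s U) (.of_forall fun _ => norm_prod_thin_le s _ hw U)

/-- The weak dependence of `ε i` on unweighted sums passes to thinned sums, since these are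
averages over random subsets. -/
lemma norm_integral_mul_prod_thin_le [DecidableEq V] (h : DecayingField μ ε d ρ c)
    (hρ : ρ ∈ Set.Ioo (0 : ℝ) 1) {w : V → ℝ}
    (hw : ∀ j, w j ∈ Set.Icc (0 : ℝ) 1) (s : ℝ) (i : V) (U : Finset V) :
    ‖∫ ω, (ε i ω : ℂ) * ∏ j ∈ U, thin (w j) s (ε j ω) ∂μ‖ ≤
      c * (1 + |s| * (U.card : ℝ)) * decay ρ (setDistance d {i} U) := by
  set p : Finset V → ℝ := fun A => (∏ j ∈ A, w j) * ∏ j ∈ U \ A, (1 - w j) with hp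
  have hp0 : ∀ A, 0 ≤ p A := fun A => mul_nonneg (Finset.prod_nonneg fun j _ => (hw j).1)
    (Finset.prod_nonneg fun j _ => sub_nonneg.2 (hw j).2)
  have hp1 : ∑ A ∈ U.powerset, p A = 1 := by
    rw [hp, ← Finset.prod_add]; simp
  have hint : ∀ A : Finset V, Integrable (fun ω => (ε i ω : ℂ) *
      Complex.exp (Complex.I * ((s * ∑ j ∈ A, ε j ω : ℝ) : ℂ))) μ := fun A => by
    have := h.integrable_mul_prod_thin (w := 1) (by simp) s A (h.integrable i)
    simpa [thin_one, ← Complex.exp_sum, Finset.mul_sum] using this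
  have e : ∀ ω, (ε i ω : ℂ) * ∏ j ∈ U, thin (w j) s (ε j ω) = ∑ A ∈ U.powerset,
      (p A : ℂ) * ((ε i ω : ℂ) * Complex.exp (Complex.I * ((s * ∑ j ∈ A, ε j ω : ℝ) : ℂ))) := by
    intro ω
    rw [prod_thin_eq_sum, Finset.mul_sum]
    exact Finset.sum_congr rfl fun A _ => by simp only [hp]; ring
  simp_rw [e]
  rw [integral_finsetSum _ fun A _ => (hint A).const_mul _]
  simp_rw [integral_const_mul]
  calc _ ≤ ∑ A ∈ U.powerset, p A * (c * (1 + |s| * (U.card : ℝ)) *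
        decay ρ (setDistance d {i} U)) := by
        refine norm_sum_le_of_le _ fun A hA => ?_
        rw [norm_mul, Complex.norm_real, Real.norm_eq_abs, abs_of_nonneg (hp0 A)]
        refine mul_le_mul_of_nonneg_left ((h.norm_integral_exp_le s i A).trans ?_) (hp0 A)
        have hAU := Finset.mem_powerset.1 hA
        have h1 : (A.card : ℝ) ≤ U.card := by exact_mod_cast Finset.card_le_card hAU
        have h2 : decay ρ (setDistance d {i} A) ≤ decay ρ (setDistance d {i} U) := by
          refine decay_anti hρ ?_
          exact iInf₂_mono fun _ _ => le_iInf₂ fun j hj => iInf₂_le j (hAU hj)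
        have := h.const_nonneg
        have := decay_nonneg hρ.1 (setDistance d {i} (A : Set V))
        gcongr
    _ = _ := by rw [← Finset.sum_mul, hp1, one_mul]

variable [Fintype V] [DecidableEq V]

/-- The coefficients of the variance of a thinned sum as a quadratic form in the covariances:
`w i` on the diagonal and `w i * w j` off the diagonal. -/
noncomputable def thinCoeff (w : V → ℝ) (i j : V) : ℝ := w i * Function.update w i 1 j

lemma abs_thinCoeff_le {w : V → ℝ} (hw : ∀ j, w j ∈ Set.Icc (0 : ℝ) 1) (i j : V) :
    |thinCoeff w i j| ≤ 1 := by
  have h1 : Function.update w i 1 j ∈ Set.Icc (0 : ℝ) 1 := by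
    rcases eq_or_ne j i with rfl | hj
    · simp
    · simpa [hj] using hw j
  rw [thinCoeff, abs_of_nonneg (mul_nonneg (hw i).1 h1.1)]
  exact mul_le_one₀ (hw i).2 h1.1 h1.2

/-- The variance of a thinned sum. -/
noncomputable def thinVar (μ : Measure Ω) (ε : V → Ω → ℝ) (w : V → ℝ) : ℝ :=
  ∑ q : V × V, thinCoeff w q.1 q.2 * errCov μ ε q.1 q.2

/-- The error in the approximate differential equation `F' = - s Q F` for the characteristic
function of a thinned sum, when correlations are cut at distance `r`. -/
noncomputable def odeError (d : V → V → ℝ≥0∞) (ρ c r s : ℝ) : ℝ :=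
  (Fintype.card V : ℝ) * (c * (1 + |s| * (Fintype.card V : ℝ)) * ρ ^ r) +
    4 * s ^ 2 * ((1 + 3 * c) * ∑ i, ((ball d r i).card : ℝ) ^ 2) +
    |s| * (√(1 ^ 2 * c * (4 * ∑ i, ((ball d r i).card : ℝ) ^ 3 +
      (∑ i, ((ball d r i).card : ℝ)) ^ 2 * ρ ^ r)) + c * (Fintype.card V : ℝ) ^ 2 * ρ ^ r)

lemma hasDerivAt_integral_prod_thin (h : DecayingField μ ε d ρ c) {w : V → ℝ}
    (hw : ∀ j, w j ∈ Set.Icc (0 : ℝ) 1) (s : ℝ) :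
    Integrable (fun ω => ∑ i, (∏ j ∈ Finset.univ.erase i, thin (w j) s (ε j ω)) •
      (Complex.I * ((w i * ε i ω : ℝ) : ℂ) * Complex.exp (Complex.I * ((s * ε i ω : ℝ) : ℂ)))) μ ∧
    HasDerivAt (fun s => ∫ ω, ∏ j, thin (w j) s (ε j ω) ∂μ)
      (∫ ω, ∑ i, (∏ j ∈ Finset.univ.erase i, thin (w j) s (ε j ω)) •
      (Complex.I * ((w i * ε i ω : ℝ) : ℂ) * Complex.exp (Complex.I * ((s * ε i ω : ℝ) : ℂ)))
      ∂μ) s := by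
  refine hasDerivAt_integral_of_dominated_loc_of_deriv_le (bound := fun ω => ∑ i, |ε i ω|)
    univ_mem (.of_forall fun s => h.aesm_prod_thin w s _) (h.integrable_prod_thin hw s _) ?_
    (.of_forall fun ω s _ => ?_) (integrable_finsetSum _ fun i _ => (h.integrable i).abs)
    (.of_forall fun ω s _ => HasDerivAt.fun_finsetProd fun i _ => hasDerivAt_thin _ _ _)
  · refine Finset.aestronglyMeasurable_fun_sum _ fun i _ => (h.aesm_prod_thin w s _).smul ?_
    have : Continuous fun x : ℝ => Complex.I * ((w i * x : ℝ) : ℂ) *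
      Complex.exp (Complex.I * ((s * x : ℝ) : ℂ)) := by fun_prop
    exact this.comp_aestronglyMeasurable (h.aesm i)
  · refine norm_sum_le_of_le _ fun i _ => ?_
    rw [norm_smul, norm_mul, norm_mul, norm_cexp_I_mul, Complex.norm_I, Complex.norm_real,
      Real.norm_eq_abs, abs_mul, abs_of_nonneg (hw i).1]
    have h1 := norm_prod_thin_le s (fun j => ε j ω) hw (Finset.univ.erase i)
    have h2 : w i * |ε i ω| ≤ |ε i ω| := mul_le_of_le_one_left (abs_nonneg _) (hw i).2
    have h3 : 0 ≤ w i * |ε i ω| := mul_nonneg (hw i).1 (abs_nonneg _)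
    nlinarith [norm_nonneg (∏ j ∈ Finset.univ.erase i, thin (w j) s (ε j ω))]

/-- Tikhomirov's argument: the characteristic function of a thinned sum satisfies the differential
equation of the Gaussian characteristic function up to a small error. -/
lemma norm_deriv_add_le (h : DecayingField μ ε d ρ c) (hρ : ρ ∈ Set.Ioo (0 : ℝ) 1)
    {r : ℝ} (hr : 0 ≤ r) {w : V → ℝ} (hw : ∀ j, w j ∈ Set.Icc (0 : ℝ) 1) (s : ℝ) :
    ‖(∫ ω, ∑ i, (∏ j ∈ Finset.univ.erase i, thin (w j) s (ε j ω)) •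
      (Complex.I * ((w i * ε i ω : ℝ) : ℂ) * Complex.exp (Complex.I * ((s * ε i ω : ℝ) : ℂ))) ∂μ)
      + ((s * thinVar μ ε w : ℝ) : ℂ) * ∫ ω, ∏ j, thin (w j) s (ε j ω) ∂μ‖ ≤
      odeError d ρ c r s := by
  set D : Ω → ℂ := fun ω => ∑ i, (∏ j ∈ Finset.univ.erase i, thin (w j) s (ε j ω)) •
      (Complex.I * ((w i * ε i ω : ℝ) : ℂ) * Complex.exp (Complex.I * ((s * ε i ω : ℝ) : ℂ))) with hD
  set P : Ω → ℂ := fun ω => ∏ j, thin (w j) s (ε j ω) with hP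
  set Pc : V → Ω → ℂ := fun i ω => ∏ j ∈ (ball d r i)ᶜ, thin (w j) s (ε j ω) with hPc
  have hDi : Integrable D μ := (h.hasDerivAt_integral_prod_thin hw s).1
  have hPi : Integrable P μ := h.integrable_prod_thin hw s _
  have hPci : ∀ i, Integrable (fun ω => (ε i ω : ℂ) * Pc i ω) μ := fun i =>
    h.integrable_mul_prod_thin hw s _ (h.integrable i)
  set a : V → V → ℝ := fun i j => thinCoeff w i j * near d r i j with ha
  have haB : ∀ i j, |a i j| ≤ 1 * near d r i j := fun i j => by
    rw [ha, abs_mul, abs_of_nonneg (near_nonneg r i j)]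
    exact mul_le_mul_of_nonneg_right (abs_thinCoeff_le hw i j) (near_nonneg r i j)
  set τ : ℝ := ∑ q : V × V, (thinCoeff w q.1 q.2 - a q.1 q.2) * errCov μ ε q.1 q.2 with hτ
  set X : V → Ω → ℝ := fun i ω => ∑ j ∈ ball d r i, |ε j ω| with hX
  -- pointwise expansion of the derivative: `quadForm` and `τ` arise since the local quadratic term
  -- replaces the variance of the thinned sum, `τ` being the part of the variance beyond radius `r`
  have hpt : ∀ ω, ‖D ω + ((s * thinVar μ ε w : ℝ) : ℂ) * P ω -
      ∑ i, (Complex.I * (w i : ℂ)) * ((ε i ω : ℂ) * Pc i ω)‖ ≤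
      |s| * |quadForm μ ε a ω| + |s| * |τ| + ∑ i, |ε i ω| * (4 * (|s| * X i ω) ^ 2) := by
    intro ω
    set L : V → ℝ := fun i => ∑ j ∈ ball d r i, Function.update w i 1 j * ε j ω with hL
    set R : V → ℂ := fun i => Complex.exp (Complex.I * ((s * ε i ω : ℝ) : ℂ)) *
      ∏ j ∈ Finset.univ.erase i, thin (w j) s (ε j ω) - Pc i ω
      - Complex.I * s * (L i : ℂ) * P ω with hR
    have hRn : ∀ i, ‖R i‖ ≤ 4 * (|s| * X i ω) ^ 2 := fun i =>
      norm_thin_local_expansion_le s (fun j => ε j ω) hw (self_mem_ball h.isDistance r i)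
    have hq : ∑ i, w i * ε i ω * L i = quadForm μ ε a ω + (thinVar μ ε w - τ) := by
      rw [quadForm, thinVar, hτ, ← Finset.sum_sub_distrib, ← Finset.sum_add_distrib,
        Fintype.sum_prod_type]
      refine Finset.sum_congr rfl fun i _ => ?_
      rw [hL]
      simp only
      rw [← sum_near_mul (d := d) r i fun j => Function.update w i 1 j * ε j ω, Finset.mul_sum]
      refine Finset.sum_congr rfl fun j _ => ?_
      simp only [ha, thinCoeff]
      ring
    have e : D ω + ((s * thinVar μ ε w : ℝ) : ℂ) * P ω -
        ∑ i, (Complex.I * (w i : ℂ)) * ((ε i ω : ℂ) * Pc i ω) =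
        -((s * quadForm μ ε a ω : ℝ) : ℂ) * P ω + ((s * τ : ℝ) : ℂ) * P ω +
        ∑ i, Complex.I * ((w i * ε i ω : ℝ) : ℂ) * R i := by
      have hDω : D ω = ∑ i, (Complex.I * ((w i * ε i ω : ℝ) : ℂ) * R i +
          (Complex.I * (w i : ℂ)) * ((ε i ω : ℂ) * Pc i ω)
          + (-(s : ℂ) * P ω) * ((w i * ε i ω * L i : ℝ) : ℂ)) := by
        rw [hD]
        refine Finset.sum_congr rfl fun i _ => ?_
        rw [smul_eq_mul, hR]
        push_cast
        ring_nf
        simp only [Complex.I_sq]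
        ring
      rw [hDω, Finset.sum_add_distrib, Finset.sum_add_distrib, ← Finset.mul_sum,
        ← Complex.ofReal_sum, hq]
      push_cast
      ring
    rw [e]
    have hP1 : ‖P ω‖ ≤ 1 := norm_prod_thin_le s _ hw _
    refine (norm_add₃_le).trans (add_le_add_three ?_ ?_ ?_)
    · rw [norm_mul, norm_neg, Complex.norm_real, Real.norm_eq_abs, abs_mul]
      exact mul_le_of_le_one_right (by positivity) hP1
    · rw [norm_mul, Complex.norm_real, Real.norm_eq_abs, abs_mul]
      exact mul_le_of_le_one_right (by positivity) hP1
    · refine norm_sum_le_of_le _ fun i _ => ?_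
      rw [norm_mul, norm_mul, Complex.norm_I, one_mul, Complex.norm_real, Real.norm_eq_abs,
        abs_mul, abs_of_nonneg (hw i).1]
      exact mul_le_mul (mul_le_of_le_one_left (abs_nonneg _) (hw i).2) (hRn i) (norm_nonneg _)
        (abs_nonneg _)
  have hX2 : ∀ i ω, |ε i ω| * (4 * (|s| * X i ω) ^ 2) =
      4 * s ^ 2 * ∑ j ∈ ball d r i, ∑ k ∈ ball d r i, |ε i ω| * |ε j ω| * |ε k ω| := by
    intro i ω
    rw [mul_pow, sq_abs, hX, sq (∑ j ∈ ball d r i, |ε j ω|), Finset.sum_mul_sum]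
    simp_rw [Finset.mul_sum]
    exact Finset.sum_congr rfl fun j _ => Finset.sum_congr rfl fun k _ => by ring
  have hXi : ∀ i, Integrable (fun ω => |ε i ω| * (4 * (|s| * X i ω) ^ 2)) μ := fun i => by
    simp_rw [hX2]
    exact (integrable_finsetSum _ fun j _ => integrable_finsetSum _ fun k _ =>
      h.integrable_abs_mul₃ i j k).const_mul _
  have hXint : ∀ i, ∫ ω, |ε i ω| * (4 * (|s| * X i ω) ^ 2) ∂μ ≤
      4 * s ^ 2 * ((1 + 3 * c) * ((ball d r i).card : ℝ) ^ 2) := fun i => by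
    simp_rw [hX2]
    rw [integral_const_mul, integral_finsetSum _ fun j _ => integrable_finsetSum _ fun k _ =>
      h.integrable_abs_mul₃ i j k]
    refine mul_le_mul_of_nonneg_left ?_ (by positivity)
    calc _ ≤ ∑ j ∈ ball d r i, ∑ k ∈ ball d r i, (1 + 3 * c) := by
          refine Finset.sum_le_sum fun j _ => ?_
          rw [integral_finsetSum _ fun k _ => h.integrable_abs_mul₃ i j k]
          exact Finset.sum_le_sum fun k _ => h.integral_abs_mul₃_le i j k
      _ = _ := by simp; ring
  have hτb : |τ| ≤ c * (Fintype.card V : ℝ) ^ 2 * ρ ^ r := by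
    calc |τ| ≤ ∑ q : V × V, c * ρ ^ r := by
          refine (Finset.abs_sum_le_sum_abs _ _).trans (Finset.sum_le_sum fun q _ => ?_)
          have hc := h.const_nonneg
          have hρr : 0 ≤ ρ ^ r := Real.rpow_nonneg hρ.1.le _
          by_cases hq : d q.1 q.2 ≤ ENNReal.ofReal r
          · simp only [ha, near, if_pos hq, mul_one, sub_self, zero_mul, abs_zero]
            positivity
          · simp only [ha, near, if_neg hq, mul_zero, sub_zero, abs_mul]
            have h1 := abs_thinCoeff_le hw q.1 q.2
            have h2 := h.abs_errCov_le q.1 q.2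
            have h3 := mul_le_mul_of_nonneg_left
              (decay_le_of_ofReal_le hρ hr (not_le.1 hq).le) hc
            have := mul_le_mul h1 (h2.trans h3) (abs_nonneg _) zero_le_one
            linarith
      _ = _ := by simp; ring
  -- the errors beyond radius `r` are nearly uncorrelated with `ε i`
  have hfar : ∀ i, ‖∫ ω, (ε i ω : ℂ) * Pc i ω ∂μ‖ ≤
      c * (1 + |s| * (Fintype.card V : ℝ)) * ρ ^ r := fun i => by
    refine (h.norm_integral_mul_prod_thin_le hρ hw s i _).trans ?_
    have h1 : (((ball d r i)ᶜ : Finset V).card : ℝ) ≤ Fintype.card V := by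
      exact_mod_cast Finset.card_le_univ _
    have h2 : decay ρ (setDistance d {i} ((ball d r i)ᶜ : Finset V)) ≤ ρ ^ r := by
      refine decay_le_of_ofReal_le hρ hr ?_
      simp only [setDistance, Set.mem_singleton_iff, le_iInf_iff]
      rintro _ rfl j hj
      have : j ∉ ball d r _ := Finset.mem_compl.1 (Finset.mem_coe.1 hj)
      rw [mem_ball_iff] at this
      exact (not_le.1 this).le
    have := h.const_nonneg
    have := decay_nonneg hρ.1 (setDistance d {i} ((ball d r i)ᶜ : Finset V))
    gcongr
  have hsplit : (∫ ω, D ω ∂μ) + ((s * thinVar μ ε w : ℝ) : ℂ) * ∫ ω, P ω ∂μ =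
      (∫ ω, (D ω + ((s * thinVar μ ε w : ℝ) : ℂ) * P ω -
      ∑ i, (Complex.I * (w i : ℂ)) * ((ε i ω : ℂ) * Pc i ω)) ∂μ) +
      ∑ i, (Complex.I * (w i : ℂ)) * ∫ ω, (ε i ω : ℂ) * Pc i ω ∂μ := by
    have e1 : Integrable (fun ω => ∑ i, (Complex.I * (w i : ℂ)) * ((ε i ω : ℂ) * Pc i ω)) μ :=
      integrable_finsetSum _ fun i _ => (hPci i).const_mul _
    have e2 : Integrable (fun ω => ((s * thinVar μ ε w : ℝ) : ℂ) * P ω) μ := hPi.const_mul _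
    have e3 : Integrable (fun ω => D ω + ((s * thinVar μ ε w : ℝ) : ℂ) * P ω) μ := hDi.add e2
    rw [integral_sub e3 e1, integral_add hDi e2, integral_const_mul,
      integral_finsetSum _ fun i _ => (hPci i).const_mul _]
    simp_rw [integral_const_mul]
    ring
  rw [hsplit]
  have b1 : ‖∑ i, (Complex.I * (w i : ℂ)) * ∫ ω, (ε i ω : ℂ) * Pc i ω ∂μ‖ ≤
      (Fintype.card V : ℝ) * (c * (1 + |s| * (Fintype.card V : ℝ)) * ρ ^ r) := by
    calc _ ≤ ∑ i : V, c * (1 + |s| * (Fintype.card V : ℝ)) * ρ ^ r := by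
          refine norm_sum_le_of_le _ fun i _ => ?_
          rw [norm_mul, norm_mul, Complex.norm_I, one_mul, Complex.norm_real, Real.norm_eq_abs,
            abs_of_nonneg (hw i).1]
          exact (mul_le_of_le_one_left (norm_nonneg _) (hw i).2).trans (hfar i)
      _ = _ := by simp
  have b2 : ‖∫ ω, (D ω + ((s * thinVar μ ε w : ℝ) : ℂ) * P ω -
      ∑ i, (Complex.I * (w i : ℂ)) * ((ε i ω : ℂ) * Pc i ω)) ∂μ‖ ≤
      |s| * (∫ ω, |quadForm μ ε a ω| ∂μ) + |s| * |τ| +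
        ∑ i, 4 * s ^ 2 * ((1 + 3 * c) * ((ball d r i).card : ℝ) ^ 2) := by
    have i1 : Integrable (fun ω => |s| * |quadForm μ ε a ω|) μ :=
      (h.integrable_quadForm a).abs.const_mul _
    have i2 : Integrable (fun ω => |s| * |quadForm μ ε a ω| + |s| * |τ|) μ :=
      i1.add (integrable_const _)
    have i3 : Integrable (fun ω => ∑ i, |ε i ω| * (4 * (|s| * X i ω) ^ 2)) μ :=
      integrable_finsetSum _ fun i _ => hXi i
    refine (norm_integral_le_of_norm_le (i2.add i3) (.of_forall hpt)).trans ?_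
    rw [integral_add' i2 i3, integral_add i1 (integrable_const _), integral_const_mul,
      integral_finsetSum _ fun i _ => hXi i]
    simp only [integral_const, probReal_univ, one_smul]
    gcongr with i
    exact hXint i
  have b3 := h.integral_abs_quadForm_le hρ hr haB
  refine (norm_add_le _ _).trans ((add_le_add b2 b1).trans ?_)
  rw [odeError, ← Finset.mul_sum, ← Finset.mul_sum]
  have := mul_le_mul_of_nonneg_left b3 (abs_nonneg s)
  have := mul_le_mul_of_nonneg_left hτb (abs_nonneg s)
  linarith

end DecayingField

/-! ### Gaussian approximation for weights in the unit interval -/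

/-- An approximate solution of `F' = - t Q F` is close to the Gaussian characteristic function. -/
lemma norm_sub_gaussian_le_of_ode {F F' : ℝ → ℂ} {Q E s : ℝ} (h0 : F 0 = 1)
    (hF : ∀ t, HasDerivAt F (F' t) t)
    (hE : ∀ t, |t| ≤ |s| → ‖F' t + ((t * Q : ℝ) : ℂ) * F t‖ ≤ E) :
    ‖F s - (Real.exp (-(Q * s ^ 2 / 2)) : ℝ)‖ ≤ E * |s| * Real.exp (|Q| * s ^ 2) := by
  -- `G` is the integrating factor
  set G : ℝ → ℝ := fun t => Real.exp (Q * t ^ 2 / 2) with hG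
  have hGd : ∀ t, HasDerivAt G (t * Q * G t) t := fun t => by
    have := (((hasDerivAt_pow 2 t).const_mul Q).div_const 2).exp
    refine this.congr_deriv ?_
    simp [hG]; ring_nf
  have hgd : ∀ t, HasDerivAt (fun t => F t * (G t : ℂ))
      ((F' t + ((t * Q : ℝ) : ℂ) * F t) * (G t : ℂ)) t := fun t => by
    refine ((hF t).mul (hGd t).ofReal_comp).congr_deriv ?_
    push_cast; ring
  have hGb : ∀ t, |t| ≤ |s| → G t ≤ Real.exp (|Q| * s ^ 2 / 2) := fun t ht => by
    refine Real.exp_le_exp.2 ?_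
    have h1 : t ^ 2 ≤ s ^ 2 := sq_le_sq.2 ht
    have h2 := le_abs_self Q
    have h3 := mul_le_mul h2 h1 (sq_nonneg t) (abs_nonneg Q)
    linarith
  have hE0 : 0 ≤ E := (norm_nonneg _).trans (hE 0 (by simp))
  have key := Convex.norm_image_sub_le_of_norm_hasDerivWithin_le (s := Set.Icc (-|s|) |s|)
    (f := fun t => F t * (G t : ℂ)) (C := E * Real.exp (|Q| * s ^ 2 / 2)) (x := 0) (y := s)
    (fun t _ => (hgd t).hasDerivWithinAt) (fun t ht => ?_) (convex_Icc _ _)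
    (by simp) (by simp [neg_abs_le, le_abs_self])
  · have e : F s - (Real.exp (-(Q * s ^ 2 / 2)) : ℝ) =
        (Real.exp (-(Q * s ^ 2 / 2)) : ℝ) * (F s * (G s : ℂ) - F 0 * (G 0 : ℂ)) := by
      have : ((Real.exp (-(Q * s ^ 2 / 2)) : ℝ) : ℂ) * (G s : ℂ) = 1 := by
        rw [← Complex.ofReal_mul, hG, ← Real.exp_add]; simp
      have hG0 : G 0 = 1 := by simp [hG]
      rw [h0, hG0, mul_sub, mul_left_comm, this]
      simp
    rw [e, norm_mul, Complex.norm_real, Real.norm_eq_abs, Real.abs_exp]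
    have h1 : Real.exp (-(Q * s ^ 2 / 2)) ≤ Real.exp (|Q| * s ^ 2 / 2) := by
      refine Real.exp_le_exp.2 ?_
      have := mul_le_mul_of_nonneg_right (neg_abs_le Q) (sq_nonneg s)
      linarith
    calc _ ≤ Real.exp (|Q| * s ^ 2 / 2) * (E * Real.exp (|Q| * s ^ 2 / 2) * ‖s - 0‖) :=
          mul_le_mul h1 key (norm_nonneg _) (Real.exp_pos _).le
      _ = _ := by
          have : Real.exp (|Q| * s ^ 2) =
              Real.exp (|Q| * s ^ 2 / 2) * Real.exp (|Q| * s ^ 2 / 2) := by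
            rw [← Real.exp_add, add_halves]
          rw [sub_zero, Real.norm_eq_abs, this]
          ring
  · rw [norm_mul, Complex.norm_real, Real.norm_eq_abs, abs_of_pos (Real.exp_pos _)]
    have := abs_le.2 ht
    exact mul_le_mul (hE t this) (hGb t this) (Real.exp_pos _).le hE0

lemma abs_exp_neg_sub_exp_neg_le {a b : ℝ} (ha : 0 ≤ a) (hb : 0 ≤ b) :
    |Real.exp (-a) - Real.exp (-b)| ≤ |a - b| := by
  wlog hab : a ≤ b generalizing a b
  · rw [abs_sub_comm, abs_sub_comm a]; exact this hb ha (le_of_not_ge hab)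
  have h1 : Real.exp (-b) ≤ Real.exp (-a) := Real.exp_le_exp.2 (by linarith)
  rw [abs_of_nonneg (by linarith), abs_sub_comm, abs_of_nonneg (by linarith)]
  have h2 := Real.add_one_le_exp (a - b)
  have h3 : Real.exp (-b) = Real.exp (-a) * Real.exp (a - b) := by rw [← Real.exp_add]; ring_nf
  have h4 : Real.exp (-a) ≤ 1 := Real.exp_le_one_iff.2 (by linarith)
  have h5 := Real.exp_pos (-a)
  nlinarith

namespace DecayingField

variable {V Ω : Type*} [MeasurableSpace Ω] {μ : Measure Ω}
  [IsProbabilityMeasure μ] {ε : V → Ω → ℝ} {d : V → V → ℝ≥0∞} {ρ c : ℝ}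
  [Fintype V] [DecidableEq V]

lemma odeError_mono (h : DecayingField μ ε d ρ c) (hρ : ρ ∈ Set.Ioo (0 : ℝ) 1) {r s t : ℝ}
    (hst : |t| ≤ |s|) : odeError d ρ c r t ≤ odeError d ρ c r s := by
  have := h.const_nonneg
  have : 0 ≤ ρ ^ r := Real.rpow_nonneg hρ.1.le _
  have h2 : t ^ 2 ≤ s ^ 2 := sq_le_sq.2 hst
  unfold odeError
  gcongr

lemma norm_integral_prod_thin_sub_le (h : DecayingField μ ε d ρ c) (hρ : ρ ∈ Set.Ioo (0 : ℝ) 1)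
    {r : ℝ} (hr : 0 ≤ r) {w : V → ℝ} (hw : ∀ j, w j ∈ Set.Icc (0 : ℝ) 1) (s : ℝ) :
    ‖∫ ω, ∏ j, thin (w j) s (ε j ω) ∂μ - (Real.exp (-(thinVar μ ε w * s ^ 2 / 2)) : ℝ)‖ ≤
      odeError d ρ c r s * |s| * Real.exp (|thinVar μ ε w| * s ^ 2) := by
  refine norm_sub_gaussian_le_of_ode (F := fun s => ∫ ω, ∏ j, thin (w j) s (ε j ω) ∂μ)
    (by simp [thin]) (fun t => (h.hasDerivAt_integral_prod_thin hw t).2) fun t ht => ?_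
  exact (h.norm_deriv_add_le hρ hr hw t).trans (h.odeError_mono hρ ht)

/-- The excess of the variance of a thinned sum over the variance of the weighted sum. -/
noncomputable def thinExcess (μ : Measure Ω) (ε : V → Ω → ℝ) (w : V → ℝ) : ℝ :=
  ∑ i, w i * (1 - w i) * errCov μ ε i i

lemma errCov_self_nonneg (i : V) : 0 ≤ errCov μ ε i i := by
  simp only [errCov, Matrix.of_apply]
  exact integral_nonneg fun ω => mul_self_nonneg _

/-- The variance of the weighted sum `∑ i, w i * ε i`. -/
noncomputable def sumVar (μ : Measure Ω) (ε : V → Ω → ℝ) (w : V → ℝ) : ℝ :=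
  ∑ i, ∑ j, w i * w j * errCov μ ε i j

lemma thinVar_eq (w : V → ℝ) : thinVar μ ε w = sumVar μ ε w + thinExcess μ ε w := by
  rw [thinVar, sumVar, thinExcess, Fintype.sum_prod_type, ← Finset.sum_add_distrib]
  refine Finset.sum_congr rfl fun i _ => ?_
  rw [← Finset.add_sum_erase _ _ (Finset.mem_univ i), ← Finset.add_sum_erase _
    (fun j => w i * w j * errCov μ ε i j) (Finset.mem_univ i)]
  have : ∑ j ∈ Finset.univ.erase i, thinCoeff w i j * errCov μ ε i j =
      ∑ j ∈ Finset.univ.erase i, w i * w j * errCov μ ε i j :=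
    Finset.sum_congr rfl fun j hj => by simp [thinCoeff, Finset.ne_of_mem_erase hj]
  rw [this, thinCoeff, Function.update_self]
  ring

/-- The difference between a thinned sum and the weighted sum is approximately an independent
Gaussian, whose variance is the excess variance. -/
lemma norm_integral_prod_thin_sub_weighted_le (h : DecayingField μ ε d ρ c)
    (hρ : ρ ∈ Set.Ioo (0 : ℝ) 1) {r : ℝ} (hr : 0 ≤ r) {w : V → ℝ}
    (hw : ∀ j, w j ∈ Set.Icc (0 : ℝ) 1) (s : ℝ) :
    ‖∫ ω, ∏ j, thin (w j) s (ε j ω) ∂μ - (Real.exp (-(thinExcess μ ε w * s ^ 2 / 2)) : ℝ) *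
      ∫ ω, Complex.exp (Complex.I * ((s * ∑ j, w j * ε j ω : ℝ) : ℂ)) ∂μ‖ ≤
      7 * |s| ^ 3 * ((Fintype.card V : ℝ) * (1 + 3 * c)) + s ^ 2 / 2 *
        √(1 ^ 2 * c * (4 * ∑ i, ((ball d r i).card : ℝ) ^ 3 +
      (∑ i, ((ball d r i).card : ℝ)) ^ 2 * ρ ^ r)) := by
  set a : V → V → ℝ := fun i j => if i = j then w i * (1 - w i) else 0 with ha
  have hw2 : ∀ i, 0 ≤ w i * (1 - w i) := fun i => mul_nonneg (hw i).1 (sub_nonneg.2 (hw i).2)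
  have haB : ∀ i j, |a i j| ≤ 1 * near d r i j := fun i j => by
    by_cases hij : i = j
    · subst hij
      simp only [ha, if_true, near, h.isDistance.self, zero_le, abs_of_nonneg (hw2 i)]
      nlinarith [(hw i).1, (hw i).2]
    · simpa [ha, hij] using near_nonneg r i j
  have hq : ∀ ω, quadForm μ ε a ω = ∑ i, w i * (1 - w i) * ε i ω ^ 2 - thinExcess μ ε w := by
    intro ω
    rw [quadForm, Fintype.sum_prod_type, thinExcess, ← Finset.sum_sub_distrib]
    refine Finset.sum_congr rfl fun i _ => ?_
    rw [Finset.sum_eq_single i (fun j _ hj => by simp [ha, hj.symm]) (by simp)]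
    simp only [ha, if_true]; ring
  have hκ : 0 ≤ thinExcess μ ε w :=
    Finset.sum_nonneg fun i _ => mul_nonneg (hw2 i) (errCov_self_nonneg i)
  have hexpm : AEStronglyMeasurable
      (fun ω => Complex.exp (Complex.I * ((s * ∑ j, w j * ε j ω : ℝ) : ℂ))) μ := by
    have h1 : AEStronglyMeasurable (fun ω => ∑ j, w j * ε j ω) μ :=
      Finset.aestronglyMeasurable_fun_sum _ fun j _ => (h.aesm j).const_mul _
    have h2 : Continuous fun x : ℝ => Complex.exp (Complex.I * ((s * x : ℝ) : ℂ)) := by fun_prop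
    exact h2.comp_aestronglyMeasurable h1
  have hexpi : Integrable
      (fun ω => Complex.exp (Complex.I * ((s * ∑ j, w j * ε j ω : ℝ) : ℂ))) μ :=
    Integrable.of_bound hexpm 1 (.of_forall fun ω => (norm_cexp_I_mul _).le)
  rw [← integral_const_mul, ← integral_sub (h.integrable_prod_thin hw s _) (hexpi.const_mul _)]
  have hpt : ∀ ω, ‖∏ j, thin (w j) s (ε j ω) - (Real.exp (-(thinExcess μ ε w * s ^ 2 / 2)) : ℝ) *
      Complex.exp (Complex.I * ((s * ∑ j, w j * ε j ω : ℝ) : ℂ))‖ ≤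
      7 * |s| ^ 3 * (∑ j, |ε j ω| * |ε j ω| * |ε j ω|) + s ^ 2 / 2 * |quadForm μ ε a ω| := by
    intro ω
    -- the characteristic function of `w j * ε j` plus an independent Gaussian, given `ε`
    set g : V → ℂ := fun j => Complex.exp (Complex.I * ((s * (w j * ε j ω) : ℝ) : ℂ) -
      ((s ^ 2 / 2 * (w j * (1 - w j) * ε j ω ^ 2) : ℝ) : ℂ)) with hg
    have hg1 : ∀ j, ‖g j‖ ≤ 1 := fun j => by
      rw [hg, Complex.norm_exp, Real.exp_le_one_iff, Complex.sub_re, Complex.ofReal_re,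
        Complex.re_mul_ofReal, Complex.I_re]
      have := hw2 j
      have : 0 ≤ s ^ 2 / 2 * (w j * (1 - w j) * ε j ω ^ 2) := by positivity
      linarith
    have h1 : ‖∏ j, thin (w j) s (ε j ω) - ∏ j, g j‖ ≤
        7 * |s| ^ 3 * (∑ j, |ε j ω| * |ε j ω| * |ε j ω|) := by
      refine (norm_prod_sub_prod_le (fun j => norm_thin_le (hw j) _ _) hg1 _).trans ?_
      rw [Finset.mul_sum]
      refine Finset.sum_le_sum fun j _ => (norm_thin_sub_gaussian_le (hw j) s _).trans_eq ?_
      ring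
    have h2 : ∏ j, g j = (Real.exp (-(s ^ 2 / 2 * ∑ j, w j * (1 - w j) * ε j ω ^ 2)) : ℝ) *
        Complex.exp (Complex.I * ((s * ∑ j, w j * ε j ω : ℝ) : ℂ)) := by
      rw [hg, ← Complex.exp_sum, Complex.ofReal_exp, ← Complex.exp_add]
      congr 1
      push_cast
      rw [Finset.sum_sub_distrib, Finset.mul_sum, Finset.mul_sum, Finset.mul_sum]
      ring
    have h3 : ‖∏ j, g j - (Real.exp (-(thinExcess μ ε w * s ^ 2 / 2)) : ℝ) *
        Complex.exp (Complex.I * ((s * ∑ j, w j * ε j ω : ℝ) : ℂ))‖ ≤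
        s ^ 2 / 2 * |quadForm μ ε a ω| := by
      rw [h2, ← sub_mul, norm_mul, norm_cexp_I_mul, mul_one, ← Complex.ofReal_sub,
        Complex.norm_real, Real.norm_eq_abs]
      refine (abs_exp_neg_sub_exp_neg_le ?_ (by positivity)).trans (le_of_eq ?_)
      · exact mul_nonneg (by positivity) (Finset.sum_nonneg fun j _ =>
          mul_nonneg (hw2 j) (sq_nonneg _))
      · rw [show s ^ 2 / 2 * ∑ j, w j * (1 - w j) * ε j ω ^ 2 - thinExcess μ ε w * s ^ 2 / 2 =
          s ^ 2 / 2 * quadForm μ ε a ω by rw [hq]; ring, abs_mul, abs_of_nonneg (by positivity)]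
    have := norm_add_le (∏ j, thin (w j) s (ε j ω) - ∏ j, g j) (∏ j, g j -
      (Real.exp (-(thinExcess μ ε w * s ^ 2 / 2)) : ℝ) *
        Complex.exp (Complex.I * ((s * ∑ j, w j * ε j ω : ℝ) : ℂ)))
    rw [sub_add_sub_cancel] at this
    linarith
  have i1 : Integrable (fun ω => 7 * |s| ^ 3 * (∑ j, |ε j ω| * |ε j ω| * |ε j ω|)) μ :=
    (integrable_finsetSum _ fun j _ => h.integrable_abs_mul₃ j j j).const_mul _
  have i2 : Integrable (fun ω => s ^ 2 / 2 * |quadForm μ ε a ω|) μ :=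
    (h.integrable_quadForm a).abs.const_mul _
  refine (norm_integral_le_of_norm_le (i1.add i2) (.of_forall hpt)).trans ?_
  rw [integral_add' i1 i2, integral_const_mul, integral_const_mul,
    integral_finsetSum _ fun j _ => h.integrable_abs_mul₃ j j j]
  have := h.integral_abs_quadForm_le hρ hr haB
  have : ∑ j, ∫ ω, |ε j ω| * |ε j ω| * |ε j ω| ∂μ ≤ (Fintype.card V : ℝ) * (1 + 3 * c) := by
    refine (Finset.sum_le_sum fun j _ => h.integral_abs_mul₃_le j j j).trans_eq ?_
    rw [Finset.sum_const, nsmul_eq_mul, Finset.card_univ]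
  gcongr

/-- Gaussian approximation of a weighted sum with weights in the unit interval. -/
lemma norm_integral_exp_sub_gaussian_le (h : DecayingField μ ε d ρ c)
    (hρ : ρ ∈ Set.Ioo (0 : ℝ) 1) {r : ℝ} (hr : 0 ≤ r) {w : V → ℝ}
    (hw : ∀ j, w j ∈ Set.Icc (0 : ℝ) 1) (s : ℝ) {M : ℝ}
    (hM : ∑ i, ∑ j, c * decay ρ (d i j) ≤ M) :
    ‖∫ ω, Complex.exp (Complex.I * ((s * ∑ j, w j * ε j ω : ℝ) : ℂ)) ∂μ -
      (Real.exp (-(sumVar μ ε w * s ^ 2 / 2)) : ℝ)‖ ≤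
      Real.exp (2 * M * s ^ 2) * (odeError d ρ c r s * |s| +
      (7 * |s| ^ 3 * ((Fintype.card V : ℝ) * (1 + 3 * c)) + s ^ 2 / 2 *
        √(1 ^ 2 * c * (4 * ∑ i, ((ball d r i).card : ℝ) ^ 3 +
      (∑ i, ((ball d r i).card : ℝ)) ^ 2 * ρ ^ r)))) := by
  have hQ : |thinVar μ ε w| ≤ M := by
    refine ((Finset.abs_sum_le_sum_abs _ _).trans ?_).trans hM
    rw [← Fintype.sum_prod_type']
    refine Finset.sum_le_sum fun q _ => ?_
    rw [abs_mul]
    exact (mul_le_of_le_one_left (abs_nonneg _) (abs_thinCoeff_le hw _ _)).trans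
      (h.abs_errCov_le _ _)
  have hκ : thinExcess μ ε w ≤ M := by
    refine le_trans (Finset.sum_le_sum fun i _ => ?_) hM
    have h1 : w i * (1 - w i) * errCov μ ε i i ≤ c * decay ρ (d i i) := by
      have : w i * (1 - w i) ≤ 1 := by nlinarith [(hw i).1, (hw i).2]
      exact (mul_le_of_le_one_left (errCov_self_nonneg i) this).trans
        ((le_abs_self _).trans (h.abs_errCov_le i i))
    refine h1.trans (Finset.single_le_sum (f := fun j => c * decay ρ (d i j))
      (fun j _ => mul_nonneg h.const_nonneg (decay_nonneg hρ.1 _)) (Finset.mem_univ i))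
  set κ := thinExcess μ ε w
  set Q := thinVar μ ε w
  have hM0 : 0 ≤ M := (abs_nonneg _).trans hQ
  have h1 := h.norm_integral_prod_thin_sub_le hρ hr hw s
  have h2 := h.norm_integral_prod_thin_sub_weighted_le hρ hr hw s
  set P := ∫ ω, ∏ j, thin (w j) s (ε j ω) ∂μ
  set Z := ∫ ω, Complex.exp (Complex.I * ((s * ∑ j, w j * ε j ω : ℝ) : ℂ)) ∂μ
  set T := 7 * |s| ^ 3 * ((Fintype.card V : ℝ) * (1 + 3 * c)) + s ^ 2 / 2 *
        √(1 ^ 2 * c * (4 * ∑ i, ((ball d r i).card : ℝ) ^ 3 +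
      (∑ i, ((ball d r i).card : ℝ)) ^ 2 * ρ ^ r))
  -- divide out the Gaussian factor of variance `κ`
  have e : Z - (Real.exp (-(sumVar μ ε w * s ^ 2 / 2)) : ℝ) = (Real.exp (κ * s ^ 2 / 2) : ℝ) *
      ((P - (Real.exp (-(Q * s ^ 2 / 2)) : ℝ)) - (P - (Real.exp (-(κ * s ^ 2 / 2)) : ℝ) * Z)) := by
    have a1 : ((Real.exp (κ * s ^ 2 / 2) : ℝ) : ℂ) * (Real.exp (-(κ * s ^ 2 / 2)) : ℝ) = 1 := by
      rw [← Complex.ofReal_mul, ← Real.exp_add]; simp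
    have a2 : ((Real.exp (κ * s ^ 2 / 2) : ℝ) : ℂ) * (Real.exp (-(Q * s ^ 2 / 2)) : ℝ) =
        (Real.exp (-(sumVar μ ε w * s ^ 2 / 2)) : ℝ) := by
      rw [← Complex.ofReal_mul, ← Real.exp_add]
      have : Q = sumVar μ ε w + κ := thinVar_eq w
      rw [this]
      ring_nf
    linear_combination -Z * a1 + a2
  have hT : 0 ≤ T := (norm_nonneg _).trans h2
  have hO : 0 ≤ odeError d ρ c r s * |s| := by
    have := (norm_nonneg _).trans h1
    exact nonneg_of_mul_nonneg_left this (Real.exp_pos _)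
  rw [e, norm_mul, Complex.norm_real, Real.norm_eq_abs, Real.abs_exp]
  have h3 : Real.exp (κ * s ^ 2 / 2) ≤ Real.exp (M * s ^ 2) := by
    refine Real.exp_le_exp.2 ?_
    nlinarith [sq_nonneg s, mul_le_mul_of_nonneg_right hκ (sq_nonneg s),
      mul_nonneg hM0 (sq_nonneg s)]
  have h4 : Real.exp (|Q| * s ^ 2) ≤ Real.exp (M * s ^ 2) :=
    Real.exp_le_exp.2 (mul_le_mul_of_nonneg_right hQ (sq_nonneg s))
  have h5 : 1 ≤ Real.exp (M * s ^ 2) := Real.one_le_exp (by positivity)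
  calc _ ≤ Real.exp (M * s ^ 2) *
        (odeError d ρ c r s * |s| * Real.exp (M * s ^ 2) + T * Real.exp (M * s ^ 2)) := by
        refine mul_le_mul h3 ((norm_sub_le _ _).trans (add_le_add (h1.trans ?_) (h2.trans ?_)))
          (norm_nonneg _) (Real.exp_pos _).le
        · gcongr
        · exact le_mul_of_one_le_right hT h5
    _ = _ := by
        rw [show 2 * M * s ^ 2 = M * s ^ 2 + M * s ^ 2 by ring, Real.exp_add]; ring

end DecayingField

/-! ### From a cone of directions to all directions -/

/-- A law on the plane whose projections on a cone of directions about the first axis are centered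
Gaussian, with variances given by a quadratic form, has a Gaussian second marginal: the
moment generating function is analytic along the line through `(1, 0)` and `(0, b)`. -/
lemma integral_exp_snd_of_cone {ν : Measure (ℝ × ℝ)} [IsProbabilityMeasure ν] {A B D : ℝ}
    (h : ∀ u ∈ Set.Icc (-1 : ℝ) 1, ∀ t : ℝ,
      ∫ z, Complex.exp (Complex.I * ((t * (z.1 + u * z.2) : ℝ) : ℂ)) ∂ν =
        (Real.exp (-((A + 2 * u * B + u ^ 2 * D) * t ^ 2 / 2)) : ℝ)) (t : ℝ) :
    ∫ z, Complex.exp (Complex.I * ((t * z.2 : ℝ) : ℂ)) ∂ν =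
      (Real.exp (-(D * t ^ 2 / 2)) : ℝ) := by
  -- the projections are Gaussian, hence have exponential moments
  have hq : ∀ u ∈ Set.Icc (-1 : ℝ) 1, 0 ≤ A + 2 * u * B + u ^ 2 * D := fun u hu => by
    have h1 : ‖∫ z, Complex.exp (Complex.I * ((1 * (z.1 + u * z.2) : ℝ) : ℂ)) ∂ν‖ ≤ 1 := by
      have := norm_integral_le_of_norm_le_const (μ := ν) (C := 1) (f := fun z : ℝ × ℝ =>
        Complex.exp (Complex.I * ((1 * (z.1 + u * z.2) : ℝ) : ℂ)))
        (.of_forall fun z => (norm_cexp_I_mul _).le)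
      simpa using this
    rw [h u hu 1, Complex.norm_real, Real.norm_eq_abs, Real.abs_exp, Real.exp_le_one_iff] at h1
    linarith
  have hmeas : ∀ u : ℝ, Measurable fun z : ℝ × ℝ => z.1 + u * z.2 := fun u => by fun_prop
  have hlaw : ∀ u ∈ Set.Icc (-1 : ℝ) 1, ν.map (fun z => z.1 + u * z.2) =
      gaussianReal 0 (A + 2 * u * B + u ^ 2 * D).toNNReal := fun u hu => by
    have := Measure.isProbabilityMeasure_map (μ := ν) (hmeas u).aemeasurable
    refine Measure.ext_of_charFun (funext fun t => ?_)
    rw [charFun_gaussianReal, charFun_apply_real, integral_map (hmeas u).aemeasurable (by fun_prop)]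
    have := h u hu t
    rw [Complex.ofReal_exp] at this
    convert this using 2
    · ext z; congr 1; push_cast; ring
    · rw [Real.coe_toNNReal _ (hq u hu)]; push_cast; ring
  have hmgf : ∀ u ∈ Set.Icc (-1 : ℝ) 1, ∀ t : ℝ, mgf (fun z : ℝ × ℝ => z.1 + u * z.2) ν t =
      Real.exp ((A + 2 * u * B + u ^ 2 * D) * t ^ 2 / 2) := fun u hu t => by
    rw [mgf_gaussianReal (hlaw u hu), Real.coe_toNNReal _ (hq u hu), zero_mul, zero_add]
  have hint : ∀ u ∈ Set.Icc (-1 : ℝ) 1, ∀ t : ℝ,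
      Integrable (fun z : ℝ × ℝ => Real.exp (t * (z.1 + u * z.2))) ν := fun u hu t => by
    rw [← mgf_pos_iff, hmgf u hu]; exact Real.exp_pos _
  have hint' : ∀ a b : ℝ, Integrable (fun z : ℝ × ℝ => Real.exp (a * z.1 + b * z.2)) ν :=
    fun a b => by
    refine Integrable.mono' ((hint 1 (by simp) (a + b)).add (hint (-1) (by simp) (a - b)))
      (by fun_prop) (.of_forall fun z => ?_)
    rw [Real.norm_eq_abs, Real.abs_exp]
    have e : a * z.1 + b * z.2 = ((a + b) * (z.1 + 1 * z.2) + (a - b) * (z.1 + -1 * z.2)) / 2 := by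
      ring
    simp only [Pi.add_apply]
    rcases le_total ((a + b) * (z.1 + 1 * z.2)) ((a - b) * (z.1 + -1 * z.2)) with hle | hle
    · exact (Real.exp_le_exp.2 (by linarith)).trans (le_add_of_nonneg_left (Real.exp_pos _).le)
    · exact (Real.exp_le_exp.2 (by linarith)).trans (le_add_of_nonneg_right (Real.exp_pos _).le)
  -- the moment generating function of the second coordinate, by analytic continuation
  have hsnd : ∀ b : ℝ, ∫ z : ℝ × ℝ, Real.exp (b * z.2) ∂ν = Real.exp (D * b ^ 2 / 2) := by
    intro b
    set ν' : Measure (ℝ × ℝ) := ν.withDensity fun z => ENNReal.ofReal (Real.exp z.1) with hν'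
    set Z : ℝ × ℝ → ℝ := fun z => b * z.2 - z.1 with hZ
    have hdens : ∀ f : ℝ × ℝ → ℝ, ∫ z, f z ∂ν' = ∫ z, Real.exp z.1 * f z ∂ν := fun f => by
      rw [hν', integral_withDensity_eq_integral_toReal_smul (by fun_prop)
        (.of_forall fun _ => ENNReal.ofReal_lt_top)]
      refine integral_congr_ae (.of_forall fun z => ?_)
      simp [ENNReal.toReal_ofReal (Real.exp_pos _).le]
    have hmgfZ : ∀ τ, mgf Z ν' τ = ∫ z, Real.exp ((1 - τ) * z.1 + τ * b * z.2) ∂ν := fun τ => by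
      rw [mgf, hdens]
      refine integral_congr_ae (.of_forall fun z => ?_)
      simp only [hZ]
      rw [← Real.exp_add]; ring_nf
    have hset : integrableExpSet Z ν' = Set.univ := by
      refine Set.eq_univ_of_forall fun τ => ?_
      rw [integrableExpSet, Set.mem_ofPred_eq, hν', integrable_withDensity_iff_integrable_smul'
        (by fun_prop) (.of_forall fun _ => ENNReal.ofReal_lt_top)]
      refine (hint' (1 - τ) (τ * b)).congr (.of_forall fun z => ?_)
      simp only [hZ, ENNReal.toReal_ofReal (Real.exp_pos _).le, smul_eq_mul]
      rw [← Real.exp_add]; ring_nf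
    have hA1 : AnalyticOnNhd ℝ (mgf Z ν') Set.univ := by
      have := analyticOnNhd_mgf (X := Z) (μ := ν')
      rwa [hset, interior_univ] at this
    set R : ℝ → ℝ := fun τ =>
      Real.exp ((A * (1 - τ) ^ 2 + 2 * B * ((1 - τ) * (τ * b)) + D * (τ * b) ^ 2) / 2) with hR
    have hA2 : AnalyticOnNhd ℝ R Set.univ := fun τ _ => by fun_prop
    have hev : mgf Z ν' =ᶠ[𝓝 0] R := by
      have h1 : ∀ᶠ τ : ℝ in 𝓝 0, τ < 1 :=
        (continuous_id.tendsto (0 : ℝ)).eventually (gt_mem_nhds (by norm_num))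
      have h2 : ∀ᶠ τ : ℝ in 𝓝 0, |τ * b| / (1 - τ) < 1 := by
        have : ContinuousAt (fun τ : ℝ => |τ * b| / (1 - τ)) 0 :=
          ContinuousAt.div (by fun_prop) (by fun_prop) (by norm_num)
        exact this.tendsto.eventually (gt_mem_nhds (by simp))
      filter_upwards [h1, h2] with τ h1 h2
      have h3 : 0 < 1 - τ := by linarith
      have hu : τ * b / (1 - τ) ∈ Set.Icc (-1 : ℝ) 1 := by
        rw [Set.mem_Icc, ← abs_le, abs_div, abs_of_pos h3]; exact h2.le
      rw [hmgfZ, hR]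
      have := hmgf _ hu (1 - τ)
      rw [mgf] at this
      convert this using 2
      · ext z; congr 1; field_simp
      · field_simp
    have := hA1.eqOn_of_preconnected_of_eventuallyEq hA2 isPreconnected_univ (Set.mem_univ 0) hev
      (Set.mem_univ 1)
    rw [hmgfZ, hR] at this
    simpa using this
  have hD : 0 ≤ D := by
    have h1 := hsnd 1
    have h2 := hsnd (-1)
    have i1 : Integrable (fun z : ℝ × ℝ => Real.exp (1 * z.2)) ν := by simpa using hint' 0 1
    have i2 : Integrable (fun z : ℝ × ℝ => Real.exp (-1 * z.2)) ν := by simpa using hint' 0 (-1)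
    have h3 : (2 : ℝ) ≤ ∫ z : ℝ × ℝ, (Real.exp (1 * z.2) + Real.exp (-1 * z.2)) ∂ν := by
      have : ∫ _ : ℝ × ℝ, (2 : ℝ) ∂ν = 2 := by simp
      rw [← this]
      refine integral_mono (integrable_const _) (i1.add i2) fun z => ?_
      have h5 := Real.add_one_le_exp (1 * z.2)
      have h6 := Real.add_one_le_exp (-1 * z.2)
      simp only
      linarith
    rw [integral_add i1 i2, h1, h2] at h3
    by_contra hneg
    push Not at hneg
    have h7 : Real.exp (D * 1 ^ 2 / 2) < 1 := by rw [Real.exp_lt_one_iff]; linarith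
    have h8 : Real.exp (D * (-1) ^ 2 / 2) < 1 := by rw [Real.exp_lt_one_iff]; linarith
    linarith
  have hY : mgf (fun z : ℝ × ℝ => z.2) ν = mgf id (gaussianReal 0 D.toNNReal) := by
    ext b
    rw [mgf_id_gaussianReal, mgf, hsnd, Real.coe_toNNReal _ hD]
    simp
  have hset : integrableExpSet (fun z : ℝ × ℝ => z.2) ν = Set.univ :=
    Set.eq_univ_of_forall fun b => by simpa [integrableExpSet] using hint' 0 b
  have := eqOn_complexMGF_of_mgf hY (x := t * Complex.I) (by rw [hset]; simp)
  rw [complexMGF_id_mul_I, charFun_gaussianReal, complexMGF] at this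
  rw [Complex.ofReal_exp]
  convert this using 2
  · ext z; congr 1; push_cast; ring
  · rw [Real.coe_toNNReal _ hD]; push_cast; ring

open scoped NNReal in
/-- Asymptotic normality of `S n + u * W n` for all `|u| ≤ 1` implies that of `W n`. -/
lemma tendsto_integral_exp_of_cone {Ω : ℕ → Type*} [∀ n, MeasurableSpace (Ω n)]
    {μ : ∀ n, Measure (Ω n)} [∀ n, IsProbabilityMeasure (μ n)] {S W : ∀ n, Ω n → ℝ}
    (hS : ∀ n, AEMeasurable (S n) (μ n)) (hW : ∀ n, AEMeasurable (W n) (μ n))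
    {M : ℝ} (hS2 : ∀ᶠ n in atTop, Integrable (fun ω => S n ω ^ 2) (μ n) ∧ ∫ ω, S n ω ^ 2 ∂μ n ≤ M)
    (hW2 : ∀ᶠ n in atTop, Integrable (fun ω => W n ω ^ 2) (μ n) ∧ ∫ ω, W n ω ^ 2 ∂μ n ≤ M)
    {A B D : ℕ → ℝ} (hA : ∀ᶠ n in atTop, |A n| ≤ M) (hB : ∀ᶠ n in atTop, |B n| ≤ M)
    (hD : ∀ᶠ n in atTop, |D n| ≤ M)
    (h : ∀ u ∈ Set.Icc (-1 : ℝ) 1, ∀ t : ℝ, Tendsto (fun n =>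
      ∫ ω, Complex.exp (Complex.I * ((t * (S n ω + u * W n ω) : ℝ) : ℂ)) ∂μ n -
        (Real.exp (-((A n + 2 * u * B n + u ^ 2 * D n) * t ^ 2 / 2)) : ℝ)) atTop (𝓝 0)) (t : ℝ) :
    Tendsto (fun n => ∫ ω, Complex.exp (Complex.I * ((t * W n ω : ℝ) : ℂ)) ∂μ n -
      (Real.exp (-(D n * t ^ 2 / 2)) : ℝ)) atTop (𝓝 0) := by
  -- along an ultrafilter, the tight laws of `(S n, W n)` and the bounded variances converge
  rw [tendsto_iff_ultrafilter]
  intro 𝒰 h𝒰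
  have hSW : ∀ n, AEMeasurable (fun ω => (S n ω, W n ω)) (μ n) := fun n => (hS n).prodMk (hW n)
  set ν : ℕ → ProbabilityMeasure (ℝ × ℝ) := fun n =>
    ⟨(μ n).map fun ω => (S n ω, W n ω), Measure.isProbabilityMeasure_map (hSW n)⟩ with hν
  have hνint : ∀ n (f : ℝ × ℝ → ℂ), Continuous f →
      ∫ z, f z ∂(ν n : Measure (ℝ × ℝ)) = ∫ ω, f (S n ω, W n ω) ∂μ n := fun n f hf => by
    simp only [hν, ProbabilityMeasure.coe_mk]
    exact integral_map (hSW n) hf.aestronglyMeasurable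
  -- Chebyshev's inequality
  have hcheb : ∀ {n : ℕ} {f : Ω n → ℝ} {a : ℝ}, 0 < a → Integrable (fun ω => f ω ^ 2) (μ n) →
      ∫ ω, f ω ^ 2 ∂μ n ≤ M → μ n {ω | a < |f ω|} ≤ ENNReal.ofReal (M / a ^ 2) := by
    intro n f a ha hi hM
    have h1 := mul_meas_ge_le_integral_of_nonneg (.of_forall fun ω => sq_nonneg (f ω)) hi (a ^ 2)
    have h2 : μ n {ω | a < |f ω|} ≤ μ n {ω | a ^ 2 ≤ f ω ^ 2} := measure_mono fun ω hω => by
      have : a < |f ω| := hω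
      show a ^ 2 ≤ f ω ^ 2
      rw [← sq_abs (f ω)]
      gcongr
    rw [← ENNReal.ofReal_toReal (measure_ne_top (μ n) _)]
    refine ENNReal.ofReal_le_ofReal ?_
    rw [le_div_iff₀ (by positivity)]
    have h3 := ENNReal.toReal_mono (measure_ne_top _ _) h2
    change _ * (μ n {ω | a ^ 2 ≤ f ω ^ 2}).toReal ≤ _ at h1
    nlinarith [sq_nonneg a]
  set K : ℕ → Set (ℝ × ℝ) := fun k => Metric.closedBall 0 ((k : ℝ) + 1) with hK
  set m : ℕ → ℝ≥0 := fun k => Real.toNNReal (2 * M / ((k : ℝ) + 1) ^ 2) with hm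
  have hmlim : Tendsto m atTop (𝓝 0) := by
    have : Tendsto (fun k : ℕ => 2 * M / ((k : ℝ) + 1) ^ 2) atTop (𝓝 0) := by
      refine Tendsto.div_atTop tendsto_const_nhds ?_
      exact (tendsto_pow_atTop (by norm_num)).comp
        (tendsto_atTop_add_const_right _ _ tendsto_natCast_atTop_atTop)
    simpa [Function.comp_def, hm] using (continuous_real_toNNReal.tendsto _).comp this
  have hcomp := isCompact_setOfPred_probabilityMeasure_mass_eq_compl_isCompact_le (K := K) hmlim
    (fun k => isCompact_closedBall _ _) (.inl inferInstance)
  have hmem : ∀ᶠ n in (𝒰 : Filter ℕ), ν n ∈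
      {ν : ProbabilityMeasure (ℝ × ℝ) | ∀ k, ν (K k)ᶜ ≤ m k} := by
    filter_upwards [hS2.filter_mono h𝒰, hW2.filter_mono h𝒰] with n hS2 hW2 k
    have hM : 0 ≤ M := (integral_nonneg fun ω => sq_nonneg _).trans hS2.2
    have hk : (0 : ℝ) < (k : ℝ) + 1 := by positivity
    have hkey : (μ n).map (fun ω => (S n ω, W n ω)) (K k)ᶜ ≤ (m k : ℝ≥0∞) := by
      rw [Measure.map_apply_of_aemeasurable (hSW n) Metric.isClosed_closedBall.measurableSet.compl]
      calc _ ≤ μ n ({ω | (k : ℝ) + 1 < |S n ω|} ∪ {ω | (k : ℝ) + 1 < |W n ω|}) := by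
            refine measure_mono fun ω hω => ?_
            have : ¬ (S n ω, W n ω) ∈ K k := hω
            simp only [hK, mem_closedBall_zero_iff, Prod.norm_def, sup_le_iff, not_and_or,
              not_le] at this
            exact this
        _ ≤ _ := measure_union_le _ _
        _ ≤ _ := add_le_add (hcheb hk hS2.1 hS2.2) (hcheb hk hW2.1 hW2.2)
        _ = _ := by
            rw [← ENNReal.ofReal_add (by positivity) (by positivity), hm, ENNReal.ofReal]
            congr 2; ring
    exact_mod_cast (ENNReal.coe_le_coe.1 (by simpa [hν] using! hkey) : ν n (K k)ᶜ ≤ m k)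
  obtain ⟨ν₀, -, hν₀⟩ := hcomp.ultrafilter_le_nhds (𝒰.map ν) (by
    rw [le_principal_iff]; exact hmem)
  have hν₀' : Tendsto ν 𝒰 (𝓝 ν₀) := hν₀
  rw [ProbabilityMeasure.tendsto_iff_forall_integral_rclike_tendsto ℂ] at hν₀'
  have hlimreal : ∀ {a : ℕ → ℝ}, (∀ᶠ n in atTop, |a n| ≤ M) → ∃ a₀, Tendsto a 𝒰 (𝓝 a₀) := by
    intro a ha
    obtain ⟨a₀, -, ha₀⟩ := (isCompact_Icc (a := -M) (b := M)).ultrafilter_le_nhds (𝒰.map a) (by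
      rw [le_principal_iff]
      exact (ha.filter_mono h𝒰).mono fun n hn => abs_le.1 hn)
    exact ⟨a₀, ha₀⟩
  obtain ⟨A₀, hA₀⟩ := hlimreal hA
  obtain ⟨B₀, hB₀⟩ := hlimreal hB
  obtain ⟨D₀, hD₀⟩ := hlimreal hD
  have hlim : ∀ a b : ℝ, Tendsto (fun n =>
      ∫ ω, Complex.exp (Complex.I * ((a * S n ω + b * W n ω : ℝ) : ℂ)) ∂μ n) 𝒰
      (𝓝 (∫ z, Complex.exp (Complex.I * ((a * z.1 + b * z.2 : ℝ) : ℂ))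
        ∂(ν₀ : Measure (ℝ × ℝ)))) := by
    intro a b
    have hc : Continuous fun z : ℝ × ℝ =>
      Complex.exp (Complex.I * ((a * z.1 + b * z.2 : ℝ) : ℂ)) := by fun_prop
    have := hν₀' (BoundedContinuousFunction.ofNormedAddCommGroup _ hc 1
      fun z => (norm_cexp_I_mul _).le)
    simp only [BoundedContinuousFunction.coe_ofNormedAddCommGroup] at this
    simp_rw [hνint _ _ hc] at this
    exact this
  have hcone : ∀ u ∈ Set.Icc (-1 : ℝ) 1, ∀ t : ℝ,
      ∫ z, Complex.exp (Complex.I * ((t * (z.1 + u * z.2) : ℝ) : ℂ)) ∂(ν₀ : Measure (ℝ × ℝ)) =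
        (Real.exp (-((A₀ + 2 * u * B₀ + u ^ 2 * D₀) * t ^ 2 / 2)) : ℝ) := by
    intro u hu t
    have h1 := hlim t (t * u)
    have h2 := (h u hu t).mono_left h𝒰
    have h3 : Tendsto (fun n => ((Real.exp (-((A n + 2 * u * B n + u ^ 2 * D n) * t ^ 2 / 2)) : ℝ)
        : ℂ)) 𝒰 (𝓝 (Real.exp (-((A₀ + 2 * u * B₀ + u ^ 2 * D₀) * t ^ 2 / 2)) : ℝ)) := by
      refine (Complex.continuous_ofReal.tendsto _).comp ((Real.continuous_exp.tendsto _).comp ?_)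
      exact ((((hA₀.add (hB₀.const_mul _)).add (hD₀.const_mul _)).mul_const _).div_const _).neg
    have h4 := h2.add h3
    simp only [sub_add_cancel, zero_add] at h4
    simp_rw [show ∀ x y : ℝ, t * (x + u * y) = t * x + t * u * y from fun x y => by ring] at h4 ⊢
    exact tendsto_nhds_unique h1 h4
  have hfin := integral_exp_snd_of_cone hcone t
  have h1 := hlim 0 t
  simp only [zero_mul, zero_add] at h1
  rw [hfin] at h1
  have h3 : Tendsto (fun n => ((Real.exp (-(D n * t ^ 2 / 2)) : ℝ) : ℂ)) 𝒰
      (𝓝 (Real.exp (-(D₀ * t ^ 2 / 2)) : ℝ)) := by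
    refine (Complex.continuous_ofReal.tendsto _).comp ((Real.continuous_exp.tendsto _).comp ?_)
    exact ((hD₀.mul_const _).div_const _).neg
  simpa using h1.sub h3

/-! ### Consequences of the neighborhood growth -/

/-- The growth condition at a fixed size `n`. -/
def GrowthAt {n : ℕ} (d : Fin n → Fin n → ℝ≥0∞) (c₁ g : ℝ) : Prop :=
  ∀ m : ℕ, max (√((1 / (n : ℝ)) * ∑ i, (nbhdSize d m i : ℝ) ^ 3))
        ((1 / (n : ℝ)) * ∑ i, (nbhdSize d m i : ℝ) ^ 2) ≤ g * Real.exp (c₁ * m)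

lemma card_ball_le_nbhdSize {V : Type*} [Fintype V] (d : V → V → ℝ≥0∞) (r : ℝ) (i : V) :
    (ball d r i).card ≤ nbhdSize d ⌈r⌉₊ i := by
  refine Finset.card_le_card fun j hj => ?_
  rw [Finset.mem_filter]
  refine ⟨Finset.mem_univ _, (mem_ball_iff.1 hj).trans ?_⟩
  rw [← ENNReal.ofReal_natCast]
  exact ENNReal.ofReal_le_ofReal (Nat.le_ceil r)

lemma GrowthAt.sum_card_ball_le {n : ℕ} {d : Fin n → Fin n → ℝ≥0∞} {c₁ g : ℝ}
    (h : GrowthAt d c₁ g) (hg : 0 < g) (hc₁ : 0 < c₁) (hn : 0 < n) {r : ℝ} (hr : 0 ≤ r) :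
    (∑ i, ((ball d r i).card : ℝ) ≤ n * (g * Real.exp c₁ * Real.exp (c₁ * r))) ∧
    (∑ i, ((ball d r i).card : ℝ) ^ 2 ≤ n * (g * Real.exp c₁ * Real.exp (c₁ * r))) ∧
    (∑ i, ((ball d r i).card : ℝ) ^ 3 ≤ n * (g * Real.exp c₁ * Real.exp (c₁ * r)) ^ 2) := by
  have hn' : (0 : ℝ) < n := by exact_mod_cast hn
  have hexp : g * Real.exp (c₁ * ⌈r⌉₊) ≤ g * Real.exp c₁ * Real.exp (c₁ * r) := by
    rw [mul_assoc, ← Real.exp_add]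
    refine mul_le_mul_of_nonneg_left (Real.exp_le_exp.2 ?_) hg.le
    nlinarith [Nat.ceil_lt_add_one hr]
  have h0 := h ⌈r⌉₊
  have h2 : ∑ i, (nbhdSize d ⌈r⌉₊ i : ℝ) ^ 2 ≤ n * (g * Real.exp c₁ * Real.exp (c₁ * r)) := by
    have := ((le_max_right _ _).trans h0).trans hexp
    rwa [one_div, inv_mul_le_iff₀ hn'] at this
  have h3 : ∑ i, (nbhdSize d ⌈r⌉₊ i : ℝ) ^ 3 ≤ n * (g * Real.exp c₁ * Real.exp (c₁ * r)) ^ 2 := by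
    have := ((le_max_left _ _).trans h0).trans hexp
    rw [Real.sqrt_le_left (by positivity)] at this
    rwa [one_div, inv_mul_le_iff₀ hn'] at this
  have hle : ∀ i, ((ball d r i).card : ℝ) ≤ nbhdSize d ⌈r⌉₊ i := fun i => by
    exact_mod_cast card_ball_le_nbhdSize d r i
  have h2' : ∑ i, ((ball d r i).card : ℝ) ^ 2 ≤ n * (g * Real.exp c₁ * Real.exp (c₁ * r)) :=
    (Finset.sum_le_sum fun i _ => pow_le_pow_left₀ (Nat.cast_nonneg _) (hle i) _).trans h2
  refine ⟨(Finset.sum_le_sum fun i _ => ?_).trans h2', h2',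
    (Finset.sum_le_sum fun i _ => pow_le_pow_left₀ (Nat.cast_nonneg _) (hle i) _).trans h3⟩
  exact_mod_cast Nat.le_self_pow two_ne_zero _

/-- The decay function is dominated by a sum over integer layers. -/
lemma decay_le_sum_near {V : Type*} [Fintype V] {d : V → V → ℝ≥0∞} {ρ : ℝ}
    (hρ : ρ ∈ Set.Ioo (0 : ℝ) 1) {i j : V} {S : ℕ} (hS : ⌊(d i j).toReal⌋₊ < S) :
    decay ρ (d i j) ≤ ∑ s ∈ Finset.range S, ρ ^ s * near d ((s + 1 : ℕ) : ℝ) i j := by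
  have h0 : ∀ s ∈ Finset.range S, 0 ≤ ρ ^ s * near d ((s + 1 : ℕ) : ℝ) i j := fun s _ =>
    mul_nonneg (pow_nonneg hρ.1.le _) (near_nonneg _ _ _)
  by_cases hd : d i j = ⊤
  · simpa [decay, hd] using Finset.sum_nonneg h0
  refine le_trans ?_ (Finset.single_le_sum h0 (Finset.mem_range.2 hS))
  have : d i j ≤ ENNReal.ofReal ((⌊(d i j).toReal⌋₊ + 1 : ℕ) : ℝ) := by
    rw [ENNReal.le_ofReal_iff_toReal_le hd (by positivity)]
    push_cast
    exact (Nat.lt_floor_add_one _).le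
  rw [near, if_pos this, mul_one, decay, if_neg hd, ← Real.rpow_natCast]
  exact Real.rpow_le_rpow_of_exponent_ge hρ.1 hρ.2.le (Nat.floor_le ENNReal.toReal_nonneg)

/-- The constant in `GrowthAt.sum_mul_decay_le`, from a geometric series over integer layers of the
distance. -/
noncomputable def layerConst (ρ c₁ g : ℝ) : ℝ :=
  √g * Real.exp (c₁ / 2) * (1 - ρ * Real.exp (c₁ / 2))⁻¹

/-- Since the growth rate of the neighborhoods is beaten by the decay, the matrix of decays is
bounded from `ℓ⁴` to its dual, up to a power of `n`. -/
lemma GrowthAt.sum_mul_decay_le {n : ℕ} {d : Fin n → Fin n → ℝ≥0∞} {ρ c₁ g : ℝ}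
    (h : GrowthAt d c₁ g) (hd : IsDistance d) (hρ : ρ ∈ Set.Ioo (0 : ℝ) 1) (hg : 0 < g)
    (hrate : ρ * Real.exp (c₁ / 2) < 1) (u : Fin n → ℝ) :
    ∑ i, ∑ j, |u i| * |u j| * decay ρ (d i j) ≤
      layerConst ρ c₁ g * (√n * √(∑ i, u i ^ 4)) := by
  rcases Nat.eq_zero_or_pos n with rfl | hn
  · simp
  have hn' : (0 : ℝ) < n := by exact_mod_cast hn
  -- a number of layers that exhausts all finite distances
  set S : ℕ := 1 + ∑ i, ∑ j, ⌊(d i j).toReal⌋₊ with hS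
  have hlt : ∀ i j, ⌊(d i j).toReal⌋₊ < S := fun i j => by
    have h1 := Finset.single_le_sum (f := fun j => ⌊(d i j).toReal⌋₊) (fun _ _ => Nat.zero_le _)
      (Finset.mem_univ j)
    have h2 := Finset.single_le_sum (f := fun i => ∑ j, ⌊(d i j).toReal⌋₊)
      (fun _ _ => Nat.zero_le _) (Finset.mem_univ i)
    omega
  have hlayer : ∀ s : ℕ, ∑ i, ∑ j, |u i| * |u j| * near d ((s + 1 : ℕ) : ℝ) i j ≤
      √(∑ i, u i ^ 4) * (√n * (√g * Real.exp (c₁ / 2) ^ (s + 1))) := by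
    intro s
    set b : Fin n → ℝ := fun i => ((ball d ((s + 1 : ℕ) : ℝ) i).card : ℝ) with hb
    have e1 : ∑ i, ∑ j, u i ^ 2 * near d ((s + 1 : ℕ) : ℝ) i j = ∑ i, u i ^ 2 * b i := by
      simp_rw [← Finset.mul_sum, sum_near]; rfl
    have e2 : ∑ i, ∑ j, u j ^ 2 * near d ((s + 1 : ℕ) : ℝ) i j = ∑ i, u i ^ 2 * b i := by
      rw [Finset.sum_comm]
      simp_rw [← Finset.mul_sum, sum_near' hd]; rfl
    have h1 : ∑ i, ∑ j, |u i| * |u j| * near d ((s + 1 : ℕ) : ℝ) i j ≤ ∑ i, u i ^ 2 * b i := by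
      calc _ ≤ ∑ i, ∑ j, (u i ^ 2 * near d ((s + 1 : ℕ) : ℝ) i j +
            u j ^ 2 * near d ((s + 1 : ℕ) : ℝ) i j) / 2 := by
            refine Finset.sum_le_sum fun i _ => Finset.sum_le_sum fun j _ => ?_
            have := near_nonneg (d := d) ((s + 1 : ℕ) : ℝ) i j
            rw [← sq_abs (u i), ← sq_abs (u j)]
            nlinarith [mul_nonneg this (sq_nonneg (|u i| - |u j|))]
        _ = _ := by
            simp_rw [← Finset.sum_div, Finset.sum_add_distrib]
            rw [e1, e2]; ring
    have h2 : ∑ i, u i ^ 2 * b i ≤ √(∑ i, u i ^ 4) * √(∑ i, b i ^ 2) := by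
      have := Real.sum_mul_le_sqrt_mul_sqrt Finset.univ (fun i => u i ^ 2) b
      simpa [← pow_mul] using this
    have h3 : √(∑ i, b i ^ 2) ≤ √n * (√g * Real.exp (c₁ / 2) ^ (s + 1)) := by
      have hm := (le_max_right _ _).trans (h (s + 1))
      rw [one_div, inv_mul_le_iff₀ hn'] at hm
      have hexp : Real.exp (c₁ / 2) ^ (s + 1) = √(Real.exp (c₁ * ((s + 1 : ℕ) : ℝ))) := by
        rw [← Real.exp_nat_mul, ← Real.exp_half]
        congr 1; ring
      rw [hexp, ← Real.sqrt_mul hg.le, ← Real.sqrt_mul hn'.le]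
      refine Real.sqrt_le_sqrt (le_trans (le_of_eq ?_) hm)
      refine Finset.sum_congr rfl fun i _ => ?_
      simp only [hb, ball, nbhdSize, ENNReal.ofReal_natCast]
    exact h1.trans (h2.trans (mul_le_mul_of_nonneg_left h3 (Real.sqrt_nonneg _)))
  set q := ρ * Real.exp (c₁ / 2) with hq
  have hq0 : 0 ≤ q := mul_nonneg hρ.1.le (Real.exp_pos _).le
  calc _ ≤ ∑ i, ∑ j, |u i| * |u j| *
        ∑ s ∈ Finset.range S, ρ ^ s * near d ((s + 1 : ℕ) : ℝ) i j := by
        refine Finset.sum_le_sum fun i _ => Finset.sum_le_sum fun j _ => ?_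
        exact mul_le_mul_of_nonneg_left (decay_le_sum_near hρ (hlt i j)) (by positivity)
    _ = ∑ s ∈ Finset.range S, ρ ^ s * ∑ i, ∑ j, |u i| * |u j| * near d ((s + 1 : ℕ) : ℝ) i j := by
        simp_rw [Finset.mul_sum]
        rw [Finset.sum_congr rfl fun i _ => Finset.sum_comm, Finset.sum_comm]
        exact Finset.sum_congr rfl fun s _ => Finset.sum_congr rfl fun i _ =>
          Finset.sum_congr rfl fun j _ => by ring
    _ ≤ ∑ s ∈ Finset.range S, ρ ^ s *
        (√(∑ i, u i ^ 4) * (√n * (√g * Real.exp (c₁ / 2) ^ (s + 1)))) :=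
        Finset.sum_le_sum fun s _ => mul_le_mul_of_nonneg_left (hlayer s) (pow_nonneg hρ.1.le _)
    _ = √g * Real.exp (c₁ / 2) * (∑ s ∈ Finset.range S, q ^ s) * (√n * √(∑ i, u i ^ 4)) := by
        rw [Finset.mul_sum, Finset.sum_mul]
        refine Finset.sum_congr rfl fun s _ => ?_
        rw [hq]; ring
    _ ≤ _ := by
        rw [layerConst]
        gcongr
        rw [← tsum_geometric_of_lt_one hq0 hrate]
        exact (summable_geometric_of_lt_one hq0 hrate).sum_le_tsum _ fun s _ => pow_nonneg hq0 _

lemma layerConst_nonneg {ρ c₁ g : ℝ} (hrate : ρ * Real.exp (c₁ / 2) < 1) :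
    0 ≤ layerConst ρ c₁ g := by
  have : 0 ≤ (1 - ρ * Real.exp (c₁ / 2))⁻¹ := inv_nonneg.2 (by linarith)
  unfold layerConst
  positivity

lemma GrowthAt.sum_decay_le {n : ℕ} {d : Fin n → Fin n → ℝ≥0∞} {ρ c₁ g : ℝ}
    (h : GrowthAt d c₁ g) (hd : IsDistance d) (hρ : ρ ∈ Set.Ioo (0 : ℝ) 1) (hg : 0 < g)
    (hrate : ρ * Real.exp (c₁ / 2) < 1) :
    ∑ i, ∑ j, decay ρ (d i j) ≤ layerConst ρ c₁ g * n := by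
  have := h.sum_mul_decay_le hd hρ hg hrate fun _ => 1
  simpa using this

/-- The asymptotic regime: correlations that decay at rate `ρ`, growing neighborhoods, and
truncation radii `r n` at which both the long-range correlations and the neighborhoods are
negligible. -/
structure Regime {Ω : ℕ → Type*} [∀ n, MeasurableSpace (Ω n)]
    (μ : ∀ n, Measure (Ω n)) (ε : ∀ n, Fin n → Ω n → ℝ)
    (d : ∀ n, Fin n → Fin n → ℝ≥0∞) (ρ c₁ c g : ℝ) (r : ℕ → ℝ) : Prop where
  mem_Ioo : ρ ∈ Set.Ioo (0 : ℝ) 1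
  rate_pos : 0 < c₁
  growth_pos : 0 < g
  rate_lt : ρ * Real.exp (c₁ / 2) < 1
  field : ∀ n, DecayingField (μ n) (ε n) (d n) ρ c
  growth : ∀ n, GrowthAt (d n) c₁ g
  radius_nonneg : ∀ n, 0 ≤ r n
  tendsto_nbhd : Tendsto (fun n : ℕ => Real.exp (c₁ * r n) ^ 2 / n) atTop (𝓝 0)
  tendsto_decay : Tendsto (fun n : ℕ => n * ρ ^ r n) atTop (𝓝 0)

namespace Regime

variable {Ω : ℕ → Type*} [∀ n, MeasurableSpace (Ω n)]
    {μ : ∀ n, Measure (Ω n)} [∀ n, IsProbabilityMeasure (μ n)] {ε : ∀ n, Fin n → Ω n → ℝ}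
    {d : ∀ n, Fin n → Fin n → ℝ≥0∞} {ρ c₁ c g : ℝ} {r : ℕ → ℝ}

/-- The bound on the normalized fluctuations of quadratic forms in nearby errors. -/
noncomputable def fluct (ρ c₁ c g : ℝ) (r : ℕ → ℝ) (n : ℕ) : ℝ :=
  √(c * (g * Real.exp c₁) ^ 2 * (4 * (Real.exp (c₁ * r n) ^ 2 / n) +
    Real.exp (c₁ * r n) ^ 2 / n * (n * ρ ^ r n)))

lemma tendsto_fluct (h : Regime μ ε d ρ c₁ c g r) :
    Tendsto (fluct ρ c₁ c g r) atTop (𝓝 0) := by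
  have := (((h.tendsto_nbhd.const_mul 4).add (h.tendsto_nbhd.mul h.tendsto_decay)).const_mul
    (c * (g * Real.exp c₁) ^ 2)).sqrt
  simp only [mul_zero, add_zero, Real.sqrt_zero] at this
  exact this

lemma sqrt_fluct_le (h : Regime μ ε d ρ c₁ c g r) {n : ℕ} (hn : 0 < n) (A : ℝ) :
    √(A ^ 2 * c * (4 * ∑ i, ((ball (d n) (r n) i).card : ℝ) ^ 3 +
      (∑ i, ((ball (d n) (r n) i).card : ℝ)) ^ 2 * ρ ^ r n)) ≤
      |A| * (n * fluct ρ c₁ c g r n) := by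
  have hn' : (0 : ℝ) < n := by exact_mod_cast hn
  obtain ⟨h1, -, h3⟩ := (h.growth n).sum_card_ball_le h.growth_pos h.rate_pos hn (h.radius_nonneg n)
  have hc := (h.field n).const_nonneg
  have hρr : 0 ≤ ρ ^ r n := Real.rpow_nonneg h.mem_Ioo.1.le _
  rw [Real.sqrt_le_left (by unfold fluct; positivity), fluct, mul_pow, mul_pow, Real.sq_sqrt
    (by positivity), sq_abs]
  have h4 : (∑ i, ((ball (d n) (r n) i).card : ℝ)) ^ 2 ≤
      (n * (g * Real.exp c₁ * Real.exp (c₁ * r n))) ^ 2 := by gcongr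
  calc _ ≤ A ^ 2 * c * (4 * (n * (g * Real.exp c₁ * Real.exp (c₁ * r n)) ^ 2) +
        (n * (g * Real.exp c₁ * Real.exp (c₁ * r n))) ^ 2 * ρ ^ r n) := by gcongr
    _ = _ := by field_simp

/-- Central limit theorem for weights in the unit interval. -/
lemma tendsto_of_weights_mem_Icc (h : Regime μ ε d ρ c₁ c g r) {w : ∀ n, Fin n → ℝ}
    (hw : ∀ᶠ n in atTop, ∀ i, w n i ∈ Set.Icc (0 : ℝ) 1) (t : ℝ) :
    Tendsto (fun n : ℕ => ∫ ω, Complex.exp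
        (Complex.I * ((t / √n * ∑ j, w n j * ε n j ω : ℝ) : ℂ)) ∂μ n -
      (Real.exp (-(DecayingField.sumVar (μ n) (ε n) (w n) * (t / √n) ^ 2 / 2)) : ℝ))
      atTop (𝓝 0) := by
  set K := layerConst ρ c₁ g with hK
  set x : ℕ → ℝ := fun n => Real.exp (c₁ * r n) ^ 2 / n with hx
  set y : ℕ → ℝ := fun n => n * ρ ^ r n with hy
  set f : ℕ → ℝ := fluct ρ c₁ c g r with hf
  set T := |t| with hT
  set G := g * Real.exp c₁ with hG
  have hlim : Tendsto (fun n : ℕ => Real.exp (2 * (c * K) * t ^ 2) *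
      (c * (T + T ^ 2) * y n + 4 * T ^ 3 * (1 + 3 * c) * G * √(x n) + T ^ 2 * (f n + c * y n) +
      7 * T ^ 3 * (1 + 3 * c) * (√(n : ℝ))⁻¹ + T ^ 2 / 2 * f n)) atTop (𝓝 0) := by
    have l1 := h.tendsto_decay
    have l2 := h.tendsto_nbhd.sqrt
    have l3 := h.tendsto_fluct
    have l4 : Tendsto (fun n : ℕ => (√(n : ℝ))⁻¹) atTop (𝓝 0) :=
      (Real.tendsto_sqrt_atTop.comp tendsto_natCast_atTop_atTop).inv_tendsto_atTop
    have := (((((l1.const_mul (c * (T + T ^ 2))).add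
      (l2.const_mul (4 * T ^ 3 * (1 + 3 * c) * G))).add
      ((l3.add (l1.const_mul c)).const_mul (T ^ 2))).add
      (l4.const_mul (7 * T ^ 3 * (1 + 3 * c)))).add (l3.const_mul (T ^ 2 / 2))).const_mul
      (Real.exp (2 * (c * K) * t ^ 2))
    simp only [mul_zero, add_zero, Real.sqrt_zero] at this
    exact this
  refine squeeze_zero_norm' ?_ hlim
  filter_upwards [hw, eventually_gt_atTop 0] with n hw hn
  have hn' : (0 : ℝ) < n := by exact_mod_cast hn
  have hs : 0 < √(n : ℝ) := Real.sqrt_pos.2 hn'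
  have hss : √(n : ℝ) ^ 2 = n := Real.sq_sqrt hn'.le
  have hn1 : (1 : ℝ) ≤ √(n : ℝ) := Real.one_le_sqrt.2 (by exact_mod_cast hn)
  have hF := h.field n
  have hc := hF.const_nonneg
  have hρr : 0 ≤ ρ ^ r n := Real.rpow_nonneg h.mem_Ioo.1.le _
  have hM : ∑ i, ∑ j, c * decay ρ (d n i j) ≤ c * K * n := by
    simp_rw [← Finset.mul_sum, mul_assoc]
    exact mul_le_mul_of_nonneg_left ((h.growth n).sum_decay_le hF.isDistance h.mem_Ioo h.growth_pos
      h.rate_lt) hc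
  have hmain := hF.norm_integral_exp_sub_gaussian_le h.mem_Ioo (h.radius_nonneg n) hw (t / √n) hM
  have hfl := h.sqrt_fluct_le hn 1
  rw [abs_one, one_mul] at hfl
  obtain ⟨-, h2, -⟩ := (h.growth n).sum_card_ball_le h.growth_pos h.rate_pos hn (h.radius_nonneg n)
  have habs : |t / √(n : ℝ)| = T / √(n : ℝ) := by rw [abs_div, abs_of_pos hs]
  have hT0 : 0 ≤ T := abs_nonneg t
  have hG0 : 0 < G := mul_pos h.growth_pos (Real.exp_pos _)
  have hf0 : 0 ≤ f n := Real.sqrt_nonneg _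
  have hxs : √(x n) = Real.exp (c₁ * r n) / √n := by
    rw [hx, Real.sqrt_div (sq_nonneg _), Real.sqrt_sq (Real.exp_pos _).le]
  refine hmain.trans ?_
  have e0 : 2 * (c * K * n) * (t / √(n : ℝ)) ^ 2 = 2 * (c * K) * t ^ 2 := by
    rw [div_pow, hss]; field_simp
  rw [e0]
  refine mul_le_mul_of_nonneg_left ?_ (Real.exp_pos _).le
  have hsq : (t / √(n : ℝ)) ^ 2 = T ^ 2 / n := by rw [div_pow, hss, hT, sq_abs]
  rw [DecayingField.odeError, Fintype.card_fin, habs, hsq]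
  set H := √(1 ^ 2 * c * (4 * ∑ i, ((ball (d n) (r n) i).card : ℝ) ^ 3 +
      (∑ i, ((ball (d n) (r n) i).card : ℝ)) ^ 2 * ρ ^ r n)) with hH
  have b1 : (n : ℝ) * (c * (1 + T / √n * n) * ρ ^ r n) * (T / √n) ≤ c * (T + T ^ 2) * y n := by
    have e : (n : ℝ) * (c * (1 + T / √n * n) * ρ ^ r n) * (T / √n) =
        c * (T / √n + T ^ 2) * y n := by
      have : (n : ℝ) = √n * √n := by rw [← sq, hss]
      rw [hy]
      simp only
      have : T / √n * n * (T / √n) = T ^ 2 := by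
        rw [show T / √n * n * (T / √n) = T ^ 2 * (n / √n ^ 2) by ring, hss, div_self hn'.ne',
          mul_one]
      linear_combination n * c * ρ ^ r n * this
    rw [e]
    have : T / √n ≤ T := div_le_self hT0 hn1
    have : 0 ≤ y n := mul_nonneg hn'.le hρr
    gcongr
  have b2 : 4 * (T ^ 2 / n) * ((1 + 3 * c) * ∑ i, ((ball (d n) (r n) i).card : ℝ) ^ 2) * (T / √n) ≤
      4 * T ^ 3 * (1 + 3 * c) * G * √(x n) := by
    calc _ ≤ 4 * (T ^ 2 / n) * ((1 + 3 * c) * (n * (G * Real.exp (c₁ * r n)))) * (T / √n) := by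
          gcongr
      _ = _ := by rw [hxs]; field_simp
  have b3 : T / √n * (H + c * (n : ℝ) ^ 2 * ρ ^ r n) * (T / √n) ≤ T ^ 2 * (f n + c * y n) := by
    calc _ ≤ T / √n * (n * f n + c * (n : ℝ) ^ 2 * ρ ^ r n) * (T / √n) := by gcongr
      _ = T ^ 2 / (√n) ^ 2 * (n * f n + c * (n : ℝ) ^ 2 * ρ ^ r n) := by ring
      _ = _ := by rw [hss, hy]; field_simp
  have b4 : 7 * (T / √n) ^ 3 * ((n : ℝ) * (1 + 3 * c)) = 7 * T ^ 3 * (1 + 3 * c) * (√(n : ℝ))⁻¹ := by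
    have : (T / √n) ^ 3 * n = T ^ 3 * (√(n : ℝ))⁻¹ := by
      nth_rewrite 2 [← hss]; field_simp
    linear_combination 7 * (1 + 3 * c) * this
  have b5 : T ^ 2 / n / 2 * H ≤ T ^ 2 / 2 * f n := by
    calc _ ≤ T ^ 2 / n / 2 * (n * f n) := by gcongr
      _ = _ := by field_simp
  linarith

end Regime

/-! ### The central limit theorem for bounded weights -/

namespace DecayingField

variable {V Ω : Type*} [MeasurableSpace Ω] {μ : Measure Ω}
  [IsProbabilityMeasure μ] {ε : V → Ω → ℝ} {d : V → V → ℝ≥0∞} {ρ c : ℝ} [Fintype V]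

lemma sq_sum_eq (w : V → ℝ) (ω : Ω) :
    (∑ i, w i * ε i ω) ^ 2 = ∑ i, ∑ j, w i * w j * (ε i ω * ε j ω) := by
  rw [sq, Finset.sum_mul_sum]
  exact Finset.sum_congr rfl fun i _ => Finset.sum_congr rfl fun j _ => by ring

lemma integrable_sq_sum (h : DecayingField μ ε d ρ c) (w : V → ℝ) :
    Integrable (fun ω => (∑ i, w i * ε i ω) ^ 2) μ := by
  simp_rw [sq_sum_eq]
  exact integrable_finsetSum _ fun i _ => integrable_finsetSum _ fun j _ =>
    (h.integrable_mul i j).const_mul _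

lemma integral_sq_sum (h : DecayingField μ ε d ρ c) (w : V → ℝ) :
    ∫ ω, (∑ i, w i * ε i ω) ^ 2 ∂μ = sumVar μ ε w := by
  simp_rw [sq_sum_eq]
  rw [integral_finsetSum _ fun i _ => integrable_finsetSum _ fun j _ =>
    (h.integrable_mul i j).const_mul _]
  simp_rw [integral_finsetSum _ fun j _ => (h.integrable_mul _ j).const_mul _, integral_const_mul]
  rfl

lemma abs_sum_errCov_le (h : DecayingField μ ε d ρ c) (a b : V → ℝ) :
    |∑ i, ∑ j, a i * b j * errCov μ ε i j| ≤ c * ∑ i, ∑ j, |a i| * |b j| * decay ρ (d i j) := by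
  simp_rw [Finset.mul_sum]
  refine (Finset.abs_sum_le_sum_abs _ _).trans (Finset.sum_le_sum fun i _ =>
    (Finset.abs_sum_le_sum_abs _ _).trans (Finset.sum_le_sum fun j _ => ?_))
  rw [abs_mul, abs_mul]
  have := mul_le_mul_of_nonneg_left (h.abs_errCov_le i j)
    (mul_nonneg (abs_nonneg (a i)) (abs_nonneg (b j)))
  linarith

lemma aemeasurable_sum (h : DecayingField μ ε d ρ c) (w : V → ℝ) :
    AEMeasurable (fun ω => ∑ i, w i * ε i ω) μ :=
  Finset.aemeasurable_fun_sum _ fun i _ => (h.aemeasurable i).const_mul _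

end DecayingField

namespace Regime

open DecayingField

variable {Ω : ℕ → Type*} [∀ n, MeasurableSpace (Ω n)]
    {μ : ∀ n, Measure (Ω n)} [∀ n, IsProbabilityMeasure (μ n)] {ε : ∀ n, Fin n → Ω n → ℝ}
    {d : ∀ n, Fin n → Fin n → ℝ≥0∞} {ρ c₁ c g : ℝ} {r : ℕ → ℝ}

lemma abs_sum_errCov_le (h : Regime μ ε d ρ c₁ c g r) {n : ℕ} {a b : Fin n → ℝ}
    (ha : ∀ i, |a i| ≤ 1) (hb : ∀ i, |b i| ≤ 1) :
    |∑ i, ∑ j, a i * b j * errCov (μ n) (ε n) i j| ≤ c * layerConst ρ c₁ g * n := by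
  refine ((h.field n).abs_sum_errCov_le a b).trans ?_
  rw [mul_assoc]
  refine mul_le_mul_of_nonneg_left (le_trans ?_ ((h.growth n).sum_decay_le (h.field n).isDistance
    h.mem_Ioo h.growth_pos h.rate_lt)) (h.field n).const_nonneg
  refine Finset.sum_le_sum fun i _ => Finset.sum_le_sum fun j _ => ?_
  exact mul_le_of_le_one_left (decay_nonneg h.mem_Ioo.1 _)
    (mul_le_one₀ (ha i) (abs_nonneg _) (hb j))

/-- Central limit theorem for weighted sums with uniformly bounded weights. -/
lemma tendsto_of_weights_bounded (h : Regime μ ε d ρ c₁ c g r) {w : ∀ n, Fin n → ℝ} {b : ℝ}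
    (hb : 0 < b) (hw : ∀ᶠ n in atTop, ∀ i, |w n i| ≤ b) (t : ℝ) :
    Tendsto (fun n : ℕ => ∫ ω, Complex.exp
        (Complex.I * ((t / √n * ∑ j, w n j * ε n j ω : ℝ) : ℂ)) ∂μ n -
      (Real.exp (-(sumVar (μ n) (ε n) (w n) / n * t ^ 2 / 2)) : ℝ)) atTop (𝓝 0) := by
  set v : ∀ n, Fin n → ℝ := fun n i => w n i / b with hv
  have hv1 : ∀ᶠ n in atTop, ∀ i, |v n i| ≤ 1 := hw.mono fun n hn i => by
    rw [hv, abs_div, abs_of_pos hb]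
    exact (div_le_one hb).2 (hn i)
  have hsq : ∀ n : ℕ, √(n : ℝ) ^ 2 = n := fun n => Real.sq_sqrt (Nat.cast_nonneg n)
  set M := c * layerConst ρ c₁ g with hM
  have hdiv : ∀ {n : ℕ} {x : ℝ}, 0 < n → |x| ≤ M * n → |x / n| ≤ M := fun {n x} hn hx => by
    have hn' : (0 : ℝ) < n := by exact_mod_cast hn
    rw [abs_div, abs_of_pos hn']
    exact (div_le_iff₀ hn').2 hx
  have hmom : ∀ u : ∀ n, Fin n → ℝ, (∀ᶠ n in atTop, ∀ i, |u n i| ≤ 1) → ∀ᶠ n : ℕ in atTop,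
      Integrable (fun ω => ((∑ i, u n i * ε n i ω) / √n) ^ 2) (μ n) ∧
      ∫ ω, ((∑ i, u n i * ε n i ω) / √n) ^ 2 ∂μ n ≤ M := by
    intro u hu
    filter_upwards [hu, eventually_gt_atTop 0] with n hu hn
    simp_rw [div_pow, hsq]
    refine ⟨((h.field n).integrable_sq_sum _).div_const _, ?_⟩
    rw [integral_div, (h.field n).integral_sq_sum]
    exact (le_abs_self _).trans (hdiv hn (h.abs_sum_errCov_le hu hu))
  have hone : ∀ᶠ n in atTop, ∀ i : Fin n, |(1 : ℝ)| ≤ 1 := .of_forall fun n i => by simp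
  have key := tendsto_integral_exp_of_cone (μ := μ) (M := M)
    (S := fun n ω => (∑ i, 1 * ε n i ω) / √n) (W := fun n ω => (∑ i, v n i * ε n i ω) / √n)
    (A := fun n => sumVar (μ n) (ε n) (fun _ => 1) / n)
    (B := fun n => (∑ i, ∑ j, 1 * v n j * errCov (μ n) (ε n) i j) / n)
    (D := fun n => sumVar (μ n) (ε n) (v n) / n)
    (fun n => ((h.field n).aemeasurable_sum _).div_const _)
    (fun n => ((h.field n).aemeasurable_sum _).div_const _) (hmom _ hone) (hmom _ hv1)
    (by filter_upwards [hone, eventually_gt_atTop 0] with n h1 hn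
        exact hdiv hn (h.abs_sum_errCov_le h1 h1))
    (by filter_upwards [hone, hv1, eventually_gt_atTop 0] with n h1 h2 hn
        exact hdiv hn (h.abs_sum_errCov_le h1 h2))
    (by filter_upwards [hv1, eventually_gt_atTop 0] with n h1 hn
        exact hdiv hn (h.abs_sum_errCov_le h1 h1)) ?_ (t * b)
  · refine key.congr fun n => ?_
    congr 3
    · ext ω
      congr 3
      simp only [hv, Finset.sum_div, Finset.mul_sum]
      refine Finset.sum_congr rfl fun i _ => ?_
      field_simp
    · have hvw : sumVar (μ n) (ε n) (v n) * b ^ 2 = sumVar (μ n) (ε n) (w n) := by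
        simp only [sumVar, hv, Finset.sum_mul]
        refine Finset.sum_congr rfl fun i _ => Finset.sum_congr rfl fun j _ => ?_
        field_simp
      congr 2
      linear_combination (t ^ 2 / n) * hvw
  · intro u hu t
    -- weights `(1 + u * v) / 2` lie in the unit interval
    have := h.tendsto_of_weights_mem_Icc (w := fun n i => (1 + u * v n i) / 2) (hv1.mono
      fun n hn i => by
        have h1 : |u * v n i| ≤ 1 := by
          rw [abs_mul]; exact mul_le_one₀ (abs_le.2 hu) (abs_nonneg _) (hn i)
        obtain ⟨h2, h3⟩ := abs_le.1 h1
        constructor <;> linarith) (2 * t)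
    refine this.congr fun n => ?_
    congr 3
    · ext ω
      congr 3
      rw [Finset.sum_div, Finset.sum_div, Finset.mul_sum, Finset.mul_sum, ← Finset.sum_add_distrib,
        Finset.mul_sum]
      exact Finset.sum_congr rfl fun i _ => by ring
    · have hsymm : ∑ i, ∑ j, 1 * v n j * errCov (μ n) (ε n) i j =
          ∑ i, ∑ j, v n i * errCov (μ n) (ε n) i j := by
        rw [Finset.sum_comm]
        exact Finset.sum_congr rfl fun i _ => Finset.sum_congr rfl fun j _ => by
          rw [errCov_comm (μ := μ n) j i]; ring
      have hexp : sumVar (μ n) (ε n) (fun i => (1 + u * v n i) / 2) * 4 =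
          sumVar (μ n) (ε n) (fun _ => 1) + 2 * u * (∑ i, ∑ j, 1 * v n j * errCov (μ n) (ε n) i j) +
          u ^ 2 * sumVar (μ n) (ε n) (v n) := by
        have : 2 * u * (∑ i, ∑ j, 1 * v n j * errCov (μ n) (ε n) i j) =
            u * (∑ i, ∑ j, v n i * errCov (μ n) (ε n) i j) +
            u * (∑ i, ∑ j, 1 * v n j * errCov (μ n) (ε n) i j) := by rw [← hsymm]; ring
        rw [this]
        simp only [sumVar, Finset.mul_sum, Finset.sum_mul, ← Finset.sum_add_distrib]
        exact Finset.sum_congr rfl fun i _ => Finset.sum_congr rfl fun j _ => by ring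
      congr 2
      rw [div_pow, hsq]
      linear_combination (t ^ 2 / n) * hexp

end Regime

/-! ### The inverse square root of a symmetric matrix -/

section

/-- The symmetric matrix `A` has its spectrum in `[a, b]`, in terms of its quadratic form. -/
def FormBounds {p : ℕ} (A : Matrix (Fin p) (Fin p) ℝ) (a b : ℝ) : Prop :=
  A.IsHermitian ∧ ∀ x : Fin p → ℝ, a * (x ⬝ᵥ x) ≤ x ⬝ᵥ (A *ᵥ x) ∧ x ⬝ᵥ (A *ᵥ x) ≤ b * (x ⬝ᵥ x)

variable {p : ℕ} {A B : Matrix (Fin p) (Fin p) ℝ} {a b : ℝ}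

lemma eigenvalues_mem_Icc (h : FormBounds A a b) (i : Fin p) :
    h.1.eigenvalues i ∈ Set.Icc a b := by
  have h1 := h.2 ⇑(h.1.eigenvectorBasis i)
  have h2 := h.1.eigenvalues_eq i
  have h3 : (⇑(h.1.eigenvectorBasis i) : Fin p → ℝ) ⬝ᵥ ⇑(h.1.eigenvectorBasis i) = 1 := by
    have := h.1.eigenvectorBasis.orthonormal.1 i
    have h4 := EuclideanSpace.real_norm_sq_eq (h.1.eigenvectorBasis i)
    rw [this] at h4
    simp only [dotProduct, ← sq]
    linarith
  simp only [star_trivial, RCLike.re_to_real] at h2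
  rw [h3, mul_one, mul_one, ← h2] at h1
  exact h1

lemma cfc_apply_entry (hA : A.IsHermitian) (f : ℝ → ℝ) (r s : Fin p) :
    cfc f A r s = ∑ k, (hA.eigenvectorUnitary : Matrix (Fin p) (Fin p) ℝ) r k *
      f (hA.eigenvalues k) * (hA.eigenvectorUnitary : Matrix (Fin p) (Fin p) ℝ) s k := by
  rw [hA.cfc_eq, IsHermitian.cfc, Unitary.conjStarAlgAut_apply, Matrix.mul_apply]
  simp [Matrix.mul_diagonal, Matrix.star_apply]

lemma sum_eigenvectorUnitary_sq (hA : A.IsHermitian) (r : Fin p) :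
    ∑ k, (hA.eigenvectorUnitary : Matrix (Fin p) (Fin p) ℝ) r k ^ 2 = 1 := by
  have h := congrFun (congrFun (Unitary.coe_mul_star_self hA.eigenvectorUnitary) r) r
  simpa [Matrix.mul_apply, Matrix.star_apply, sq] using h

lemma abs_cfc_entry_le (hA : A.IsHermitian) {f : ℝ → ℝ} {δ : ℝ}
    (hf : ∀ i, |f (hA.eigenvalues i)| ≤ δ) (r s : Fin p) : |cfc f A r s| ≤ δ := by
  rw [cfc_apply_entry hA]
  set U := (hA.eigenvectorUnitary : Matrix (Fin p) (Fin p) ℝ)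
  calc _ ≤ ∑ k, (δ / 2 * U r k ^ 2 + δ / 2 * U s k ^ 2) := by
        refine (Finset.abs_sum_le_sum_abs _ _).trans (Finset.sum_le_sum fun k _ => ?_)
        rw [abs_mul, abs_mul, ← sq_abs (U r k), ← sq_abs (U s k)]
        have h0 := (abs_nonneg _).trans (hf k)
        have h1 := mul_le_mul_of_nonneg_left (hf k) (mul_nonneg (abs_nonneg (U r k))
          (abs_nonneg (U s k)))
        nlinarith [mul_nonneg h0 (sq_nonneg (|U r k| - |U s k|))]
    _ = δ := by
        rw [Finset.sum_add_distrib, ← Finset.mul_sum, ← Finset.mul_sum,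
          sum_eigenvectorUnitary_sq hA, sum_eigenvectorUnitary_sq hA]
        ring

lemma finite_spectrum (hA : A.IsHermitian) : (spectrum ℝ A).Finite := by
  rw [hA.spectrum_real_eq_range_eigenvalues]; exact Set.finite_range _

lemma abs_entry_le (h : FormBounds A a b) (ha : 0 ≤ a) (r s : Fin p) : |A r s| ≤ b := by
  have := abs_cfc_entry_le h.1 (f := id) (δ := b) (fun i => by
    obtain ⟨h1, h2⟩ := eigenvalues_mem_Icc h i
    rw [id, abs_of_nonneg (ha.trans h1)]; exact h2) r s
  rwa [cfc_id ℝ A h.1.isSelfAdjoint] at this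

lemma aeval_eq_cfc (hA : A.IsHermitian) (P : Polynomial ℝ) :
    Polynomial.aeval A P = cfc P.eval A := (cfc_polynomial P A hA.isSelfAdjoint).symm

lemma invSqrt_isSymm (A : Matrix (Fin p) (Fin p) ℝ) : (invSqrt A)ᵀ = invSqrt A := by
  have : IsSelfAdjoint (invSqrt A) := cfc_predicate _ _
  simpa [IsSelfAdjoint, star_eq_conjTranspose] using this

lemma invSqrt_mul_mul_invSqrt (h : FormBounds A a b) (ha : 0 < a) :
    invSqrt A * A * invSqrt A = 1 := by
  have hfin := finite_spectrum h.1
  have hsa : IsSelfAdjoint A := h.1.isSelfAdjoint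
  have e : invSqrt A * A * invSqrt A = cfc (fun x : ℝ => (√x)⁻¹ * x * (√x)⁻¹) A := by
    rw [cfc_mul (fun x : ℝ => (√x)⁻¹ * x) (fun x : ℝ => (√x)⁻¹) A (hfin.continuousOn _)
      (hfin.continuousOn _), cfc_mul (fun x : ℝ => (√x)⁻¹) (fun x => x) A (hfin.continuousOn _)
      (hfin.continuousOn _), cfc_id' ℝ A hsa]
    rfl
  rw [e, ← cfc_one ℝ A hsa]
  refine cfc_congr fun x hx => ?_
  rw [h.1.spectrum_real_eq_range_eigenvalues] at hx
  obtain ⟨i, rfl⟩ := hx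
  have hpos : 0 < h.1.eigenvalues i := ha.trans_le (eigenvalues_mem_Icc h i).1
  have h1 := Real.mul_self_sqrt hpos.le
  have h2 := Real.sqrt_pos.2 hpos
  simp only [Pi.one_apply]
  nth_rewrite 2 [← h1]
  field_simp

lemma invSqrt_smul (hA : A.IsHermitian) {t : ℝ} (ht : 0 ≤ t) :
    invSqrt (t • A) = (√t)⁻¹ • invSqrt A := by
  have hfin := finite_spectrum hA
  rw [invSqrt, ← cfc_comp_smul t (fun x : ℝ => (√x)⁻¹) A ((hfin.image _).continuousOn _)
    hA.isSelfAdjoint, invSqrt, ← cfc_smul (√t)⁻¹ _ A (hfin.continuousOn _)]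
  refine cfc_congr fun x _ => ?_
  simp only [smul_eq_mul]
  rw [Real.sqrt_mul ht, mul_inv]

/-- Polynomials that converge to `x ↦ (√x)⁻¹` at every real number. At nonpositive numbers this
function is `0`, by the conventions for the square root and the inverse. -/
lemma exists_polynomial_tendsto_inv_sqrt : ∃ P : ℕ → Polynomial ℝ, ∀ x : ℝ,
    Tendsto (fun k => (P k).eval x) atTop (𝓝 (√x)⁻¹) := by
  set δ : ℕ → ℝ := fun k => 1 / ((k : ℝ) + 1) with hδ
  have hδ0 : ∀ k, 0 < δ k := fun k => by positivity
  have hδl : Tendsto δ atTop (𝓝 0) := tendsto_one_div_add_atTop_nhds_zero_nat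
  set f : ℕ → ℝ → ℝ := fun k x => √x / (|x| + δ k) with hf
  have hfc : ∀ k, Continuous (f k) := fun k =>
    Continuous.div (by fun_prop) (by fun_prop) fun x => by have := hδ0 k; positivity
  choose P hP using fun k : ℕ => exists_polynomial_near_of_continuousOn (-(k : ℝ)) k (f k)
    (hfc k).continuousOn (δ k) (hδ0 k)
  refine ⟨P, fun x => ?_⟩
  have h1 : Tendsto (fun k => f k x) atTop (𝓝 (√x)⁻¹) := by
    rcases le_or_gt x 0 with hx | hx
    · simp [hf, Real.sqrt_eq_zero_of_nonpos hx]
    · have : Tendsto (fun k => √x / (|x| + δ k)) atTop (𝓝 (√x / (|x| + 0))) :=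
        tendsto_const_nhds.div (tendsto_const_nhds.add hδl) (by simpa using hx.ne')
      have e : √x / (|x| + 0) = (√x)⁻¹ := by
        rw [add_zero, abs_of_pos hx, Real.sqrt_div_self', one_div]
      exact e ▸ this
  have h2 : Tendsto (fun k => (P k).eval x - f k x) atTop (𝓝 0) := by
    refine squeeze_zero_norm' ?_ hδl
    filter_upwards [eventually_ge_atTop ⌈|x|⌉₊] with k hk
    have : |x| ≤ k := (Nat.le_ceil _).trans (by exact_mod_cast hk)
    exact (hP k x (abs_le.1 this)).le
  simpa using h2.add h1

lemma measurable_invSqrt {α : Type*} [MeasurableSpace α] {M : α → Matrix (Fin p) (Fin p) ℝ}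
    (hM : ∀ r s, Measurable fun a => M a r s) (hH : ∀ a, (M a).IsHermitian) (r s : Fin p) :
    Measurable fun a => invSqrt (M a) r s := by
  obtain ⟨P, hP⟩ := exists_polynomial_tendsto_inv_sqrt
  have hpow : ∀ (k : ℕ) (r s : Fin p), Measurable fun a => (M a ^ k) r s := by
    intro k
    induction k with
    | zero => intro r s; simp only [pow_zero]; exact measurable_const
    | succ k ih =>
      intro r s
      simp only [pow_succ, Matrix.mul_apply]
      exact Finset.measurable_fun_sum _ fun j _ => (ih r j).mul (hM j s)
  refine measurable_of_tendsto_metrizable (f := fun k a => (Polynomial.aeval (M a) (P k)) r s)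
    (fun k => ?_) (tendsto_pi_nhds.2 fun a => ?_)
  · simp only [Polynomial.aeval_eq_sum_range, Matrix.sum_apply, Matrix.smul_apply]
    exact Finset.measurable_fun_sum _ fun j _ => (hpow j r s).const_mul _
  · simp_rw [aeval_eq_cfc (hH a), invSqrt, cfc_apply_entry (hH a)]
    exact tendsto_finsetSum _ fun k _ => ((hP _).const_mul _).mul_const _

/-- The inverse square root is uniformly continuous on the symmetric matrices with spectrum in a
fixed compact interval of positive numbers. -/
lemma exists_invSqrt_sub_le (ha : 0 < a) (b : ℝ) {κ : ℝ} (hκ : 0 < κ) :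
    ∃ η > 0, ∀ A B : Matrix (Fin p) (Fin p) ℝ, FormBounds A a b → FormBounds B a b →
      (∀ r s, |A r s - B r s| < η) → ∀ r s, |invSqrt A r s - invSqrt B r s| ≤ κ := by
  obtain ⟨P, hP⟩ := exists_polynomial_near_of_continuousOn a b (fun x => (√x)⁻¹)
    (ContinuousOn.inv₀ (by fun_prop) fun x hx => (Real.sqrt_pos.2 (ha.trans_le hx.1)).ne')
    (κ / 3) (by positivity)
  set F : (Fin p → Fin p → ℝ) → (Fin p → Fin p → ℝ) := fun A =>
    fun r s => (Polynomial.aeval (Matrix.of A) P : Matrix (Fin p) (Fin p) ℝ) r s with hF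
  have hG : Continuous fun A : Matrix (Fin p) (Fin p) ℝ => Polynomial.aeval A P :=
    Polynomial.continuous_aeval P
  have hof : Continuous (Matrix.of : (Fin p → Fin p → ℝ) → Matrix (Fin p) (Fin p) ℝ) :=
    continuous_id
  have hFc : Continuous F := continuous_pi fun r => continuous_pi fun s =>
    (hG.comp hof).matrix_elem r s
  have hu := (isCompact_closedBall (0 : Fin p → Fin p → ℝ) b).uniformContinuousOn_of_continuous
    hFc.continuousOn
  rw [Metric.uniformContinuousOn_iff] at hu
  obtain ⟨η, hη, hu⟩ := hu (κ / 3) (by positivity)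
  refine ⟨η, hη, fun A B hA hB hAB r s => ?_⟩
  have hmem : ∀ {A : Matrix (Fin p) (Fin p) ℝ}, FormBounds A a b →
      (fun i j => A i j) ∈ Metric.closedBall (0 : Fin p → Fin p → ℝ) b := fun {A} hA => by
    have hb : 0 ≤ b := (abs_nonneg _).trans (abs_entry_le hA ha.le r s)
    rw [Metric.mem_closedBall, dist_pi_le_iff hb]
    intro i
    rw [dist_pi_le_iff hb]
    intro j
    simpa using abs_entry_le hA ha.le i j
  have happ : ∀ {A : Matrix (Fin p) (Fin p) ℝ}, FormBounds A a b →
      |F (fun i j => A i j) r s - invSqrt A r s| ≤ κ / 3 := fun {A} hA => by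
    have hfin := finite_spectrum hA.1
    have e : F (fun i j => A i j) r s - invSqrt A r s = cfc (fun x => P.eval x - (√x)⁻¹) A r s := by
      rw [cfc_sub (fun x => P.eval x) (fun x : ℝ => (√x)⁻¹) A (hfin.continuousOn _)
        (hfin.continuousOn _), Matrix.sub_apply, cfc_polynomial P A hA.1.isSelfAdjoint]
      rfl
    rw [e]
    exact abs_cfc_entry_le hA.1 (fun i => (hP _ (eigenvalues_mem_Icc hA i)).le) r s
  have h3 : |F (fun i j => A i j) r s - F (fun i j => B i j) r s| ≤ κ / 3 := by
    have h4 := hu _ (hmem hA) _ (hmem hB) ((dist_pi_lt_iff hη).2 fun i =>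
      (dist_pi_lt_iff hη).2 fun j => hAB i j)
    exact ((dist_le_pi_dist (F (fun i j => A i j) r) (F (fun i j => B i j) r) s).trans
      (dist_le_pi_dist (F (fun i j => A i j)) (F (fun i j => B i j)) r)).trans h4.le
  have h1 := abs_le.1 (happ hA)
  have h2 := abs_le.1 (happ hB)
  have h3 := abs_le.1 h3
  rw [abs_le]
  constructor <;> linarith [h1.1, h1.2, h2.1, h2.2, h3.1, h3.2]

/-- A symmetric matrix that is entrywise close to one with spectrum in `[a, b]`. -/
lemma FormBounds.of_close (h : FormBounds A a b) (hB : B.IsHermitian) {η : ℝ}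
    (hAB : ∀ r s, |A r s - B r s| ≤ η) : FormBounds B (a - p * η) (b + p * η) := by
  refine ⟨hB, fun x => ?_⟩
  have key : |x ⬝ᵥ (A *ᵥ x) - x ⬝ᵥ (B *ᵥ x)| ≤ p * η * (x ⬝ᵥ x) := by
    have e : x ⬝ᵥ (A *ᵥ x) - x ⬝ᵥ (B *ᵥ x) = ∑ r, ∑ s, x r * (A r s - B r s) * x s := by
      simp only [dotProduct, mulVec, Finset.mul_sum, ← Finset.sum_sub_distrib]
      exact Finset.sum_congr rfl fun r _ => Finset.sum_congr rfl fun s _ => by ring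
    rw [e]
    calc _ ≤ ∑ r, ∑ s, (η / 2 * x r ^ 2 + η / 2 * x s ^ 2) := by
          refine (Finset.abs_sum_le_sum_abs _ _).trans (Finset.sum_le_sum fun r _ =>
            (Finset.abs_sum_le_sum_abs _ _).trans (Finset.sum_le_sum fun s _ => ?_))
          rw [abs_mul, abs_mul, ← sq_abs (x r), ← sq_abs (x s)]
          have h0 := (abs_nonneg _).trans (hAB r s)
          have h1 := mul_le_mul_of_nonneg_left (hAB r s) (mul_nonneg (abs_nonneg (x r))
            (abs_nonneg (x s)))
          nlinarith [mul_nonneg h0 (sq_nonneg (|x r| - |x s|))]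
      _ = _ := by
          simp only [Finset.sum_add_distrib, Finset.sum_const, Finset.card_univ, Fintype.card_fin,
            nsmul_eq_mul, ← Finset.mul_sum, dotProduct, ← sq]
          ring
  obtain ⟨h1, h2⟩ := h.2 x
  obtain ⟨h3, h4⟩ := abs_le.1 key
  constructor <;> linarith

lemma FormBounds.mono (h : FormBounds A a b) {a' b' : ℝ} (ha : a' ≤ a) (hb : b ≤ b') :
    FormBounds A a' b' := by
  refine ⟨h.1, fun x => ?_⟩
  have hx : 0 ≤ x ⬝ᵥ x := Finset.sum_nonneg fun i _ => mul_self_nonneg _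
  exact ⟨(mul_le_mul_of_nonneg_right ha hx).trans (h.2 x).1,
    (h.2 x).2.trans (mul_le_mul_of_nonneg_right hb hx)⟩

lemma FormBounds.posDef (h : FormBounds A a b) (ha : 0 < a) : A.PosDef := by
  refine PosDef.of_dotProduct_mulVec_pos h.1 fun {x} hx => ?_
  rw [star_trivial]
  refine lt_of_lt_of_le (mul_pos ha ?_) (h.2 x).1
  have := dotProduct_star_self_pos_iff.2 hx
  rwa [star_trivial] at this

end

/-! ### Least squares residuals -/

section LeastSquares

variable {V : Type*} [Fintype V] {p : ℕ} {X : Matrix V (Fin p) ℝ} {κ B : ℝ}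

lemma dotProduct_sq_le {m : Type*} [Fintype m] (u v : m → ℝ) :
    (u ⬝ᵥ v) ^ 2 ≤ (u ⬝ᵥ u) * (v ⬝ᵥ v) := by
  have := Finset.sum_mul_sq_le_sq_mul_sq Finset.univ u v
  simpa only [dotProduct, ← sq] using this

lemma dotProduct_self_nonneg' {m : Type*} [Fintype m] (u : m → ℝ) : 0 ≤ u ⬝ᵥ u :=
  Finset.sum_nonneg fun _ _ => mul_self_nonneg _

lemma dotProduct_gram (X : Matrix V (Fin p) ℝ) (u v : Fin p → ℝ) :
    u ⬝ᵥ ((Xᵀ * X) *ᵥ v) = (X *ᵥ u) ⬝ᵥ (X *ᵥ v) := by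
  rw [← mulVec_mulVec, dotProduct_mulVec, vecMul_transpose]

lemma mulVec_sq_le (hB : ∀ i k, |X i k| ≤ B) (v : Fin p → ℝ) (i : V) :
    (X *ᵥ v) i ^ 2 ≤ p * B ^ 2 * (v ⬝ᵥ v) := by
  refine (dotProduct_sq_le (X i) v).trans
    (mul_le_mul_of_nonneg_right ?_ (dotProduct_self_nonneg' v))
  calc ∑ k, X i k * X i k ≤ ∑ _k : Fin p, B ^ 2 := Finset.sum_le_sum fun k _ => by
        rw [← sq, ← sq_abs]; exact pow_le_pow_left₀ (abs_nonneg _) (hB i k) 2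
    _ = p * B ^ 2 := by simp

/-- A lower bound for the form of the Gram matrix makes the latter invertible. -/
lemma isUnit_det_gram (hκ : 0 < κ) (hX : ∀ v, κ * (v ⬝ᵥ v) ≤ (X *ᵥ v) ⬝ᵥ (X *ᵥ v)) :
    IsUnit (Xᵀ * X).det := by
  have : (Xᵀ * X).PosDef := by
    refine PosDef.of_dotProduct_mulVec_pos (by
      rw [IsHermitian, conjTranspose_eq_transpose_of_trivial, transpose_mul, transpose_transpose])
      fun {v} hv => ?_
    rw [star_trivial, dotProduct_gram]
    refine lt_of_lt_of_le (mul_pos hκ ?_) (hX v)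
    have := dotProduct_star_self_pos_iff.2 hv
    rwa [star_trivial] at this
  exact this.det_pos.ne'.isUnit

lemma gram_mulVec_olsEstimate_sub (hX : IsUnit (Xᵀ * X).det) (β : Fin p → ℝ) (e : V → ℝ) :
    (Xᵀ * X) *ᵥ (olsEstimate X (response X β e) - β) = Xᵀ *ᵥ e := by
  rw [mulVec_sub, olsEstimate, mulVec_mulVec, mul_nonsing_inv _ hX, one_mulVec, response,
    mulVec_add, mulVec_mulVec, add_sub_cancel_left]

lemma residual_response (β : Fin p → ℝ) (e : V → ℝ) :
    residual X (response X β e) = e - X *ᵥ (olsEstimate X (response X β e) - β) := by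
  rw [residual, mulVec_sub]
  nth_rewrite 1 [response]
  abel

/-- The fitted residuals differ from the errors by a multiple of the length of `Xᵀe`. -/
lemma sub_residual_sq_le (hκ : 0 < κ) (hX : ∀ v, κ * (v ⬝ᵥ v) ≤ (X *ᵥ v) ⬝ᵥ (X *ᵥ v))
    (hB : ∀ i k, |X i k| ≤ B) (β : Fin p → ℝ) (e : V → ℝ) (i : V) :
    (e i - residual X (response X β e) i) ^ 2 ≤
      p * B ^ 2 / κ ^ 2 * ((Xᵀ *ᵥ e) ⬝ᵥ (Xᵀ *ᵥ e)) := by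
  set δ := olsEstimate X (response X β e) - β with hδ
  have h1 : κ * (δ ⬝ᵥ δ) ≤ δ ⬝ᵥ (Xᵀ *ᵥ e) := by
    rw [← gram_mulVec_olsEstimate_sub (isUnit_det_gram hκ hX) β e, dotProduct_gram]
    exact hX δ
  have hD := dotProduct_self_nonneg' δ
  have hE := dotProduct_self_nonneg' (Xᵀ *ᵥ e)
  have h2 : κ ^ 2 * (δ ⬝ᵥ δ) ≤ (Xᵀ *ᵥ e) ⬝ᵥ (Xᵀ *ᵥ e) := by
    rcases hD.eq_or_lt with h0 | h0
    · rw [← h0]; simpa using hE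
    · have h3 := pow_le_pow_left₀ (by positivity) h1 2
      have h4 := h3.trans (dotProduct_sq_le δ (Xᵀ *ᵥ e))
      refine le_of_mul_le_mul_left ?_ h0
      linarith
  rw [residual_response, Pi.sub_apply, sub_sub_cancel]
  refine (mulVec_sq_le hB δ i).trans ?_
  rw [div_mul_eq_mul_div, le_div_iff₀ (by positivity)]
  have : 0 ≤ p * B ^ 2 := by positivity
  nlinarith [mul_le_mul_of_nonneg_left h2 this]

/-- The free parameter `θ` balances the errors against the squared residual differences `H`; it is
`n ^ (-1 / 2)` below, where `H` has order `1 / n`. -/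
lemma abs_mul_sub_mul_le {x y x' y' H θ : ℝ} (hθ : 0 < θ) (hx : (x - x') ^ 2 ≤ H)
    (hy : (y - y') ^ 2 ≤ H) :
    |x' * y' - x * y| ≤ θ / 2 * (x ^ 2 + y ^ 2) + (1 / θ + 1) * H := by
  have e : x' * y' - x * y = (x - x') * (y - y') - (x - x') * y - x * (y - y') := by ring
  have amgm : ∀ u v : ℝ, v ^ 2 ≤ H → |u * v| ≤ θ / 2 * u ^ 2 + 1 / θ / 2 * H := fun u v hv => by
    have h1 : 0 ≤ (θ * |u| - |v|) ^ 2 / (2 * θ) := by positivity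
    have h2 : (θ * |u| - |v|) ^ 2 / (2 * θ) = θ / 2 * u ^ 2 + 1 / θ / 2 * v ^ 2 - |u * v| := by
      rw [abs_mul, ← sq_abs u, ← sq_abs v]; field_simp; ring
    have h3 : 1 / θ / 2 * v ^ 2 ≤ 1 / θ / 2 * H := by gcongr
    linarith
  have h1 := amgm y (x - x') hx
  have h2 := amgm x (y - y') hy
  have h3 : |(x - x') * (y - y')| ≤ H := by
    rw [abs_mul]
    nlinarith [sq_nonneg (|x - x'| - |y - y'|), sq_abs (x - x'), sq_abs (y - y')]
  rw [e]
  rw [mul_comm] at h1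
  have h4 := abs_sub ((x - x') * (y - y') - (x - x') * y) (x * (y - y'))
  have h5 := abs_sub ((x - x') * (y - y')) ((x - x') * y)
  linarith

end LeastSquares

/-! ### Consistency of the plug-in estimator -/

lemma plugIn_apply {V : Type*} [Fintype V] {p : ℕ} (d : V → V → ℝ≥0∞) (r : ℝ)
    (X : Matrix V (Fin p) ℝ) (Y : V → ℝ) (k l : Fin p) :
    plugIn d r X Y k l =
      ∑ i, ∑ j, near d r i j * (X i k * X j l * residual X Y i * residual X Y j) := by
  simp only [sum_near_mul]
  rfl

lemma plugIn_isHermitian {V : Type*} [Fintype V] {p : ℕ} {d : V → V → ℝ≥0∞} (hd : IsDistance d)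
    (r : ℝ) (X : Matrix V (Fin p) ℝ) (Y : V → ℝ) : (plugIn d r X Y).IsHermitian := by
  ext k l
  rw [conjTranspose_apply, star_trivial, plugIn_apply, plugIn_apply, Finset.sum_comm]
  refine Finset.sum_congr rfl fun i _ => Finset.sum_congr rfl fun j _ => ?_
  rw [near_comm hd]
  ring

lemma dotProduct_mulVec_cov {V Ω : Type*} [Fintype V] [MeasurableSpace Ω] (μ : Measure Ω)
    (ε : V → Ω → ℝ) {p : ℕ} (X : Matrix V (Fin p) ℝ) (v : Fin p → ℝ) :
    v ⬝ᵥ ((Xᵀ * errCov μ ε * X) *ᵥ v) = DecayingField.sumVar μ ε (X *ᵥ v) := by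
  rw [← mulVec_mulVec, ← mulVec_mulVec, dotProduct_mulVec, vecMul_transpose]
  generalize X *ᵥ v = u
  simp only [dotProduct, DecayingField.sumVar, mulVec, Finset.mul_sum]
  exact Finset.sum_congr rfl fun i _ => Finset.sum_congr rfl fun j _ => by ring

lemma cov_apply {V Ω : Type*} [Fintype V] [MeasurableSpace Ω] (μ : Measure Ω)
    (ε : V → Ω → ℝ) {p : ℕ} (X : Matrix V (Fin p) ℝ) (k l : Fin p) :
    (Xᵀ * errCov μ ε * X) k l = ∑ i, ∑ j, X i k * X j l * errCov μ ε i j := by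
  simp only [Matrix.mul_apply, transpose_apply, Finset.sum_mul]
  rw [Finset.sum_comm]
  exact Finset.sum_congr rfl fun i _ => Finset.sum_congr rfl fun j _ => by ring

namespace Regime

open DecayingField

variable {Ω : ℕ → Type*} [∀ n, MeasurableSpace (Ω n)]
    {μ : ∀ n, Measure (Ω n)} [∀ n, IsProbabilityMeasure (μ n)] {ε : ∀ n, Fin n → Ω n → ℝ}
    {d : ∀ n, Fin n → Fin n → ℝ≥0∞} {ρ c₁ c g : ℝ} {r : ℕ → ℝ}
    {p : ℕ} {X : ∀ n, Matrix (Fin n) (Fin p) ℝ} {B a b : ℝ}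

lemma sumVar_le (h : Regime μ ε d ρ c₁ c g r) {n : ℕ} {w : Fin n → ℝ} (hw : ∀ i, |w i| ≤ B) :
    sumVar (μ n) (ε n) w ≤ B ^ 2 * (c * layerConst ρ c₁ g * n) := by
  refine (le_abs_self _).trans (((h.field n).abs_sum_errCov_le w w).trans ?_)
  have h1 := (h.growth n).sum_decay_le (h.field n).isDistance h.mem_Ioo h.growth_pos h.rate_lt
  have hc := (h.field n).const_nonneg
  calc _ ≤ c * (B ^ 2 * ∑ i, ∑ j, decay ρ (d n i j)) := by
        refine mul_le_mul_of_nonneg_left ?_ hc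
        simp_rw [Finset.mul_sum]
        refine Finset.sum_le_sum fun i _ => Finset.sum_le_sum fun j _ => ?_
        refine mul_le_mul_of_nonneg_right ?_ (decay_nonneg h.mem_Ioo.1 _)
        rw [sq]
        exact mul_le_mul (hw i) (hw j) (abs_nonneg _) ((abs_nonneg _).trans (hw i))
    _ ≤ c * (B ^ 2 * (layerConst ρ c₁ g * n)) := by gcongr
    _ = _ := by ring

/-- As the errors are weakly dependent, a lower bound for `XᵀΣX / n` forces one for `XᵀX / n`. -/
lemma exists_gram_lower_bound (h : Regime μ ε d ρ c₁ c g r) (hB : ∀ n i k, |X n i k| ≤ B)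
    (ha : 0 < a) (hV : ∀ᶠ n : ℕ in atTop,
      FormBounds ((n : ℝ)⁻¹ • ((X n)ᵀ * errCov (μ n) (ε n) * X n)) a b) :
    ∃ κ > 0, ∀ᶠ n : ℕ in atTop, ∀ v, κ * n * (v ⬝ᵥ v) ≤ (X n *ᵥ v) ⬝ᵥ (X n *ᵥ v) := by
  set K := c * layerConst ρ c₁ g with hK
  have hK0 : 0 ≤ K := mul_nonneg (h.field 0).const_nonneg (layerConst_nonneg h.rate_lt)
  refine ⟨a ^ 2 / (K ^ 2 * (p * B ^ 2) + 1), by positivity, ?_⟩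
  filter_upwards [hV, eventually_gt_atTop 0] with n hV hn v
  have hn' : (0 : ℝ) < n := by exact_mod_cast hn
  set u := X n *ᵥ v with hu
  have hD := dotProduct_self_nonneg' v
  have hQ := dotProduct_self_nonneg' u
  have h1 : a * n * (v ⬝ᵥ v) ≤ K * (√n * √(∑ i, u i ^ 4)) := by
    have h2 := (hV.2 v).1
    rw [smul_mulVec, dotProduct_smul, dotProduct_mulVec_cov, smul_eq_mul, inv_mul_eq_div,
      le_div_iff₀ hn'] at h2
    have h3 := (le_abs_self _).trans ((h.field n).abs_sum_errCov_le u u)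
    have h4 := mul_le_mul_of_nonneg_left ((h.growth n).sum_mul_decay_le (h.field n).isDistance
      h.mem_Ioo h.growth_pos h.rate_lt u) (h.field n).const_nonneg
    calc _ = a * (v ⬝ᵥ v) * n := by ring
      _ ≤ _ := h2.trans (h3.trans (h4.trans_eq (by rw [hK]; ring)))
  have h5 : ∑ i, u i ^ 4 ≤ p * B ^ 2 * (v ⬝ᵥ v) * (u ⬝ᵥ u) := by
    simp only [dotProduct, Finset.mul_sum (s := (Finset.univ : Finset (Fin n)))]
    refine Finset.sum_le_sum fun i _ => ?_
    have := mul_le_mul_of_nonneg_right (mulVec_sq_le (hB n) v i) (sq_nonneg (u i))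
    calc u i ^ 4 = u i ^ 2 * u i ^ 2 := by ring
      _ ≤ _ := this
      _ = _ := by simp only [dotProduct]; ring
  have h6 : (a * n * (v ⬝ᵥ v)) ^ 2 ≤ K ^ 2 * (n * (p * B ^ 2 * (v ⬝ᵥ v) * (u ⬝ᵥ u))) := by
    refine (pow_le_pow_left₀ (by positivity) h1 2).trans ?_
    rw [mul_pow, mul_pow √(n : ℝ), Real.sq_sqrt hn'.le, Real.sq_sqrt (Finset.sum_nonneg fun i _ =>
      by positivity)]
    gcongr
  rw [div_mul_eq_mul_div, div_mul_eq_mul_div, div_le_iff₀ (by positivity)]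
  rcases hD.eq_or_lt with h0 | h0
  · rw [← h0, mul_zero]; positivity
  · have h7 : a ^ 2 * n * (v ⬝ᵥ v) ≤ K ^ 2 * (p * B ^ 2) * (u ⬝ᵥ u) := by
      refine le_of_mul_le_mul_left ?_ (mul_pos hn' h0)
      linarith
    linarith

/-- The plug-in estimator of `XᵀΣX / n` is consistent: its error is dominated by an integrable
function whose integral vanishes in the limit. The error has three parts: the effect of replacing
errors by residuals, the fluctuation of a quadratic form in nearby errors, and the bias from the
truncation. -/
lemma exists_plugIn_error (h : Regime μ ε d ρ c₁ c g r) (hB : ∀ n i k, |X n i k| ≤ B)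
    (ha : 0 < a) (hV : ∀ᶠ n : ℕ in atTop,
      FormBounds ((n : ℝ)⁻¹ • ((X n)ᵀ * errCov (μ n) (ε n) * X n)) a b) (β : Fin p → ℝ) :
    ∃ R : ∀ n, Ω n → ℝ, (∀ n ω, 0 ≤ R n ω) ∧ (∀ n, Integrable (R n) (μ n)) ∧
      Tendsto (fun n => ∫ ω, R n ω ∂μ n) atTop (𝓝 0) ∧
      ∀ᶠ n : ℕ in atTop, ∀ ω k l,
        |((n : ℝ)⁻¹ • ((X n)ᵀ * errCov (μ n) (ε n) * X n)) k l -
          ((n : ℝ)⁻¹ • plugIn (d n) (r n) (X n) (response (X n) β fun i => ε n i ω)) k l| ≤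
        R n ω := by
  obtain ⟨κ, hκ, hX⟩ := h.exists_gram_lower_bound hB ha hV
  have hc := (h.field 0).const_nonneg
  have hL : 0 ≤ layerConst ρ c₁ g := layerConst_nonneg h.rate_lt
  -- coefficients of the quadratic form for the entry `(k, l)`
  let q : ∀ n, Fin p → Fin p → Fin n → Fin n → ℝ := fun n k l i j =>
    X n i k * X n j l * near (d n) (r n) i j
  have hq : ∀ n k l i j, |q n k l i j| ≤ B ^ 2 * near (d n) (r n) i j := fun n k l i j => by
    rw [abs_mul, abs_of_nonneg (near_nonneg _ _ _), abs_mul, sq]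
    exact mul_le_mul_of_nonneg_right (mul_le_mul (hB n i k) (hB n j l) (abs_nonneg _)
      ((abs_nonneg _).trans (hB n i k))) (near_nonneg _ _ _)
  -- a bound for the squared difference of errors and residuals
  let H : ∀ n, Ω n → ℝ := fun n ω => p * B ^ 2 / (κ * n) ^ 2 *
    ∑ k, (∑ i, X n i k * ε n i ω) ^ 2
  have hHint : ∀ n, Integrable (H n) (μ n) := fun n =>
    (integrable_finsetSum _ fun k _ => (h.field n).integrable_sq_sum _).const_mul _
  set K := p * B ^ 2 / κ ^ 2 * (p * (B ^ 2 * (c * layerConst ρ c₁ g))) with hK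
  have hHle : ∀ n, 0 < n → ∫ ω, H n ω ∂μ n ≤ K / n := fun n hn => by
    have hn' : (0 : ℝ) < n := by exact_mod_cast hn
    rw [integral_const_mul, integral_finsetSum _ fun k _ => (h.field n).integrable_sq_sum _]
    simp_rw [(h.field n).integral_sq_sum]
    have : ∑ k, sumVar (μ n) (ε n) (fun i => X n i k) ≤
        p * (B ^ 2 * (c * layerConst ρ c₁ g * n)) :=
      (Finset.sum_le_sum fun k _ => h.sumVar_le fun i => hB n i k).trans_eq (by simp)
    calc _ ≤ p * B ^ 2 / (κ * n) ^ 2 * (p * (B ^ 2 * (c * layerConst ρ c₁ g * n))) := by gcongr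
      _ = K / n := by rw [hK]; field_simp
  let θ : ℕ → ℝ := fun n => (√(n : ℝ))⁻¹
  let R₁ : ∀ n, Ω n → ℝ := fun n ω => ∑ i, ∑ j, near (d n) (r n) i j *
    (B ^ 2 * (θ n / 2 * (ε n i ω ^ 2 + ε n j ω ^ 2) + (1 / θ n + 1) * H n ω))
  let R₂ : ∀ n, Ω n → ℝ := fun n ω => ∑ k, ∑ l, |quadForm (μ n) (ε n) (q n k l) ω|
  have hsq : ∀ n i, Integrable (fun ω => ε n i ω ^ 2) (μ n) := fun n i => by
    simpa only [sq] using (h.field n).integrable_mul i i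
  have hterm : ∀ n i j, Integrable (fun ω => near (d n) (r n) i j *
      (B ^ 2 * (θ n / 2 * (ε n i ω ^ 2 + ε n j ω ^ 2) + (1 / θ n + 1) * H n ω))) (μ n) :=
    fun n i j => (((((hsq n i).add (hsq n j)).const_mul _).add
      ((hHint n).const_mul _)).const_mul _).const_mul _
  have hR₁ : ∀ n, Integrable (R₁ n) (μ n) := fun n =>
    integrable_finsetSum _ fun i _ => integrable_finsetSum _ fun j _ => hterm n i j
  have hR₂ : ∀ n, Integrable (R₂ n) (μ n) := fun n =>
    integrable_finsetSum _ fun k _ => integrable_finsetSum _ fun l _ =>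
      ((h.field n).integrable_quadForm _).abs
  have hR₁0 : ∀ n ω, 0 ≤ R₁ n ω := fun n ω => Finset.sum_nonneg fun i _ =>
    Finset.sum_nonneg fun j _ => by
      have h1 := near_nonneg (d := d n) (r n) i j
      have h2 : 0 ≤ θ n := by positivity
      have h3 : 0 ≤ H n ω := by positivity
      positivity
  have hR₁le : ∀ n, 0 < n → ∫ ω, R₁ n ω ∂μ n ≤
      (∑ i, ((ball (d n) (r n) i).card : ℝ)) * (B ^ 2 * (θ n * c + (1 / θ n + 1) * (K / n))) := by
    intro n hn
    have hθ0 : 0 ≤ θ n := by positivity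
    simp only [R₁]
    rw [integral_finsetSum _ fun i _ => integrable_finsetSum _ fun j _ => hterm n i j,
      Finset.sum_mul]
    refine Finset.sum_le_sum fun i _ => ?_
    rw [integral_finsetSum _ fun j _ => hterm n i j, ← sum_near, Finset.sum_mul]
    refine Finset.sum_le_sum fun j _ => ?_
    have hsum : Integrable (fun ω => θ n / 2 * (ε n i ω ^ 2 + ε n j ω ^ 2)) (μ n) :=
      ((hsq n i).add (hsq n j)).const_mul _
    rw [integral_const_mul, integral_const_mul, integral_add hsum ((hHint n).const_mul _), integral_const_mul, integral_const_mul,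
      integral_add (hsq n i) (hsq n j)]
    have hvar : ∀ i, ∫ ω, ε n i ω ^ 2 ∂μ n ≤ c := fun i => by
      have h1 := (le_abs_self _).trans ((h.field n).abs_errCov_le i i)
      have h2 := mul_le_mul_of_nonneg_left (decay_le_one h.mem_Ioo (d n i i)) hc
      calc _ = errCov (μ n) (ε n) i i := by simp only [sq]; rfl
        _ ≤ c := by linarith
    refine mul_le_mul_of_nonneg_left ?_ (near_nonneg _ _ _)
    refine mul_le_mul_of_nonneg_left ?_ (sq_nonneg B)
    refine add_le_add ?_ (mul_le_mul_of_nonneg_left (hHle n hn) (by positivity))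
    nlinarith [hvar i, hvar j]
  have hR₂le : ∀ n, 0 < n → ∫ ω, R₂ n ω ∂μ n ≤ p * (p * (B ^ 2 * (n * fluct ρ c₁ c g r n))) := by
    intro n hn
    simp only [R₂]
    rw [integral_finsetSum _ fun k _ => integrable_finsetSum _ fun l _ =>
      ((h.field n).integrable_quadForm _).abs]
    simp_rw [integral_finsetSum _ fun l _ => ((h.field n).integrable_quadForm _).abs]
    have : ∀ k l, ∫ ω, |quadForm (μ n) (ε n) (q n k l) ω| ∂μ n ≤
        B ^ 2 * (n * fluct ρ c₁ c g r n) := fun k l => by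
      have h1 := (h.field n).integral_abs_quadForm_le h.mem_Ioo (h.radius_nonneg n) (hq n k l)
      have h2 := h.sqrt_fluct_le hn (B ^ 2)
      rw [abs_of_nonneg (sq_nonneg B)] at h2
      exact h1.trans h2
    exact (Finset.sum_le_sum fun k _ => Finset.sum_le_sum fun l _ => this k l).trans_eq (by simp)
  have hR0 : ∀ (n : ℕ) ω, 0 ≤ (n : ℝ)⁻¹ * (R₁ n ω + R₂ n ω + B ^ 2 * c * (n ^ 2 * ρ ^ r n)) := by
    intro n ω
    have h1 := hR₁0 n ω
    have h2 : 0 ≤ R₂ n ω := by positivity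
    have h3 : 0 ≤ ρ ^ r n := Real.rpow_nonneg h.mem_Ioo.1.le _
    positivity
  refine ⟨fun n ω => (n : ℝ)⁻¹ * (R₁ n ω + R₂ n ω + B ^ 2 * c * (n ^ 2 * ρ ^ r n)), hR0,
    fun n => (((hR₁ n).add (hR₂ n)).add (integrable_const _)).const_mul _, ?_, ?_⟩
  · have hlim : Tendsto (fun n : ℕ =>
        B ^ 2 * (g * Real.exp c₁) * (c + K + K * (√(n : ℝ))⁻¹) * √(Real.exp (c₁ * r n) ^ 2 / n) +
        p ^ 2 * B ^ 2 * fluct ρ c₁ c g r n + B ^ 2 * c * (n * ρ ^ r n)) atTop (𝓝 0) := by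
      have l1 := h.tendsto_decay
      have l2 := h.tendsto_nbhd.sqrt
      have l3 := h.tendsto_fluct
      have l4 : Tendsto (fun n : ℕ => (√(n : ℝ))⁻¹) atTop (𝓝 0) :=
        (Real.tendsto_sqrt_atTop.comp tendsto_natCast_atTop_atTop).inv_tendsto_atTop
      have := (((((l4.const_mul K).const_add (c + K)).const_mul
        (B ^ 2 * (g * Real.exp c₁))).mul l2).add (l3.const_mul (p ^ 2 * B ^ 2))).add
        (l1.const_mul (B ^ 2 * c))
      simpa using this
    refine tendsto_of_tendsto_of_tendsto_of_le_of_le' tendsto_const_nhds hlim ?_ ?_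
    · exact .of_forall fun n => integral_nonneg (hR0 n)
    · filter_upwards [eventually_gt_atTop 0] with n hn
      have hn' : (0 : ℝ) < n := by exact_mod_cast hn
      have hs : 0 < √(n : ℝ) := Real.sqrt_pos.2 hn'
      have hadd : Integrable (fun ω => R₁ n ω + R₂ n ω) (μ n) := (hR₁ n).add (hR₂ n)
      rw [integral_const_mul, integral_add hadd (integrable_const _),
        integral_add (hR₁ n) (hR₂ n), integral_const, probReal_univ, one_smul]
      obtain ⟨h1, -, -⟩ := (h.growth n).sum_card_ball_le h.growth_pos h.rate_pos hn
        (h.radius_nonneg n)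
      have hK0 : 0 ≤ K := by positivity
      have h2 : (∑ i, ((ball (d n) (r n) i).card : ℝ)) *
          (B ^ 2 * (θ n * c + (1 / θ n + 1) * (K / n))) ≤
          (n * (g * Real.exp c₁ * Real.exp (c₁ * r n))) *
          (B ^ 2 * (θ n * c + (1 / θ n + 1) * (K / n))) := by
        refine mul_le_mul_of_nonneg_right h1 ?_
        have : 0 ≤ θ n := by positivity
        positivity
      have h3 := add_le_add (add_le_add ((hR₁le n hn).trans h2) (hR₂le n hn))
        (le_refl (B ^ 2 * c * ((n : ℝ) ^ 2 * ρ ^ r n)))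
      refine (mul_le_mul_of_nonneg_left h3 (inv_nonneg.2 hn'.le)).trans_eq ?_
      rw [Real.sqrt_div (sq_nonneg _), Real.sqrt_sq (Real.exp_pos _).le]
      simp only [θ]
      have hss : √(n : ℝ) * √n = n := Real.mul_self_sqrt hn'.le
      generalize √(n : ℝ) = s at hs hss
      rw [← hss]
      field_simp
      ring
  · filter_upwards [hX, eventually_gt_atTop 0] with n hX hn ω k l
    have hn' : (0 : ℝ) < n := by exact_mod_cast hn
    have hθ : 0 < θ n := inv_pos.2 (Real.sqrt_pos.2 hn')
    have hκn : 0 < κ * n := mul_pos hκ hn'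
    set e : Fin n → ℝ := fun i => ε n i ω with he
    set f := residual (X n) (response (X n) β e) with hf
    have hres : ∀ i, (e i - f i) ^ 2 ≤ H n ω := fun i => by
      refine (sub_residual_sq_le hκn hX (hB n) β e i).trans_eq ?_
      simp only [H, dotProduct, mulVec, transpose_apply, ← sq, he]
    have e1 : plugIn (d n) (r n) (X n) (response (X n) β e) k l -
        ((X n)ᵀ * errCov (μ n) (ε n) * X n) k l =
        (∑ i, ∑ j, q n k l i j * (f i * f j - e i * e j)) + quadForm (μ n) (ε n) (q n k l) ω -
        ∑ i, ∑ j, (1 - near (d n) (r n) i j) * (X n i k * X n j l * errCov (μ n) (ε n) i j) := by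
      rw [plugIn_apply, cov_apply, quadForm, Fintype.sum_prod_type]
      simp only [← Finset.sum_add_distrib, ← Finset.sum_sub_distrib, q]
      refine Finset.sum_congr rfl fun i _ => Finset.sum_congr rfl fun j _ => ?_
      ring
    have b1 : |∑ i, ∑ j, q n k l i j * (f i * f j - e i * e j)| ≤ R₁ n ω := by
      refine (Finset.abs_sum_le_sum_abs _ _).trans (Finset.sum_le_sum fun i _ =>
        (Finset.abs_sum_le_sum_abs _ _).trans (Finset.sum_le_sum fun j _ => ?_))
      rw [abs_mul]
      refine (mul_le_mul (hq n k l i j) (abs_mul_sub_mul_le hθ (hres i) (hres j)) (abs_nonneg _)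
        (mul_nonneg (sq_nonneg B) (near_nonneg _ _ _))).trans_eq ?_
      ring
    have b2 : |quadForm (μ n) (ε n) (q n k l) ω| ≤ R₂ n ω :=
      (Finset.single_le_sum (f := fun l => |quadForm (μ n) (ε n) (q n k l) ω|)
        (fun l _ => abs_nonneg _) (Finset.mem_univ l)).trans
      (Finset.single_le_sum (f := fun k => ∑ l, |quadForm (μ n) (ε n) (q n k l) ω|)
        (fun k _ => Finset.sum_nonneg fun l _ => abs_nonneg _) (Finset.mem_univ k))
    have hρr : 0 ≤ ρ ^ r n := Real.rpow_nonneg h.mem_Ioo.1.le _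
    have hB0 : 0 ≤ B ^ 2 * (c * ρ ^ r n) := by positivity
    have b3 : |∑ i, ∑ j, (1 - near (d n) (r n) i j) *
        (X n i k * X n j l * errCov (μ n) (ε n) i j)| ≤ B ^ 2 * c * (n ^ 2 * ρ ^ r n) := by
      calc _ ≤ ∑ _i : Fin n, ∑ _j : Fin n, B ^ 2 * (c * ρ ^ r n) := by
            refine (Finset.abs_sum_le_sum_abs _ _).trans (Finset.sum_le_sum fun i _ =>
              (Finset.abs_sum_le_sum_abs _ _).trans (Finset.sum_le_sum fun j _ => ?_))
            by_cases hj : d n i j ≤ ENNReal.ofReal (r n)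
            · have : near (d n) (r n) i j = 1 := by simp [near, hj]
              rw [this, sub_self, zero_mul, abs_zero]
              exact hB0
            · have : near (d n) (r n) i j = 0 := by simp [near, hj]
              rw [this, sub_zero, one_mul, abs_mul, abs_mul, sq]
              refine mul_le_mul (mul_le_mul (hB n i k) (hB n j l) (abs_nonneg _)
                ((abs_nonneg _).trans (hB n i k))) (((h.field n).abs_errCov_le i j).trans
                (mul_le_mul_of_nonneg_left (decay_le_of_ofReal_le h.mem_Ioo (h.radius_nonneg n)
                  (not_le.1 hj).le) hc)) (abs_nonneg _) ?_
              exact mul_self_nonneg B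
        _ = _ := by simp; ring
    rw [abs_sub_comm, Matrix.smul_apply, Matrix.smul_apply, smul_eq_mul, smul_eq_mul, ← mul_sub,
      abs_mul, abs_of_nonneg (inv_nonneg.2 hn'.le), e1]
    refine mul_le_mul_of_nonneg_left ?_ (inv_nonneg.2 hn'.le)
    exact (abs_sub _ _).trans (add_le_add ((abs_add_le _ _).trans (add_le_add b1 b2)) b3)

end Regime

/-! ### The model at logarithmic truncation radius -/

section

/-- A constant `C` for which `ρ ^ (C log n)` is `o(1 / n)` while neighborhoods of radius `C log n`
have size `o(√n)`. The choice makes both margins equal. -/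
noncomputable def radiusConst (ρ c₁ : ℝ) : ℝ := 2 / (Real.log ρ⁻¹ + 2 * c₁)

section Radius

variable {ρ c₁ : ℝ}

lemma radiusConst_pos (hc₁ : 0 < c₁) (hrate : 2 * c₁ < Real.log ρ⁻¹) : 0 < radiusConst ρ c₁ := by
  unfold radiusConst
  exact div_pos two_pos (by linarith)

lemma tendsto_exp_neg_mul_log {γ : ℝ} (hγ : 0 < γ) :
    Tendsto (fun n : ℕ => Real.exp (-(γ * Real.log n))) atTop (𝓝 0) :=
  Real.tendsto_exp_neg_atTop_nhds_zero.comp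
    ((Real.tendsto_log_atTop.comp tendsto_natCast_atTop_atTop).const_mul_atTop hγ)

lemma tendsto_mul_rpow_radius (hρ : 0 < ρ) (hc₁ : 0 < c₁) (hrate : 2 * c₁ < Real.log ρ⁻¹) :
    Tendsto (fun n : ℕ => n * ρ ^ (radiusConst ρ c₁ * Real.log n)) atTop (𝓝 0) := by
  have hsum : 0 < Real.log ρ⁻¹ + 2 * c₁ := by linarith
  have hγ : 0 < (Real.log ρ⁻¹ - 2 * c₁) / (Real.log ρ⁻¹ + 2 * c₁) :=
    div_pos (by linarith) hsum
  refine (tendsto_exp_neg_mul_log hγ).congr' ?_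
  filter_upwards [eventually_gt_atTop 0] with n hn
  have hn' : (0 : ℝ) < n := by exact_mod_cast hn
  nth_rewrite 2 [← Real.exp_log hn']
  rw [Real.rpow_def_of_pos hρ, ← Real.exp_add]
  congr 1
  have : Real.log ρ = -Real.log ρ⁻¹ := by rw [Real.log_inv, neg_neg]
  rw [this, radiusConst]
  generalize Real.log ρ⁻¹ = L at hsum
  field_simp
  ring

lemma tendsto_exp_radius (hc₁ : 0 < c₁) (hrate : 2 * c₁ < Real.log ρ⁻¹) :
    Tendsto (fun n : ℕ => Real.exp (c₁ * (radiusConst ρ c₁ * Real.log n)) ^ 2 / n)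
      atTop (𝓝 0) := by
  have hsum : 0 < Real.log ρ⁻¹ + 2 * c₁ := by linarith
  have hγ : 0 < (Real.log ρ⁻¹ - 2 * c₁) / (Real.log ρ⁻¹ + 2 * c₁) :=
    div_pos (by linarith) hsum
  refine (tendsto_exp_neg_mul_log hγ).congr' ?_
  filter_upwards [eventually_gt_atTop 0] with n hn
  have hn' : (0 : ℝ) < n := by exact_mod_cast hn
  nth_rewrite 3 [← Real.exp_log hn']
  rw [← Real.exp_nat_mul, ← Real.exp_sub]
  congr 1
  rw [radiusConst]
  generalize Real.log ρ⁻¹ = L at hsum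
  push_cast
  field_simp
  ring

lemma mul_exp_half_lt_one (hρ : 0 < ρ) (hc₁ : 0 < c₁) (hrate : 2 * c₁ < Real.log ρ⁻¹) :
    ρ * Real.exp (c₁ / 2) < 1 := by
  nth_rewrite 1 [← Real.exp_log hρ]
  rw [← Real.exp_add, Real.exp_lt_one_iff]
  rw [Real.log_inv] at hrate
  linarith

end Radius

section Moments

variable {Ω : Type*} [MeasurableSpace Ω] {μ : Measure Ω} [IsProbabilityMeasure μ] {f : Ω → ℝ}
  {c : ℝ}

lemma memLp_four_of_eLpNorm_le (hf : AEMeasurable f μ) (h : eLpNorm f 4 μ ≤ ENNReal.ofReal c) :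
    MemLp f 4 μ := ⟨hf.aestronglyMeasurable, h.trans_lt ENNReal.ofReal_lt_top⟩

lemma integrable_pow_four (hf : MemLp f 4 μ) : Integrable (fun ω => f ω ^ 4) μ := by
  have := MemLp.integrable_norm_pow (p := 4) (by exact_mod_cast hf) (by norm_num)
  refine this.congr (.of_forall fun ω => ?_)
  simp only [Real.norm_eq_abs]
  exact Even.pow_abs (by decide) _

lemma integral_pow_four_le (hf : MemLp f 4 μ) (hc : 0 ≤ c)
    (h : eLpNorm f 4 μ ≤ ENNReal.ofReal c) : ∫ ω, f ω ^ 4 ∂μ ≤ c ^ 4 := by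
  rw [hf.eLpNorm_eq_integral_rpow_norm (by norm_num) (by norm_num),
    ENNReal.ofReal_le_ofReal_iff hc] at h
  have e : ∫ ω, ‖f ω‖ ^ (4 : ℝ≥0∞).toReal ∂μ = ∫ ω, f ω ^ 4 ∂μ := by
    refine integral_congr_ae (.of_forall fun ω => ?_)
    have h4 : (4 : ℝ≥0∞).toReal = ((4 : ℕ) : ℝ) := by norm_num
    simp only [h4, Real.rpow_natCast, Real.norm_eq_abs]
    exact Even.pow_abs (by decide) _
  have h0 : 0 ≤ ∫ ω, f ω ^ 4 ∂μ := integral_nonneg fun ω => by positivity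
  rw [e] at h
  have h1 := pow_le_pow_left₀ (Real.rpow_nonneg h0 _) h 4
  refine le_trans (le_of_eq ?_) h1
  rw [← Real.rpow_natCast, ← Real.rpow_mul h0]
  norm_num

/-- The covariance of a centered variable with a bounded function of another variable. -/
lemma cov_bounded_comp (hf : MemLp f 4 μ) (hf0 : ∫ ω, f ω ∂μ = 0) {S : Ω → ℝ}
    (hS : AEMeasurable S μ) {h : ℝ → ℝ} (hh : Continuous h) {B : ℝ} (hB : ∀ x, |h x| ≤ B) :
    cov[f, fun ω => h (S ω); μ] = ∫ ω, f ω * h (S ω) ∂μ := by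
  have h2 : MemLp (fun ω => h (S ω)) 2 μ :=
    MemLp.of_bound (hh.measurable.comp_aemeasurable hS).aestronglyMeasurable B
      (.of_forall fun ω => hB _)
  rw [covariance_eq_sub (hf.mono_exponent (by norm_num)) h2, hf0, zero_mul, sub_zero]
  rfl

lemma norm_integral_mul_cexp_le (hf : Integrable f μ) {S : Ω → ℝ} (hS : AEMeasurable S μ) :
    ‖∫ ω, (f ω : ℂ) * Complex.exp (Complex.I * (S ω : ℂ)) ∂μ‖ ≤
      |∫ ω, f ω * Real.cos (S ω) ∂μ| + |∫ ω, f ω * Real.sin (S ω) ∂μ| := by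
  have hcos : Integrable (fun ω => f ω * Real.cos (S ω)) μ :=
    hf.mul_bdd (c := 1) (Real.measurable_cos.comp_aemeasurable hS).aestronglyMeasurable
      (.of_forall fun ω => Real.abs_cos_le_one _)
  have hsin : Integrable (fun ω => f ω * Real.sin (S ω)) μ :=
    hf.mul_bdd (c := 1) (Real.measurable_sin.comp_aemeasurable hS).aestronglyMeasurable
      (.of_forall fun ω => Real.abs_sin_le_one _)
  have e : ∀ ω, (f ω : ℂ) * Complex.exp (Complex.I * (S ω : ℂ)) =
      ((f ω * Real.cos (S ω) : ℝ) : ℂ) + ((f ω * Real.sin (S ω) : ℝ) : ℂ) * Complex.I := fun ω => by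
    rw [mul_comm Complex.I, Complex.exp_mul_I]
    push_cast
    ring
  simp_rw [e]
  rw [integral_add hcos.ofReal (hsin.ofReal.mul_const _), integral_mul_const,
    integral_complex_ofReal, integral_complex_ofReal]
  refine (norm_add_le _ _).trans (le_of_eq ?_)
  rw [norm_mul, Complex.norm_I, mul_one, Complex.norm_real, Complex.norm_real]
  rfl

end Moments

variable {Ω : ℕ → Type*} [∀ n, MeasurableSpace (Ω n)]
    {μ : ∀ n, Measure (Ω n)} [∀ n, IsProbabilityMeasure (μ n)] {ε : ∀ n, Fin n → Ω n → ℝ}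
    {d : ∀ n, Fin n → Fin n → ℝ≥0∞} {ρ c₁ : ℝ} {p : ℕ} {X : ∀ n, Matrix (Fin n) (Fin p) ℝ}

/-- The assumptions of the model, with common constants. The covariances with trigonometric
functions of partial sums give those with complex exponentials. -/
lemma exists_regime (hρ : ρ ∈ Set.Ioo (0 : ℝ) 1) (hc₁ : 0 < c₁)
    (hrate : 2 * c₁ < Real.log ρ⁻¹) (hm : ∀ n i, AEMeasurable (ε n i) (μ n))
    (h0 : ∀ n i, ∫ ω, ε n i ω ∂(μ n) = 0) (hd : ∀ n, IsDistance (d n))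
    (hb : BoundedModel μ X ε) (hcorr : CorrelationDecay μ ε d ρ) (hg : NeighborhoodGrowth d c₁) :
    ∃ c g, Regime μ ε d ρ c₁ c g fun n => radiusConst ρ c₁ * Real.log n := by
  obtain ⟨b, hb0, -, hb4, -⟩ := hb
  obtain ⟨⟨c, hc0, hc2, hc4⟩, hh⟩ := hcorr
  obtain ⟨g, hg0, hg⟩ := hg
  obtain ⟨cc, hcc0, hcc⟩ := hh Real.cos Real.differentiable_cos ⟨1, Real.abs_cos_le_one⟩
    ⟨1, fun x => by simpa using Real.abs_sin_le_one x⟩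
  obtain ⟨cs, hcs0, hcs⟩ := hh Real.sin Real.differentiable_sin ⟨1, Real.abs_sin_le_one⟩
    ⟨1, fun x => by simpa using Real.abs_cos_le_one x⟩
  have hC := radiusConst_pos hc₁ hrate
  have hL4 : ∀ n i, MemLp (ε n i) 4 (μ n) := fun n i =>
    memLp_four_of_eLpNorm_le (hm n i) (hb4 n i)
  have hb40 : 0 < b ^ 4 := by positivity
  refine ⟨b ^ 4 + c + (cc + cs), g, hρ, hc₁, hg0, mul_exp_half_lt_one hρ.1 hc₁ hrate, fun n => ?_,
    fun n m => hg n m, fun n => mul_nonneg hC.le (Real.log_natCast_nonneg n),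
    tendsto_exp_radius hc₁ hrate, tendsto_mul_rpow_radius hρ.1 hc₁ hrate⟩
  refine ⟨hd n, by positivity, hm n, fun i => integrable_pow_four (hL4 n i), fun i => ?_,
    fun i j => ?_, fun i j k l => ?_, fun s i U => ?_⟩
  · have := integral_pow_four_le (hL4 n i) hb0.le (hb4 n i)
    linarith
  · have := hc2 n i j 1 (by simp)
    simp only [pow_one] at this
    exact this.trans (mul_le_mul_of_nonneg_right (by linarith) (decay_nonneg hρ.1 _))
  · exact (hc4 n i j k l).trans (mul_le_mul_of_nonneg_right (by linarith) (decay_nonneg hρ.1 _))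
  · have hS : AEMeasurable (fun ω => s * ∑ j ∈ U, ε n j ω) (μ n) :=
      (Finset.aemeasurable_fun_sum _ fun j _ => hm n j).const_mul s
    have h1 := hcc n s i U
    have h2 := hcs n s i U
    rw [cov_bounded_comp (hL4 n i) (h0 n i) hS Real.continuous_cos Real.abs_cos_le_one] at h1
    rw [cov_bounded_comp (hL4 n i) (h0 n i) hS Real.continuous_sin Real.abs_sin_le_one] at h2
    refine (norm_integral_mul_cexp_le ((hL4 n i).integrable (by norm_num)) hS).trans
      ((add_le_add h1 h2).trans ?_)
    have h3 : 0 ≤ (1 + |s| * (U.card : ℝ)) * decay ρ (setDistance (d n) {i} U) :=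
      mul_nonneg (by positivity) (decay_nonneg hρ.1 _)
    calc _ = (cc + cs) * ((1 + |s| * (U.card : ℝ)) * decay ρ (setDistance (d n) {i} U)) := by ring
      _ ≤ (b ^ 4 + c + (cc + cs)) *
          ((1 + |s| * (U.card : ℝ)) * decay ρ (setDistance (d n) {i} U)) :=
        mul_le_mul_of_nonneg_right (by linarith) h3
      _ = _ := by ring

lemma formBounds_of_posSemidef {A : Matrix (Fin p) (Fin p) ℝ} {a b : ℝ}
    (h1 : (A - a • (1 : Matrix (Fin p) (Fin p) ℝ)).PosSemidef)
    (h2 : (b • (1 : Matrix (Fin p) (Fin p) ℝ) - A).PosSemidef) : FormBounds A a b := by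
  refine ⟨?_, fun x => ?_⟩
  · have h3 : (a • (1 : Matrix (Fin p) (Fin p) ℝ)).IsHermitian := by
      simp [IsHermitian]
    have := h1.1.add h3
    rwa [sub_add_cancel] at this
  · have h3 := h1.dotProduct_mulVec_nonneg x
    have h4 := h2.dotProduct_mulVec_nonneg x
    simp only [star_trivial, sub_mulVec, smul_mulVec, one_mulVec, dotProduct_sub,
      dotProduct_smul, smul_eq_mul] at h3 h4
    constructor <;> linarith

end

/-! ### Studentized estimation errors -/

section Studentized

variable {V : Type*} [Fintype V] {p : ℕ} {X : Matrix V (Fin p) ℝ}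

/-- Rescaled form of the normalized estimation error, for a sample of size `t`. -/
lemma studentized_eq {M : Matrix (Fin p) (Fin p) ℝ} (hM : M.IsHermitian)
    (hX : IsUnit (Xᵀ * X).det) (β : Fin p → ℝ) (e : V → ℝ) {t : ℝ} (ht : 0 < t) :
    studentized M X β (response X β e) =
      WithLp.toLp 2 (invSqrt (t⁻¹ • M) *ᵥ ((√t)⁻¹ • (Xᵀ *ᵥ e))) := by
  rw [studentized, gram_mulVec_olsEstimate_sub hX, invSqrt_smul hM (inv_nonneg.2 ht.le),
    Real.sqrt_inv, inv_inv, smul_mulVec, mulVec_smul, smul_smul,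
    mul_inv_cancel₀ (Real.sqrt_pos.2 ht).ne', one_smul]

lemma measurable_mulVec {α : Type*} [MeasurableSpace α] {m n : Type*} [Fintype n]
    {A : α → Matrix m n ℝ} (hA : ∀ i j, Measurable fun a => A a i j) {v : α → n → ℝ}
    (hv : Measurable v) : Measurable fun a => A a *ᵥ v a :=
  measurable_pi_lambda _ fun i => Finset.measurable_fun_sum _ fun j _ =>
    (hA i j).mul ((measurable_pi_apply j).comp hv)

lemma measurable_const_mulVec {α : Type*} [MeasurableSpace α] {m n : Type*} [Fintype n]
    (A : Matrix m n ℝ) {v : α → n → ℝ} (hv : Measurable v) : Measurable fun a => A *ᵥ v a :=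
  measurable_mulVec (A := fun _ => A) (fun _ _ => measurable_const) hv

lemma measurable_response (β : Fin p → ℝ) : Measurable fun e : V → ℝ => response X β e :=
  measurable_id.const_add _

lemma measurable_olsEstimate (β : Fin p → ℝ) :
    Measurable fun e : V → ℝ => olsEstimate X (response X β e) :=
  measurable_const_mulVec _ (measurable_const_mulVec _ (measurable_response β))

lemma measurable_plugIn_apply (d : V → V → ℝ≥0∞) (r : ℝ) (β : Fin p → ℝ) (k l : Fin p) :
    Measurable fun e : V → ℝ => plugIn d r X (response X β e) k l := by
  have hres : Measurable fun e : V → ℝ => residual X (response X β e) :=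
    (measurable_response β).sub (measurable_const_mulVec _ (measurable_olsEstimate β))
  simp only [plugIn_apply]
  exact Finset.measurable_fun_sum _ fun i _ => Finset.measurable_fun_sum _ fun j _ =>
    ((((measurable_pi_apply i).comp hres).const_mul _).mul
      ((measurable_pi_apply j).comp hres)).const_mul _

lemma measurable_studentized {M : (V → ℝ) → Matrix (Fin p) (Fin p) ℝ}
    (hM : ∀ k l, Measurable fun e => M e k l) (hH : ∀ e, (M e).IsHermitian) (β : Fin p → ℝ) :
    Measurable fun e : V → ℝ => studentized (M e) X β (response X β e) :=
  (WithLp.measurable_toLp 2 _).comp (measurable_mulVec (measurable_invSqrt hM hH)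
    (measurable_const_mulVec _ ((measurable_olsEstimate β).sub_const β)))

end Studentized

/-! ### Convergence to the standard Gaussian distribution -/

lemma tendstoInDistribution_stdGaussian {p : ℕ} {Ω : ℕ → Type*} [∀ n, MeasurableSpace (Ω n)]
    {μ : ∀ n, Measure (Ω n)} [∀ n, IsProbabilityMeasure (μ n)]
    {T : ∀ n, Ω n → EuclideanSpace ℝ (Fin p)} (hT : ∀ n, AEMeasurable (T n) (μ n))
    (h : ∀ a : EuclideanSpace ℝ (Fin p), Tendsto
      (fun n => ∫ ω, Complex.exp (Complex.I * ((inner ℝ (T n ω) a : ℝ) : ℂ)) ∂μ n) atTop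
      (𝓝 (Real.exp (-‖a‖ ^ 2 / 2) : ℝ))) :
    TendstoInDistribution T atTop (id : EuclideanSpace ℝ (Fin p) → EuclideanSpace ℝ (Fin p)) μ
      (stdGaussian (EuclideanSpace ℝ (Fin p))) := by
  refine ⟨hT, aemeasurable_id, ?_⟩
  refine ProbabilityMeasure.tendsto_iff_tendsto_charFun.2 fun a => ?_
  simp only [ProbabilityMeasure.coe_mk, Measure.map_id]
  rw [charFun_stdGaussian]
  have hlim := h a
  push_cast at hlim
  refine hlim.congr fun n => ?_
  rw [charFun_apply, integral_map (hT n) (by fun_prop)]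
  simp_rw [mul_comm Complex.I]

lemma norm_toLp_sq {p : ℕ} (v : Fin p → ℝ) : ‖WithLp.toLp 2 v‖ ^ 2 = v ⬝ᵥ v := by
  rw [EuclideanSpace.real_norm_sq_eq]
  simp only [dotProduct, sq]

/-- Characteristic functions at `a` of two random vectors `S z` and `S' z`, for matrices that are
entrywise within `κ` of each other. -/
lemma norm_cexp_inner_sub_le {p : ℕ} {S S' : Matrix (Fin p) (Fin p) ℝ} {κ : ℝ}
    (h : ∀ k l, |S k l - S' k l| ≤ κ) (hκ : 0 ≤ κ) (z : Fin p → ℝ)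
    (a : EuclideanSpace ℝ (Fin p)) :
    ‖Complex.exp (Complex.I * ((inner ℝ (WithLp.toLp 2 (S *ᵥ z)) a : ℝ) : ℂ)) -
      Complex.exp (Complex.I * ((inner ℝ (WithLp.toLp 2 (S' *ᵥ z)) a : ℝ) : ℂ))‖ ≤
      p * κ * ‖a‖ * (1 + z ⬝ᵥ z) := by
  set x := (inner ℝ (WithLp.toLp 2 (S *ᵥ z)) a : ℝ) with hx
  set y := (inner ℝ (WithLp.toLp 2 (S' *ᵥ z)) a : ℝ) with hy
  have e : Complex.exp (Complex.I * (x : ℂ)) - Complex.exp (Complex.I * (y : ℂ)) =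
      Complex.exp (Complex.I * (y : ℂ)) * (Complex.exp (Complex.I * ((x - y : ℝ) : ℂ)) - 1) := by
    rw [mul_sub, mul_one, ← Complex.exp_add]
    push_cast
    ring_nf
  have hxy : x - y = inner ℝ (WithLp.toLp 2 ((S - S') *ᵥ z)) a := by
    rw [hx, hy, ← inner_sub_left, sub_mulVec]
    rfl
  have hz := dotProduct_self_nonneg' z
  have hnorm : ‖WithLp.toLp 2 ((S - S') *ᵥ z)‖ ≤ p * κ * (1 + z ⬝ᵥ z) := by
    refine abs_le_of_sq_le_sq' ?_ (by positivity) |>.2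
    rw [norm_toLp_sq]
    calc ((S - S') *ᵥ z) ⬝ᵥ ((S - S') *ᵥ z) ≤ ∑ _k : Fin p, p * κ ^ 2 * (z ⬝ᵥ z) := by
          refine Finset.sum_le_sum fun k _ => ?_
          rw [← sq]
          exact mulVec_sq_le (fun k l => h k l) z k
      _ = (p * κ) ^ 2 * (z ⬝ᵥ z) := by simp; ring
      _ ≤ (p * κ * (1 + z ⬝ᵥ z)) ^ 2 := by
          rw [mul_pow (p * κ)]
          exact mul_le_mul_of_nonneg_left (by nlinarith) (sq_nonneg _)
  rw [e, norm_mul, norm_cexp_I_mul, one_mul]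
  refine (norm_cexp_sub_one_le _).trans ?_
  rw [hxy]
  refine (abs_real_inner_le_norm _ _).trans ?_
  calc _ ≤ (p * κ * (1 + z ⬝ᵥ z)) * ‖a‖ := mul_le_mul_of_nonneg_right hnorm (norm_nonneg _)
    _ = _ := by ring

namespace Regime

open DecayingField

variable {Ω : ℕ → Type*} [∀ n, MeasurableSpace (Ω n)]
    {μ : ∀ n, Measure (Ω n)} [∀ n, IsProbabilityMeasure (μ n)] {ε : ∀ n, Fin n → Ω n → ℝ}
    {d : ∀ n, Fin n → Fin n → ℝ≥0∞} {ρ c₁ c g : ℝ} {r : ℕ → ℝ}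
    {p : ℕ} {X : ∀ n, Matrix (Fin n) (Fin p) ℝ} {B a b : ℝ}

lemma aemeasurable_studentized (h : Regime μ ε d ρ c₁ c g r) (β : Fin p → ℝ) (n : ℕ)
    {M : (Fin n → ℝ) → Matrix (Fin p) (Fin p) ℝ} (hM : ∀ k l, Measurable fun e => M e k l)
    (hH : ∀ e, (M e).IsHermitian) :
    AEMeasurable (fun ω => studentized (M fun i => ε n i ω) (X n) β
      (response (X n) β fun i => ε n i ω)) (μ n) :=
  (measurable_studentized hM hH β).comp_aemeasurable
    (aemeasurable_pi_lambda _ (h.field n).aemeasurable)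

/-- The characteristic function of the estimation error, normalized by its covariance. -/
lemma tendsto_integral_exp_studentized (h : Regime μ ε d ρ c₁ c g r)
    (hB : ∀ n i k, |X n i k| ≤ B) (ha : 0 < a) (hV : ∀ᶠ n : ℕ in atTop,
      FormBounds ((n : ℝ)⁻¹ • ((X n)ᵀ * errCov (μ n) (ε n) * X n)) a b)
    (v : EuclideanSpace ℝ (Fin p)) :
    Tendsto (fun n : ℕ => ∫ ω, Complex.exp (Complex.I * ((inner ℝ (WithLp.toLp 2
        (invSqrt ((n : ℝ)⁻¹ • ((X n)ᵀ * errCov (μ n) (ε n) * X n)) *ᵥ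
          ((√(n : ℝ))⁻¹ • ((X n)ᵀ *ᵥ fun i => ε n i ω)))) v : ℝ) : ℂ)) ∂μ n) atTop
      (𝓝 (Real.exp (-‖v‖ ^ 2 / 2) : ℝ)) := by
  set S : ℕ → Matrix (Fin p) (Fin p) ℝ := fun n =>
    invSqrt ((n : ℝ)⁻¹ • ((X n)ᵀ * errCov (μ n) (ε n) * X n)) with hS
  set w : ∀ n, Fin n → ℝ := fun n => X n *ᵥ (S n *ᵥ ⇑v) with hw
  have hvv : (⇑v : Fin p → ℝ) ⬝ᵥ ⇑v = ‖v‖ ^ 2 := (norm_toLp_sq ⇑v).symm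
  -- the weights `w n` have the variance `‖v‖ ^ 2` after normalization
  have hform : ∀ᶠ n : ℕ in atTop, (S n *ᵥ ⇑v) ⬝ᵥ
      (((n : ℝ)⁻¹ • ((X n)ᵀ * errCov (μ n) (ε n) * X n)) *ᵥ (S n *ᵥ ⇑v)) = ‖v‖ ^ 2 :=
    hV.mono fun n hV => by
      rw [dotProduct_comm, dotProduct_mulVec, ← mulVec_transpose]
      simp only [hS]
      rw [invSqrt_isSymm, mulVec_mulVec, mulVec_mulVec, invSqrt_mul_mul_invSqrt hV ha,
        one_mulVec, hvv]
  have hvar : ∀ᶠ n : ℕ in atTop, sumVar (μ n) (ε n) (w n) / n = ‖v‖ ^ 2 :=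
    hform.mono fun n hn => by
      rwa [smul_mulVec, dotProduct_smul, dotProduct_mulVec_cov, smul_eq_mul, inv_mul_eq_div] at hn
  have hbd : ∀ᶠ n : ℕ in atTop, ∀ i, |w n i| ≤ √(p * B ^ 2 * (‖v‖ ^ 2 / a)) + 1 := by
    filter_upwards [hV, hform] with n hV hn i
    refine (Real.abs_le_sqrt ?_).trans (le_add_of_nonneg_right zero_le_one)
    refine (mulVec_sq_le (hB n) _ i).trans (mul_le_mul_of_nonneg_left ?_ (by positivity))
    rw [le_div_iff₀ ha, mul_comm, ← hn]
    exact (hV.2 _).1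
  have key := h.tendsto_of_weights_bounded (by positivity) hbd 1
  have hlim : Tendsto (fun n : ℕ =>
      ((Real.exp (-(sumVar (μ n) (ε n) (w n) / n * 1 ^ 2 / 2)) : ℝ) : ℂ)) atTop
      (𝓝 (Real.exp (-‖v‖ ^ 2 / 2) : ℝ)) := by
    refine tendsto_const_nhds.congr' (hvar.mono fun n hn => ?_)
    simp only [hn, one_pow, mul_one, neg_div]
  have := key.add hlim
  simp only [sub_add_cancel, zero_add] at this
  refine this.congr fun n => ?_
  refine integral_congr_ae (.of_forall fun ω => ?_)
  have e : (inner ℝ (WithLp.toLp 2 (S n *ᵥ ((√(n : ℝ))⁻¹ • ((X n)ᵀ *ᵥ fun i => ε n i ω)))) v : ℝ) =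
      1 / √n * ∑ j, w n j * ε n j ω := by
    rw [EuclideanSpace.inner_eq_star_dotProduct, star_trivial, dotProduct_mulVec,
      ← mulVec_transpose, hS, invSqrt_isSymm, dotProduct_smul, dotProduct_mulVec, vecMul_transpose,
      one_div]
    rfl
  simp only
  rw [← e]

/-- The linear statistic `Xᵀε / √n` has bounded second moments. -/
lemma integral_linear_sq_le (h : Regime μ ε d ρ c₁ c g r) (hB : ∀ n i k, |X n i k| ≤ B)
    {n : ℕ} (hn : 0 < n) :
    Integrable (fun ω => ((√(n : ℝ))⁻¹ • ((X n)ᵀ *ᵥ fun i => ε n i ω)) ⬝ᵥ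
      ((√(n : ℝ))⁻¹ • ((X n)ᵀ *ᵥ fun i => ε n i ω))) (μ n) ∧
    ∫ ω, ((√(n : ℝ))⁻¹ • ((X n)ᵀ *ᵥ fun i => ε n i ω)) ⬝ᵥ
      ((√(n : ℝ))⁻¹ • ((X n)ᵀ *ᵥ fun i => ε n i ω)) ∂μ n ≤
      p * (B ^ 2 * (c * layerConst ρ c₁ g)) := by
  have hn' : (0 : ℝ) < n := by exact_mod_cast hn
  have e : ∀ ω, ((√(n : ℝ))⁻¹ • ((X n)ᵀ *ᵥ fun i => ε n i ω)) ⬝ᵥ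
      ((√(n : ℝ))⁻¹ • ((X n)ᵀ *ᵥ fun i => ε n i ω)) =
      (n : ℝ)⁻¹ * ∑ k, (∑ i, X n i k * ε n i ω) ^ 2 := fun ω => by
    rw [smul_dotProduct, dotProduct_smul, smul_smul, ← mul_inv, Real.mul_self_sqrt hn'.le]
    simp only [dotProduct, mulVec, transpose_apply, ← sq, smul_eq_mul]
  simp_rw [e]
  refine ⟨(integrable_finsetSum _ fun k _ => (h.field n).integrable_sq_sum _).const_mul _, ?_⟩
  rw [integral_const_mul, integral_finsetSum _ fun k _ => (h.field n).integrable_sq_sum _]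
  simp_rw [(h.field n).integral_sq_sum]
  rw [inv_mul_le_iff₀ hn']
  calc _ ≤ ∑ _k : Fin p, B ^ 2 * (c * layerConst ρ c₁ g * n) :=
        Finset.sum_le_sum fun k _ => h.sumVar_le fun i => hB n i k
    _ = _ := by simp; ring

/-- The estimation error normalized by the true covariance is asymptotically Gaussian. -/
lemma tendstoInDistribution_studentized (h : Regime μ ε d ρ c₁ c g r)
    (hB : ∀ n i k, |X n i k| ≤ B) (ha : 0 < a) (hV : ∀ᶠ n : ℕ in atTop,
      FormBounds ((n : ℝ)⁻¹ • ((X n)ᵀ * errCov (μ n) (ε n) * X n)) a b) (β : Fin p → ℝ) :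
    TendstoInDistribution
      (fun n ω => studentized ((X n)ᵀ * errCov (μ n) (ε n) * X n) (X n) β
        (response (X n) β fun i => ε n i ω))
      atTop (id : EuclideanSpace ℝ (Fin p) → EuclideanSpace ℝ (Fin p)) μ
      (stdGaussian (EuclideanSpace ℝ (Fin p))) := by
  have hsymm : ∀ n, ((X n)ᵀ * errCov (μ n) (ε n) * X n).IsHermitian := fun n => by
    ext k l
    rw [conjTranspose_apply, star_trivial, cov_apply, cov_apply, Finset.sum_comm]
    refine Finset.sum_congr rfl fun i _ => Finset.sum_congr rfl fun j _ => ?_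
    rw [errCov_comm j i]
    ring
  refine tendstoInDistribution_stdGaussian (fun n => h.aemeasurable_studentized β n
    (M := fun _ => (X n)ᵀ * errCov (μ n) (ε n) * X n) (fun _ _ => measurable_const)
    fun _ => hsymm n) fun v => ?_
  refine (h.tendsto_integral_exp_studentized hB ha hV v).congr' ?_
  obtain ⟨κ, hκ, hX⟩ := h.exists_gram_lower_bound hB ha hV
  filter_upwards [hX, eventually_gt_atTop 0] with n hX hn
  have hn' : (0 : ℝ) < n := by exact_mod_cast hn
  simp_rw [studentized_eq (hsymm n) (isUnit_det_gram (mul_pos hκ hn') hX) β _ hn']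

/-- A plug-in estimate of `XᵀΣX / n` that is close to its target has its spectrum in a fixed compact
interval of positive numbers. -/
lemma plugIn_formBounds_of_close {n : ℕ} (hd : IsDistance (d n)) {η : ℝ}
    (hη : p * η ≤ a / 2) {ω : Ω n} (β : Fin p → ℝ)
    (hV : FormBounds ((n : ℝ)⁻¹ • ((X n)ᵀ * errCov (μ n) (ε n) * X n)) a b)
    (hclose : ∀ k l, |((n : ℝ)⁻¹ • ((X n)ᵀ * errCov (μ n) (ε n) * X n)) k l -
      ((n : ℝ)⁻¹ • plugIn (d n) (r n) (X n) (response (X n) β fun i => ε n i ω)) k l| ≤ η) :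
    FormBounds ((n : ℝ)⁻¹ • plugIn (d n) (r n) (X n) (response (X n) β fun i => ε n i ω))
      (a / 2) (b + a / 2) := by
  refine (hV.of_close ?_ hclose).mono (by linarith) (by linarith)
  have := plugIn_isHermitian hd (r n) (X n) (response (X n) β fun i => ε n i ω)
  rw [IsHermitian, conjTranspose_smul, this, star_trivial]

lemma exists_pos_mul_le (p : ℕ) {x : ℝ} (hx : 0 < x) : ∃ η > 0, p * η ≤ x := by
  refine ⟨x / (p + 1), by positivity, ?_⟩
  rw [mul_div_assoc', div_le_iff₀ (by positivity)]
  nlinarith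

lemma tendsto_measure_posDef (h : Regime μ ε d ρ c₁ c g r) (hB : ∀ n i k, |X n i k| ≤ B)
    (ha : 0 < a) (hV : ∀ᶠ n : ℕ in atTop,
      FormBounds ((n : ℝ)⁻¹ • ((X n)ᵀ * errCov (μ n) (ε n) * X n)) a b) (β : Fin p → ℝ) :
    Tendsto (fun n => μ n {ω | (plugIn (d n) (r n) (X n)
      (response (X n) β fun i => ε n i ω)).PosDef}) atTop (𝓝 1) := by
  obtain ⟨R, hR0, hRi, hRlim, hR⟩ := h.exists_plugIn_error hB ha hV β
  obtain ⟨η, hη, hpη⟩ := exists_pos_mul_le p (half_pos ha)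
  have hlim : Tendsto (fun n => 1 - ENNReal.ofReal ((∫ ω, R n ω ∂μ n) / η)) atTop (𝓝 1) := by
    have := ENNReal.Tendsto.sub (tendsto_const_nhds (x := (1 : ℝ≥0∞)))
      (ENNReal.tendsto_ofReal (hRlim.div_const η)) (.inl ENNReal.one_ne_top)
    simpa using this
  refine tendsto_of_tendsto_of_tendsto_of_le_of_le' hlim tendsto_const_nhds ?_
    (.of_forall fun n => prob_le_one)
  filter_upwards [hV, hR, eventually_gt_atTop 0] with n hV hR hn
  have hn' : (0 : ℝ) < n := by exact_mod_cast hn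
  set G := {ω | (plugIn (d n) (r n) (X n) (response (X n) β fun i => ε n i ω)).PosDef} with hG
  have hsub : Gᶜ ⊆ {ω | η ≤ R n ω} := fun ω hω => by
    by_contra hlt
    rw [Set.mem_ofPred_eq, not_le] at hlt
    refine hω ?_
    have hpos := (plugIn_formBounds_of_close (h.field n).isDistance hpη β hV
      fun k l => (hR ω k l).trans hlt.le).posDef (half_pos ha)
    have := hpos.smul hn'
    rwa [smul_smul, mul_inv_cancel₀ hn'.ne', one_smul] at this
  have hmark : μ n {ω | η ≤ R n ω} ≤ ENNReal.ofReal ((∫ ω, R n ω ∂μ n) / η) := by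
    have := mul_meas_ge_le_integral_of_nonneg (.of_forall (hR0 n)) (hRi n) η
    rw [← ofReal_measureReal]
    refine ENNReal.ofReal_le_ofReal ?_
    rwa [le_div_iff₀ hη, mul_comm]
  rw [tsub_le_iff_right]
  calc (1 : ℝ≥0∞) = μ n (G ∪ Gᶜ) := by rw [Set.union_compl_self, measure_univ]
    _ ≤ μ n G + μ n Gᶜ := measure_union_le _ _
    _ ≤ _ := add_le_add le_rfl ((measure_mono hsub).trans hmark)

/-- The estimation error normalized by the plug-in estimator is asymptotically Gaussian. -/
lemma tendstoInDistribution_studentized_plugIn (h : Regime μ ε d ρ c₁ c g r)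
    (hB : ∀ n i k, |X n i k| ≤ B) (ha : 0 < a) (hV : ∀ᶠ n : ℕ in atTop,
      FormBounds ((n : ℝ)⁻¹ • ((X n)ᵀ * errCov (μ n) (ε n) * X n)) a b) (β : Fin p → ℝ) :
    TendstoInDistribution
      (fun n ω => studentized
        (plugIn (d n) (r n) (X n) (response (X n) β fun i => ε n i ω)) (X n) β
        (response (X n) β fun i => ε n i ω))
      atTop (id : EuclideanSpace ℝ (Fin p) → EuclideanSpace ℝ (Fin p)) μ
      (stdGaussian (EuclideanSpace ℝ (Fin p))) := by
  have hsymm : ∀ n e, (plugIn (d n) (r n) (X n) (response (X n) β e)).IsHermitian :=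
    fun n e => plugIn_isHermitian (h.field n).isDistance _ _ _
  have hmeas : ∀ n, AEMeasurable (fun ω => studentized
      (plugIn (d n) (r n) (X n) (response (X n) β fun i => ε n i ω)) (X n) β
      (response (X n) β fun i => ε n i ω)) (μ n) := fun n => h.aemeasurable_studentized β n
    (M := fun e => plugIn (d n) (r n) (X n) (response (X n) β e))
    (fun k l => measurable_plugIn_apply _ _ β k l) (hsymm n)
  refine tendstoInDistribution_stdGaussian hmeas fun v => ?_
  have hlin := h.tendsto_integral_exp_studentized hB ha hV v
  obtain ⟨κ₀, hκ₀, hX⟩ := h.exists_gram_lower_bound hB ha hV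
  obtain ⟨R, hR0, hRi, hRlim, hR⟩ := h.exists_plugIn_error hB ha hV β
  set K := p * (B ^ 2 * (c * layerConst ρ c₁ g)) with hK
  have hK0 : 0 ≤ K := by
    have := (h.field 0).const_nonneg
    have := layerConst_nonneg (g := g) h.rate_lt
    positivity
  set Z : ∀ n, Ω n → Fin p → ℝ := fun n ω => (√(n : ℝ))⁻¹ • ((X n)ᵀ *ᵥ fun i => ε n i ω) with hZ
  set F : ∀ n, Ω n → ℂ := fun n ω => Complex.exp (Complex.I * ((inner ℝ (studentized
      (plugIn (d n) (r n) (X n) (response (X n) β fun i => ε n i ω)) (X n) β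
      (response (X n) β fun i => ε n i ω)) v : ℝ) : ℂ)) with hF
  set F' : ∀ n, Ω n → ℂ := fun n ω => Complex.exp (Complex.I * ((inner ℝ (WithLp.toLp 2
        (invSqrt ((n : ℝ)⁻¹ • ((X n)ᵀ * errCov (μ n) (ε n) * X n)) *ᵥ Z n ω)) v : ℝ) : ℂ)) with hF'
  suffices hdiff : Tendsto (fun n => ∫ ω, F n ω ∂μ n - ∫ ω, F' n ω ∂μ n) atTop (𝓝 0) by
    have := hdiff.add hlin
    rw [zero_add] at this
    exact this.congr fun n => sub_add_cancel _ _
  have hFi : ∀ n, Integrable (F n) (μ n) := fun n => by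
    refine Integrable.of_bound (C := 1) ?_ (.of_forall fun ω => (norm_cexp_I_mul _).le)
    have hm : AEMeasurable (fun ω => (inner ℝ (studentized
      (plugIn (d n) (r n) (X n) (response (X n) β fun i => ε n i ω)) (X n) β
      (response (X n) β fun i => ε n i ω)) v : ℝ)) (μ n) := (hmeas n).inner_const
    exact (Complex.measurable_exp.comp_aemeasurable
      ((Complex.measurable_ofReal.comp_aemeasurable hm).const_mul _)).aestronglyMeasurable
  have hF'i : ∀ n, Integrable (F' n) (μ n) := fun n => by
    refine Integrable.of_bound (C := 1) ?_ (.of_forall fun ω => (norm_cexp_I_mul _).le)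
    have hε := aemeasurable_pi_lambda (fun ω i => ε n i ω) (h.field n).aemeasurable
    have hm : Measurable fun e : Fin n → ℝ => (inner ℝ (WithLp.toLp 2
        (invSqrt ((n : ℝ)⁻¹ • ((X n)ᵀ * errCov (μ n) (ε n) * X n)) *ᵥ
          ((√(n : ℝ))⁻¹ • ((X n)ᵀ *ᵥ e)))) v : ℝ) := by
      have hlin : Measurable fun e : Fin n → ℝ => (√(n : ℝ))⁻¹ • ((X n)ᵀ *ᵥ e) :=
        (measurable_const_mulVec (X n)ᵀ measurable_id).const_smul (√(n : ℝ))⁻¹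
      exact Measurable.inner_const ((WithLp.measurable_toLp 2 _).comp
        (measurable_const_mulVec _ hlin))
    exact (Complex.measurable_exp.comp_aemeasurable ((Complex.measurable_ofReal.comp_aemeasurable
      (hm.comp_aemeasurable hε)).const_mul _)).aestronglyMeasurable
  rw [Metric.tendsto_nhds]
  intro δ hδ
  -- the accuracy `κ` required of the inverse square root
  obtain ⟨κ, hκ, hκδ⟩ : ∃ κ > 0, p * κ * ‖v‖ * (1 + K) < δ / 2 := by
    refine ⟨δ / 2 / (p * ‖v‖ * (1 + K) + 1), by positivity, ?_⟩
    rw [show p * (δ / 2 / (p * ‖v‖ * (1 + K) + 1)) * ‖v‖ * (1 + K) =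
      δ / 2 * (p * ‖v‖ * (1 + K)) / (p * ‖v‖ * (1 + K) + 1) by ring, div_lt_iff₀ (by positivity)]
    nlinarith
  obtain ⟨η₁, hη₁, hpη⟩ := exists_pos_mul_le p (half_pos ha)
  obtain ⟨η₂, hη₂, hinv⟩ := exists_invSqrt_sub_le (p := p) (half_pos ha) (b + a / 2) hκ
  set η := min η₁ η₂ with hη
  have hη0 : 0 < η := lt_min hη₁ hη₂
  have hsmall : ∀ᶠ n in atTop, 2 / η * ∫ ω, R n ω ∂μ n < δ / 2 := by
    have := hRlim.const_mul (2 / η)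
    rw [mul_zero] at this
    exact this.eventually_lt_const (half_pos hδ)
  filter_upwards [hV, hR, hX, hsmall, eventually_gt_atTop 0] with n hV hR hX hsmall hn
  have hn' : (0 : ℝ) < n := by exact_mod_cast hn
  obtain ⟨hZi, hZle⟩ := h.integral_linear_sq_le hB hn
  have hpt : ∀ ω, ‖F n ω - F' n ω‖ ≤
      p * κ * ‖v‖ * (1 + Z n ω ⬝ᵥ Z n ω) + 2 / η * R n ω := fun ω => by
    have hz := dotProduct_self_nonneg' (Z n ω)
    rcases lt_or_ge (R n ω) η with hlt | hge
    -- the estimator is close to its target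
    · have hcl : ∀ k l, |((n : ℝ)⁻¹ • ((X n)ᵀ * errCov (μ n) (ε n) * X n)) k l -
          ((n : ℝ)⁻¹ • plugIn (d n) (r n) (X n) (response (X n) β fun i => ε n i ω)) k l| < η :=
        fun k l => (hR ω k l).trans_lt hlt
      have hfb := plugIn_formBounds_of_close (h.field n).isDistance hpη β hV
        fun k l => ((hcl k l).trans_le (min_le_left _ _)).le
      have hS := hinv _ _ (hV.mono (half_le_self ha.le) (le_add_of_nonneg_right (half_pos ha).le))
        hfb fun k l => (hcl k l).trans_le (min_le_right _ _)
      have h1 := norm_cexp_inner_sub_le hS hκ.le (Z n ω) v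
      have h2 : 0 ≤ 2 / η * R n ω := mul_nonneg (by positivity) (hR0 n ω)
      rw [norm_sub_rev]
      simp only [hF]
      rw [studentized_eq (hsymm n _) (isUnit_det_gram (mul_pos hκ₀ hn') hX) β _ hn']
      exact h1.trans (le_add_of_nonneg_right h2)
    -- on the complement the trivial bound suffices, by Markov's inequality
    · have h1 : ‖F n ω - F' n ω‖ ≤ 2 := by
        refine (norm_sub_le _ _).trans ?_
        rw [norm_cexp_I_mul, norm_cexp_I_mul]
        norm_num
      have h2 : 2 ≤ 2 / η * R n ω := by
        rw [div_mul_eq_mul_div, le_div_iff₀ hη0]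
        linarith
      have h3 : 0 ≤ p * κ * ‖v‖ * (1 + Z n ω ⬝ᵥ Z n ω) := by positivity
      linarith
  have hZi' : Integrable (fun ω => p * κ * ‖v‖ * (1 + Z n ω ⬝ᵥ Z n ω)) (μ n) :=
    ((integrable_const _).add hZi).const_mul _
  have hone : Integrable (fun _ : Ω n => (1 : ℝ)) (μ n) := integrable_const _
  rw [dist_zero_right, ← integral_sub (hFi n) (hF'i n)]
  calc ‖∫ ω, F n ω - F' n ω ∂μ n‖ ≤
        ∫ ω, p * κ * ‖v‖ * (1 + Z n ω ⬝ᵥ Z n ω) + 2 / η * R n ω ∂μ n :=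
        norm_integral_le_of_norm_le (hZi'.add ((hRi n).const_mul _)) (.of_forall hpt)
    _ = p * κ * ‖v‖ * (1 + ∫ ω, Z n ω ⬝ᵥ Z n ω ∂μ n) + 2 / η * ∫ ω, R n ω ∂μ n := by
        rw [integral_add hZi' ((hRi n).const_mul _), integral_const_mul, integral_const_mul,
          integral_add hone hZi, integral_const, probReal_univ, one_smul]
    _ ≤ p * κ * ‖v‖ * (1 + K) + 2 / η * ∫ ω, R n ω ∂μ n := by
        gcongr
    _ < δ := by linarith

end Regime

end NetReg

open NetReg
theorem theorem1 (ρ c₁ : ℝ) (hρ : ρ ∈ Set.Ioo (0 : ℝ) 1) (hc₁ : 0 < c₁)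
    (hrate : 2 * c₁ < Real.log ρ⁻¹) :
    ∃ C : ℝ, 0 < C ∧
      ∀ (p : ℕ) (Ω : ℕ → Type*) [∀ n, MeasurableSpace (Ω n)]
        (μ : ∀ n, Measure (Ω n)) [∀ n, IsProbabilityMeasure (μ n)]
        (X : ∀ n, Matrix (Fin n) (Fin p) ℝ) (β : Fin p → ℝ)
        (ε : ∀ n, Fin n → Ω n → ℝ)
        (d : ∀ n, Fin n → Fin n → ℝ≥0∞),
        (∀ n i, AEMeasurable (ε n i) (μ n)) →
        (∀ n i, ∫ ω, ε n i ω ∂(μ n) = 0) →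
        (∀ n, IsDistance (d n)) →
        BoundedModel μ X ε →
        CorrelationDecay μ ε d ρ →
        NeighborhoodGrowth d c₁ →
        -- part (a)
        TendstoInDistribution
          (fun n ω => studentized ((X n)ᵀ * errCov (μ n) (ε n) * X n) (X n) β
            (response (X n) β (fun i => ε n i ω)))
          atTop (id : EuclideanSpace ℝ (Fin p) → EuclideanSpace ℝ (Fin p)) μ
          (stdGaussian (EuclideanSpace ℝ (Fin p))) ∧
        -- part (b): the estimator is positive definite with probability tending to one
        Tendsto (fun n => μ n {ω | (plugIn (d n) (C * Real.log n) (X n)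
          (response (X n) β (fun i => ε n i ω))).PosDef}) atTop (𝓝 1) ∧
        TendstoInDistribution
          (fun n ω => studentized
            (plugIn (d n) (C * Real.log n) (X n) (response (X n) β (fun i => ε n i ω)))
            (X n) β (response (X n) β (fun i => ε n i ω)))
          atTop (id : EuclideanSpace ℝ (Fin p) → EuclideanSpace ℝ (Fin p)) μ
          (stdGaussian (EuclideanSpace ℝ (Fin p))) := by
  refine ⟨radiusConst ρ c₁, radiusConst_pos hc₁ hrate, ?_⟩
  intro p Ω _ μ _ X β ε d hm h0 hd hb hcorr hg
  obtain ⟨c, g, h⟩ := exists_regime hρ hc₁ hrate hm h0 hd hb hcorr hg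
  obtain ⟨B, hB0, hB, -, hV⟩ := hb
  have hV' := hV.mono fun n hn => formBounds_of_posSemidef hn.1 hn.2
  have ha : 0 < B⁻¹ := inv_pos.2 hB0
  exact ⟨h.tendstoInDistribution_studentized hB ha hV' β, h.tendsto_measure_posDef hB ha hV' β,
    h.tendstoInDistribution_studentized_plugIn hB ha hV' β⟩
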